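/- Let $K$ be an algebraically closed field. Algebras are associative $K$-algebras with $1$, modules are right modules, and in a path $\alpha\beta$ the arrow $\alpha$ comes first. **Triangulation quivers of surfaces.** Let $S$ be a surface, i.e. a compact connected $2$-dimensional topological manifold, orientable or not, with or without boundary $\partial S$. Let $T$ be a triangulation of $S$ with at least two edges: $S$ is obtained from finitely many triangles by gluing pairs of their sides (two sides of the same triangle may be glued), and the edges given by unglued sides are exactly those contained in $\partial S$. Let $\vec T$ be an arbitrary choice of an orientation (cyclic order of the three sides) of each triangle of $T$. The quiver $Q=Q(S,\vec T)$ has the edges of $T$ as vertices; each oriented triangle with sides $a,b,c$ in cyclic order gives arrows $a\to b\to c\to a$, which the permutation $f$ of the arrows permutes cyclically in this order, and each boundary edge gives a loop, which $f$ fixes (a *border loop*; its vertex is a *border vertex*). Exactly two arrows start at each vertex; $\bar\alpha$ denotes the arrow $\neq\alpha$ with the same source $s(\bar\alpha)=s(\alpha)$. Put $g(\alpha)=\overline{f(\alpha)}$ and let $n_\alpha$ be the size of the $g$-orbit of $\alpha$. **The algebras.** A weight function $m_\bullet$ and a parameter function $c_\bullet$ assign to each arrow $\alpha$ an integer $m_\alpha\ge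 1$ and a scalar $c_\alpha\in K\setminus\{0\}$, constant on $g$-orbits. An arrow $\alpha$ is *virtual* if $m_\alpha n_\alpha=2$. It is required that $m_\alpha n_\alpha\ge 2$ for all $\alpha$, that $m_\alpha n_\alpha\ge 3$ if $\bar\alpha$ is virtual and not a loop, and that $m_\alpha n_\alpha\ge 4$ if $\bar\alpha$ is a virtual loop. Let $A_\alpha=\alpha g(\alpha)\cdots g^{m_\alpha n_\alpha-2}(\alpha)$ and $B_\alpha=\alpha g(\alpha)\cdots g^{m_\alpha n_\alpha-1}(\alpha)$. A border function $b_\bullet$ assigns a scalar $b_i\in K$ to each border vertex $i$. The algebra $\Lambda(S,\vec T,m_\bullet,c_\bullet,b_\bullet)$ is the quotient of the path algebra $KQ$ by the ideal generated by 1. $\alpha f(\alpha)-c_{\bar\alpha}A_{\bar\alpha}$ for all arrows $\alpha$ that are not border loops; 2. $\alpha^2-c_{\bar\alpha}A_{\bar\alpha}-b_{s(\alpha)}B_{\bar\alpha}$ for all border loops $\alpha$; 3. $\alpha f(\alpha)g(f(\alpha))$ for all arrows $\alpha$, except if $f^2(\alpha)$ is virtual, or $f(\bar\alpha)$ is virtual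 and $m_{\bar\alpha}=1$, $n_{\bar\alpha}=3$; 4. $\alpha g(\alpha)f(g(\alpha))$ for all arrows $\alpha$, except if $f(\alpha)$ is virtual, or $f^2(\alpha)$ is virtual and $m_{f(\alpha)}=1$, $n_{f(\alpha)}=3$. The *weighted surface algebra* $\Lambda(S,\vec T,m_\bullet,c_\bullet)$ is defined in the same way with all $b_i=0$. The *singular disc algebra* $D(1)$ is the one given by the quiver with vertices $1,2$, loops $\alpha$ at $1$ and $\sigma$ at $2$, arrows $\beta:1\to2$, $\gamma:2\to1$, $f=(\alpha)(\beta\,\sigma\,\gamma)$, $g=(\alpha\,\beta\,\gamma)(\sigma)$, $m_\alpha=1$, $m_\sigma=3$, $c_\alpha=c_\sigma=1$. **Socle equivalence.** Two self-injective algebras $A$ and $B$ are *socle equivalent* if the algebras $A/\operatorname{soc}(A)$ and $B/\operatorname{soc}(B)$ are isomorphic. **Theorem.** Let $\Lambda(S,\vec T,m_\bullet,c_\bullet)$ be a weighted surface algebra that is not isomorphic to $D(1)$. Let $A$ be a finite-dimensional, basic, indecomposable, symmetric $K$-algebra whose Grothendieck group $K_0(A)$ has rank at least $2$. Assume that $A$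 and $\Lambda(S,\vec T,m_\bullet,c_\bullet)$ are socle equivalent (in particular, both are self-injective). (i) If $\partial S=\emptyset$, then $A\cong\Lambda(S,\vec T,m_\bullet,c_\bullet)$ as $K$-algebras. (ii) If $\partial S\neq\emptyset$, then $A\cong\Lambda(S,\vec T,m_\bullet,c_\bullet,b_\bullet)$ as $K$-algebras for some border function $b_\bullet$. -/

import Mathlib

open scoped Manifold

/-! ## Finite-dimensional algebras -/

namespace FDAlgebra

universe u v w

/-- An idempotent `e ≠ 0` that is not a sum of two nonzero orthogonal idempotents. -/
def IsPrimitiveIdempotent {A : Type u} [Ring A] (e : A) : Prop :=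
  IsIdempotentElem e ∧ e ≠ 0 ∧
    ∀ e₁ e₂ : A, IsIdempotentElem e₁ → IsIdempotentElem e₂ → e₁ * e₂ = 0 → e₂ * e₁ = 0 →
      e = e₁ + e₂ → e₁ = 0 ∨ e₂ = 0

/-- `A` is basic: `1 = e₁ + ⋯ + eₙ` with orthogonal primitive idempotents such that the right
modules `eᵢ A` are pairwise non-isomorphic. -/
def IsBasic (A : Type u) [Ring A] : Prop :=
  ∃ (n : ℕ) (e : Fin n → A), CompleteOrthogonalIdempotents e ∧
    (∀ i, IsPrimitiveIdempotent (e i)) ∧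
    ∀ i j, i ≠ j →
      IsEmpty ((Submodule.span Aᵐᵒᵖ {e i}) ≃ₗ[Aᵐᵒᵖ] (Submodule.span Aᵐᵒᵖ {e j}))

/-- `A` is nonzero and is not a product of two nonzero algebras: its only central idempotents
are `0` and `1`. -/
def IsIndecomposable (A : Type u) [Ring A] : Prop :=
  Nontrivial A ∧ ∀ e : A, IsIdempotentElem e → (∀ a : A, e * a = a * e) → e = 0 ∨ e = 1

/-- `A` is a symmetric `K`-algebra: it has a nondegenerate, associative, symmetric bilinear
form. -/
def IsSymmetricAlgebra (K : Type v) (A : Type u) [Field K] [Ring A] [Algebra K A] : Prop :=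
  ∃ B : LinearMap.BilinForm K A, B.Nondegenerate ∧ (∀ a b, B a b = B b a) ∧
    ∀ a b c, B (a * b) c = B a (b * c)

/-- `A` is self-injective: the right regular module `A` is injective. -/
def IsSelfInjective (A : Type u) [Ring A] : Prop :=
  Module.Injective.{u, u} Aᵐᵒᵖ A

/-- The socle of the right regular module `A`, the sum of the simple right ideals. -/
def rightSocle (A : Type u) [Ring A] : Submodule Aᵐᵒᵖ A :=
  sSup {N : Submodule Aᵐᵒᵖ A | IsSimpleModule Aᵐᵒᵖ N}

/-- Left multiplication by `a`, as an endomorphism of the right regular module. -/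
def leftMul {A : Type u} [Ring A] (a : A) : A →ₗ[Aᵐᵒᵖ] A where
  toFun x := a * x
  map_add' x y := mul_add a x y
  map_smul' r x := by simp [mul_assoc]

theorem mul_mem_rightSocle {A : Type u} [Ring A] (a : A) {x : A} (hx : x ∈ rightSocle A) :
    a * x ∈ rightSocle A := by
  have key : rightSocle A ≤ (rightSocle A).comap (leftMul a) := by
    refine sSup_le fun N hN => ?_
    have : IsSimpleModule Aᵐᵒᵖ N := hN
    rcases LinearMap.injective_or_eq_zero ((leftMul a).comp N.subtype) with h | h
    · rw [← Submodule.map_le_iff_le_comap]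
      refine le_sSup ?_
      have e : N ≃ₗ[Aᵐᵒᵖ] N.map (leftMul a) :=
        (LinearEquiv.ofInjective _ h).trans
          (LinearEquiv.ofEq _ _ (by rw [LinearMap.range_comp, Submodule.range_subtype]))
      exact IsSimpleModule.congr e.symm
    · intro y hy
      have := LinearMap.congr_fun h ⟨y, hy⟩
      simp only [LinearMap.comp_apply, Submodule.subtype_apply, LinearMap.zero_apply] at this
      rw [Submodule.mem_comap, this]
      exact Submodule.zero_mem _
  exact key hx

/-- The socle `soc(A)`, which is a two-sided ideal, as an ideal of `A`. -/
def socle (A : Type u) [Ring A] : Ideal A where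
  carrier := rightSocle A
  add_mem' := Submodule.add_mem _
  zero_mem' := Submodule.zero_mem _
  smul_mem' a _ hx := mul_mem_rightSocle a hx

instance socle_isTwoSided (A : Type u) [Ring A] : (socle A).IsTwoSided :=
  ⟨fun b ha => (rightSocle A).smul_mem (MulOpposite.op b) ha⟩

/-- Two self-injective algebras `A` and `B` are socle equivalent if the algebras `A / soc(A)` and
`B / soc(B)` are isomorphic. -/
def SocleEquivalent (K : Type v) (A : Type u) (B : Type w) [Field K] [Ring A] [Algebra K A]
    [Ring B] [Algebra K B] : Prop :=
  IsSelfInjective A ∧ IsSelfInjective B ∧ Nonempty ((A ⧸ socle A) ≃ₐ[K] (B ⧸ socle B))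

/-- Finitely generated right `A`-modules. -/
abbrev FGRightModule (A : Type u) [Ring A] : Type (u + 1) :=
  {M : ModuleCat.{u} Aᵐᵒᵖ // Module.Finite Aᵐᵒᵖ M}

/-- The elements `[M] - [M'] - [M'']` for short exact sequences `0 → M' → M → M'' → 0` of finitely
generated right `A`-modules. -/
def shortExactRelators (A : Type u) [Ring A] : Set (FreeAbelianGroup (FGRightModule A)) :=
  {x | ∃ (M' M M'' : FGRightModule A) (i : M'.1 →ₗ[Aᵐᵒᵖ] M.1) (p : M.1 →ₗ[Aᵐᵒᵖ] M''.1),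
    Function.Injective i ∧ Function.Exact i p ∧ Function.Surjective p ∧
    x = FreeAbelianGroup.of M - FreeAbelianGroup.of M' - FreeAbelianGroup.of M''}

/-- The Grothendieck group `K₀(A)` of the category of finitely generated right `A`-modules. -/
abbrev GrothendieckGroup (A : Type u) [Ring A] : Type (u + 1) :=
  FreeAbelianGroup (FGRightModule A) ⧸ AddSubgroup.closure (shortExactRelators A)

end FDAlgebra

/-! ## Triangulation quivers -/

/-- A triangulation quiver `(Q, f)`: a finite connected `2`-regular quiver with at least two
vertices and a permutation `f` of the arrows with `t(α) = s(f(α))` and `f³ = 1`.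

`bar α` is the other arrow starting at `s(α)`; so `src_surjective` and `eq_or_eq_bar` say that
exactly two arrows start at each vertex. As `f` is a bijection from the arrows ending at a vertex
`i` to the arrows starting at `i`, exactly two arrows end at each vertex. -/
structure TriangulationQuiver where
  /-- the vertices -/
  Vertex : Type
  /-- the arrows -/
  Arrow : Type
  [fintypeVertex : Fintype Vertex]
  [fintypeArrow : Fintype Arrow]
  /-- the source of an arrow -/
  src : Arrow → Vertex
  /-- the target of an arrow -/
  tgt : Arrow → Vertex
  /-- the other arrow with the same source -/
  bar : Arrow → Arrow
  src_surjective : Function.Surjective src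
  bar_ne : ∀ a, bar a ≠ a
  src_bar : ∀ a, src (bar a) = src a
  eq_or_eq_bar : ∀ a a', src a' = src a → a' = a ∨ a' = bar a
  connected : ∀ i j, Relation.EqvGen (fun i j => ∃ a, src a = i ∧ tgt a = j) i j
  two_le_card : 2 ≤ Fintype.card Vertex
  /-- the permutation `f` -/
  f : Equiv.Perm Arrow
  src_f : ∀ a, src (f a) = tgt a
  f_f_f : ∀ a, f (f (f a)) = a

namespace TriangulationQuiver

attribute [instance] fintypeVertex fintypeArrow

universe u

variable (Q : TriangulationQuiver)

/-- The permutation `g` of the arrows, the other arrow starting where `f(α)` starts. -/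
def g (a : Q.Arrow) : Q.Arrow := Q.bar (Q.f a)

/-- `n_α`, the size of the `g`-orbit of `α`. -/
noncomputable def n (a : Q.Arrow) : ℕ := Function.minimalPeriod Q.g a

/-- Border loops: the arrows fixed by `f`. -/
def IsBorderLoop (a : Q.Arrow) : Prop := Q.f a = a

/-- The border `∂(Q, f)`: the vertices at which there is a border loop. -/
def border : Set Q.Vertex := {i | ∃ a, Q.IsBorderLoop a ∧ Q.src a = i}

/-- A weight function of `(Q, f)`, written as a function on arrows that is constant on
`g`-orbits; an arrow `α` is virtual if `m_α n_α = 2`. -/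
structure WeightFunction where
  /-- the weight `m_α` -/
  m : Q.Arrow → ℕ
  m_pos : ∀ a, 0 < m a
  m_g : ∀ a, m (Q.g a) = m a
  two_le : ∀ a, 2 ≤ m a * Q.n a
  three_le : ∀ a, m (Q.bar a) * Q.n (Q.bar a) = 2 → Q.src (Q.bar a) ≠ Q.tgt (Q.bar a) →
    3 ≤ m a * Q.n a
  four_le : ∀ a, m (Q.bar a) * Q.n (Q.bar a) = 2 → Q.src (Q.bar a) = Q.tgt (Q.bar a) →
    4 ≤ m a * Q.n a

/-- A parameter function of `(Q, f)`, written as a function on arrows that is constant on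
`g`-orbits. -/
structure ParameterFunction (K : Type u) [Field K] where
  /-- the parameter `c_α` -/
  c : Q.Arrow → K
  c_ne_zero : ∀ a, c a ≠ 0
  c_g : ∀ a, c (Q.g a) = c a

/-- A border function of `(Q, f)`. -/
abbrev BorderFunction (K : Type u) : Type u := Q.border → K

variable (K : Type u) [Field K]

/-- The relations between the paths of length `0` (`Sum.inl`) and `1` (`Sum.inr`) that define the
path algebra; a product `α β` is the path `α` followed by `β`. -/
inductive PathRel :
    FreeAlgebra K (Q.Vertex ⊕ Q.Arrow) → FreeAlgebra K (Q.Vertex ⊕ Q.Arrow) → Prop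
  | idem (i : Q.Vertex) :
      PathRel (FreeAlgebra.ι K (Sum.inl i) * FreeAlgebra.ι K (Sum.inl i))
        (FreeAlgebra.ι K (Sum.inl i))
  | orth (i j : Q.Vertex) (h : i ≠ j) :
      PathRel (FreeAlgebra.ι K (Sum.inl i) * FreeAlgebra.ι K (Sum.inl j)) 0
  | sum_eq_one : PathRel (∑ i : Q.Vertex, FreeAlgebra.ι K (Sum.inl i)) 1
  | src_mul (a : Q.Arrow) :
      PathRel (FreeAlgebra.ι K (Sum.inl (Q.src a)) * FreeAlgebra.ι K (Sum.inr a))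
        (FreeAlgebra.ι K (Sum.inr a))
  | mul_tgt (a : Q.Arrow) :
      PathRel (FreeAlgebra.ι K (Sum.inr a) * FreeAlgebra.ι K (Sum.inl (Q.tgt a)))
        (FreeAlgebra.ι K (Sum.inr a))

/-- The path algebra `K Q`. -/
def PathAlgebra : Type u := RingQuot (Q.PathRel K)

noncomputable instance : Ring (Q.PathAlgebra K) := inferInstanceAs (Ring (RingQuot (Q.PathRel K)))

noncomputable instance : Algebra K (Q.PathAlgebra K) :=
  inferInstanceAs (Algebra K (RingQuot (Q.PathRel K)))

variable {Q}

/-- An arrow as an element of the path algebra. -/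
noncomputable def arr (a : Q.Arrow) : Q.PathAlgebra K :=
  RingQuot.mkAlgHom K (Q.PathRel K) (FreeAlgebra.ι K (Sum.inr a))

/-- The path `α g(α) ⋯ g^{l-1}(α)` of length `l` along the `g`-cycle of `α` (for `l ≥ 1`). -/
noncomputable def gPath (a : Q.Arrow) (l : ℕ) : Q.PathAlgebra K :=
  ((List.range l).map fun k => arr K (Q.g^[k] a)).prod

namespace WeightFunction

variable (m : Q.WeightFunction)

/-- Virtual arrows. -/
def IsVirtual (a : Q.Arrow) : Prop := m.m a * Q.n a = 2

/-- The path `A_α`, of length `m_α n_α - 1 ≥ 1`. -/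
noncomputable def pathA (a : Q.Arrow) : Q.PathAlgebra K := gPath K a (m.m a * Q.n a - 1)

/-- The path `B_α`, of length `m_α n_α`. -/
noncomputable def pathB (a : Q.Arrow) : Q.PathAlgebra K := gPath K a (m.m a * Q.n a)

end WeightFunction

variable {K}

/-- The relations `x = y` whose differences `x - y` generate the ideal `I(Q, f, m, c, b)`. -/
inductive AlgebraRel (m : Q.WeightFunction) (c : Q.ParameterFunction K) (b : Q.BorderFunction K) :
    Q.PathAlgebra K → Q.PathAlgebra K → Prop
  | mul_f (a : Q.Arrow) (h : ¬ Q.IsBorderLoop a) :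
      AlgebraRel m c b (arr K a * arr K (Q.f a)) (c.c (Q.bar a) • m.pathA K (Q.bar a))
  | border_sq (a : Q.Arrow) (h : Q.IsBorderLoop a) :
      AlgebraRel m c b (arr K a * arr K a)
        (c.c (Q.bar a) • m.pathA K (Q.bar a) + b ⟨Q.src a, a, h, rfl⟩ • m.pathB K (Q.bar a))
  | mul_f_g (a : Q.Arrow)
      (h : ¬ (m.IsVirtual (Q.f (Q.f a)) ∨
        (m.IsVirtual (Q.f (Q.bar a)) ∧ m.m (Q.bar a) = 1 ∧ Q.n (Q.bar a) = 3))) :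
      AlgebraRel m c b (arr K a * arr K (Q.f a) * arr K (Q.g (Q.f a))) 0
  | mul_g_f (a : Q.Arrow)
      (h : ¬ (m.IsVirtual (Q.f a) ∨
        (m.IsVirtual (Q.f (Q.f a)) ∧ m.m (Q.f a) = 1 ∧ Q.n (Q.f a) = 3))) :
      AlgebraRel m c b (arr K a * arr K (Q.g a) * arr K (Q.f (Q.g a))) 0

/-- The socle deformed weighted triangulation algebra
`Λ(Q, f, m, c, b) = K Q / I(Q, f, m, c, b)`. -/
def SocleDeformedAlgebra (m : Q.WeightFunction) (c : Q.ParameterFunction K)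
    (b : Q.BorderFunction K) : Type u :=
  RingQuot (AlgebraRel m c b)

noncomputable instance (m : Q.WeightFunction) (c : Q.ParameterFunction K)
    (b : Q.BorderFunction K) : Ring (SocleDeformedAlgebra m c b) :=
  inferInstanceAs (Ring (RingQuot (AlgebraRel m c b)))

noncomputable instance (m : Q.WeightFunction) (c : Q.ParameterFunction K)
    (b : Q.BorderFunction K) : Algebra K (SocleDeformedAlgebra m c b) :=
  inferInstanceAs (Algebra K (RingQuot (AlgebraRel m c b)))

/-- The weighted triangulation algebra `Λ(Q, f, m, c)`: no border deformation (the border may be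
empty). -/
abbrev WeightedAlgebra (m : Q.WeightFunction) (c : Q.ParameterFunction K) : Type u :=
  SocleDeformedAlgebra m c (0 : Q.BorderFunction K)

/-! ### The singular disc algebra -/

/-- The triangulation quiver with vertices `0, 1`, the arrows `α = 0` (a loop at `0`),
`β = 1 : 0 → 1`, `γ = 2 : 1 → 0`, `σ = 3` (a loop at `1`), and `f = (α)(β σ γ)`; so
`g = (α β γ)(σ)`. It comes from the triangulation of the disc by one self-folded triangle. -/
def discQuiver : TriangulationQuiver where
  Vertex := Fin 2
  Arrow := Fin 4
  src := ![0, 0, 1, 1]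
  tgt := ![0, 1, 0, 1]
  bar := ![1, 0, 3, 2]
  src_surjective := by decide
  bar_ne := by decide
  src_bar := by decide
  eq_or_eq_bar := by decide
  connected i j := by
    have h : Relation.EqvGen (fun i j : Fin 2 => ∃ a : Fin 4,
        (![0, 0, 1, 1] : Fin 4 → Fin 2) a = i ∧ (![0, 1, 0, 1] : Fin 4 → Fin 2) a = j) 0 1 :=
      Relation.EqvGen.rel _ _ ⟨1, rfl, rfl⟩
    fin_cases i <;> fin_cases j
    · exact Relation.EqvGen.refl _
    · exact h
    · exact h.symm
    · exact Relation.EqvGen.refl _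
  two_le_card := by decide
  f := ⟨![0, 3, 1, 2], ![0, 2, 3, 1], by decide, by decide⟩
  src_f := by decide
  f_f_f := by decide

instance : DecidableEq discQuiver.Arrow := inferInstanceAs (DecidableEq (Fin 4))

instance : DecidableEq discQuiver.Vertex := inferInstanceAs (DecidableEq (Fin 2))

/-- The sizes of the `g`-orbits. -/
def discSize : discQuiver.Arrow → ℕ := (![3, 3, 3, 1] : Fin 4 → ℕ)

/-- The weights `m_α = 1` and `m_σ = 3`, as a function on the arrows. -/
def discMult : discQuiver.Arrow → ℕ := (![1, 1, 1, 3] : Fin 4 → ℕ)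

theorem discQuiver_n : ∀ a : discQuiver.Arrow, discQuiver.n a = discSize a := by
  have hp : Fact (Nat.Prime 3) := ⟨Nat.prime_three⟩
  have h3 : ∀ a : discQuiver.Arrow, Function.IsPeriodicPt discQuiver.g 3 a := by
    unfold Function.IsPeriodicPt Function.IsFixedPt; decide
  have h : ∀ a : discQuiver.Arrow, discQuiver.g a ≠ a ∧ discSize a = 3 ∨
      discQuiver.g a = a ∧ discSize a = 1 := by decide
  intro a
  rcases h a with ⟨h1, h2⟩ | ⟨h1, h2⟩
  · rw [h2]
    exact Function.minimalPeriod_eq_prime (h3 a) h1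
  · rw [h2]
    exact Function.minimalPeriod_eq_one_iff_isFixedPt.mpr h1

/-- The weight function of the singular disc algebra. -/
def discWeight : discQuiver.WeightFunction where
  m := discMult
  m_pos := by decide
  m_g := by decide
  two_le := by simp only [discQuiver_n]; decide
  three_le := by simp only [discQuiver_n]; decide
  four_le := by simp only [discQuiver_n]; decide

/-- The parameters `c_α = c_σ = 1`. -/
def discParameter (K : Type u) [Field K] : discQuiver.ParameterFunction K where
  c _ := 1
  c_ne_zero _ := one_ne_zero
  c_g _ := rfl

/-- The singular disc algebra `D(1)`: it has the commutativity relations `α² = βγ`, `βσ = αβ`,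
`σγ = γα`, `γβ = σ²`, and all paths `x f(x) g(f(x))` and `x g(x) f(g(x))` are zero. -/
abbrev SingularDiscAlgebra (K : Type u) [Field K] : Type u :=
  WeightedAlgebra discWeight (discParameter K)

end TriangulationQuiver

/-! ## Directed triangulated surfaces -/

/-- A pattern for gluing finitely many triangles along sides. The side `(t, i)` of the triangle
`t` is the one opposite to its vertex `i`. Two sides `s ≠ pairing s` are glued to each other, and
a side `s = pairing s` is left free. The side `(t, i)` is parametrized from the vertex `i + 1` to
the vertex `i + 2`; `flip s` says that the gluing of `s` with `pairing s` reverses the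
parametrizations. -/
structure GluingPattern where
  /-- the number of triangles -/
  numTriangles : ℕ
  /-- the pairing of the sides -/
  pairing : Fin numTriangles × Fin 3 → Fin numTriangles × Fin 3
  pairing_pairing : ∀ s, pairing (pairing s) = s
  /-- whether a gluing reverses the parametrizations -/
  flip : Fin numTriangles × Fin 3 → Bool
  flip_pairing : ∀ s, flip (pairing s) = flip s

namespace GluingPattern

variable (P : GluingPattern)

/-- The sides of the triangles. -/
abbrev Side : Type := Fin P.numTriangles × Fin 3

/-- The points of the disjoint union of the triangles, in barycentric coordinates. -/
abbrev Point : Type := Fin P.numTriangles × stdSimplex ℝ (Fin 3)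

/-- `p` lies on a side that is not free, and `q` is the point of the paired side that is glued
to `p`. -/
def Glued (p q : P.Point) : Prop :=
  ∃ s : P.Side, P.pairing s ≠ s ∧ p.1 = s.1 ∧ q.1 = (P.pairing s).1 ∧
    p.2 s.2 = 0 ∧ q.2 (P.pairing s).2 = 0 ∧
    if P.flip s then
      p.2 (s.2 + 1) = q.2 ((P.pairing s).2 + 2) ∧ p.2 (s.2 + 2) = q.2 ((P.pairing s).2 + 1)
    else
      p.2 (s.2 + 1) = q.2 ((P.pairing s).2 + 1) ∧ p.2 (s.2 + 2) = q.2 ((P.pairing s).2 + 2)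

/-- Two sides give the same edge if they are equal or glued. -/
def edgeSetoid : Setoid P.Side where
  r s s' := s' = s ∨ s' = P.pairing s
  iseqv :=
    { refl := fun _ => Or.inl rfl
      symm := by
        rintro s s' (rfl | rfl)
        · exact Or.inl rfl
        · exact Or.inr (P.pairing_pairing s).symm
      trans := by
        rintro s s' s'' (rfl | rfl) (rfl | rfl)
        · exact Or.inl rfl
        · exact Or.inr rfl
        · exact Or.inr rfl
        · exact Or.inl (P.pairing_pairing s) }

instance : DecidableRel P.edgeSetoid.r := fun s s' =>
  inferInstanceAs (Decidable (s' = s ∨ s' = P.pairing s))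

/-- The edges. -/
def Edge : Type := Quotient P.edgeSetoid

instance : Fintype P.Edge :=
  @Quotient.fintype _ _ P.edgeSetoid (inferInstanceAs (DecidableRel P.edgeSetoid.r))

/-- The edge given by a side. -/
def edge (s : P.Side) : P.Edge := Quotient.mk P.edgeSetoid s

end GluingPattern

/-- A directed triangulated surface `(S, T⃗)` on the given surface `S` (compact, connected,
possibly with boundary). The triangulation `T` is given as usual by finitely many triangles whose
characteristic maps to `S` identify `S` with the space obtained from the triangles by gluing
sides; both an edge between two triangles and the self-folded edge of one triangle are glued from
two sides, and the remaining edges are those in the boundary of `S`. The orientation `T⃗` is an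
arbitrary choice of one of the two cyclic orders of the sides of each triangle. -/
structure DirectedTriangulation (S : Type*) [TopologicalSpace S]
    [ChartedSpace (EuclideanHalfSpace 2) S] extends GluingPattern where
  /-- the characteristic maps of the triangles -/
  toSurface : toGluingPattern.Point → S
  continuous_toSurface : Continuous toSurface
  surjective_toSurface : Function.Surjective toSurface
  toSurface_eq_iff : ∀ p q,
    toSurface p = toSurface q ↔ Relation.EqvGen toGluingPattern.Glued p q
  free_iff_boundary : ∀ s : toGluingPattern.Side, pairing s = s ↔
    ∀ p : toGluingPattern.Point, p.1 = s.1 → p.2 s.2 = 0 →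
      toSurface p ∈ (𝓡∂ 2).boundary S
  two_le_edges : 2 ≤ Fintype.card toGluingPattern.Edge
  /-- the orientations: `true` for the cyclic order `0, 1, 2` of the sides of a triangle,
  `false` for `0, 2, 1` -/
  orientation : Fin numTriangles → Bool

namespace DirectedTriangulation

variable {S : Type*} [TopologicalSpace S] [ChartedSpace (EuclideanHalfSpace 2) S]
  (T : DirectedTriangulation S)

/-- The free sides. -/
abbrev FreeSide : Type := {s : T.Side // T.pairing s = s}

/-- The side following `s` in the orientation of its triangle. -/
def next (s : T.Side) : T.Side := (s.1, if T.orientation s.1 then s.2 + 1 else s.2 + 2)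

theorem next_next_next (s : T.Side) : T.next (T.next (T.next s)) = s := by
  obtain ⟨t, i⟩ := s
  simp only [next]
  cases T.orientation t <;> fin_cases i <;> rfl

/-- The permutation `f`: it follows the orientations of the triangles and fixes the loops at the
boundary edges. -/
def arrowPerm : Equiv.Perm (T.Side ⊕ T.FreeSide) where
  toFun := Sum.map T.next id
  invFun := Sum.map (fun s => T.next (T.next s)) id
  left_inv := by rintro (s | s) <;> simp [T.next_next_next]
  right_inv := by rintro (s | s) <;> simp [T.next_next_next]

/-- The source of an arrow of the quiver. -/
def arrowSrc : T.Side ⊕ T.FreeSide → T.Edge :=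
  Sum.elim T.edge fun s => T.edge s.1

/-- The other arrow with the same source. -/
def arrowBar : T.Side ⊕ T.FreeSide → T.Side ⊕ T.FreeSide :=
  Sum.elim (fun s => if h : T.pairing s = s then Sum.inr ⟨s, h⟩ else Sum.inl (T.pairing s))
    fun s => Sum.inl s.1

theorem edge_eq_iff (s s' : T.Side) : T.edge s = T.edge s' ↔ s' = s ∨ s' = T.pairing s :=
  ⟨fun h => Quotient.exact (s := T.edgeSetoid) h, fun h => Quotient.sound (s := T.edgeSetoid) h⟩

/-- Edges joined by arrows lie in the same component of the quiver. -/
abbrev Joined (i j : T.Edge) : Prop :=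
  Relation.EqvGen (fun i j => ∃ a, T.arrowSrc a = i ∧ T.arrowSrc (T.arrowPerm a) = j) i j

theorem joined_next (s : T.Side) : T.Joined (T.edge s) (T.edge (T.next s)) :=
  Relation.EqvGen.rel _ _ ⟨Sum.inl s, rfl, rfl⟩

theorem joined_same_triangle (s s' : T.Side) (h : s.1 = s'.1) :
    T.Joined (T.edge s) (T.edge s') := by
  have h3 : s' = s ∨ s' = T.next s ∨ s' = T.next (T.next s) := by
    obtain ⟨t, i⟩ := s
    obtain ⟨t', i'⟩ := s'
    obtain rfl : t = t' := h
    simp only [next]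
    cases T.orientation t <;> fin_cases i <;> fin_cases i' <;> simp
  rcases h3 with rfl | rfl | rfl
  · exact Relation.EqvGen.refl _
  · exact T.joined_next s
  · exact (T.joined_next s).trans _ _ _ (T.joined_next _)

theorem joined_of_eqvGen {p q : T.Point} (h : Relation.EqvGen T.Glued p q) :
    T.Joined (T.edge (p.1, 0)) (T.edge (q.1, 0)) := by
  induction h with
  | rel p q h =>
    obtain ⟨s, -, hp, hq, -⟩ := h
    refine (T.joined_same_triangle (p.1, 0) s hp).trans _ _ _ ?_
    have : T.edge s = T.edge (T.pairing s) := (T.edge_eq_iff _ _).mpr (Or.inr rfl)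
    rw [this]
    exact T.joined_same_triangle _ _ hq.symm
  | refl p => exact Relation.EqvGen.refl _
  | symm p q _ ih => exact ih.symm
  | trans p q r _ _ ih₁ ih₂ => exact ih₁.trans _ _ _ ih₂

/-- The quiver of a triangulated surface is connected because the surface is. -/
theorem joined [ConnectedSpace S] [CompactSpace S] [T2Space S] (i j : T.Edge) : T.Joined i j := by
  obtain ⟨s, rfl⟩ := Quotient.exists_rep i
  obtain ⟨s', rfl⟩ := Quotient.exists_rep j
  let C : Set (Fin T.numTriangles) := {t | T.Joined (T.edge s) (T.edge (t, 0))}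
  let U : Set (Fin T.numTriangles) → Set S := fun D => T.toSurface '' {p | p.1 ∈ D}
  have hclosed : ∀ D, IsClosed (U D) := fun D => by
    refine (IsCompact.image ?_ T.continuous_toSurface).isClosed
    exact (IsClosed.preimage continuous_fst (isClosed_discrete D)).isCompact
  have hcompl : (U C)ᶜ = U Cᶜ := by
    ext x
    obtain ⟨p, rfl⟩ := T.surjective_toSurface x
    have hmem : ∀ D, (∀ t t', T.Joined (T.edge (t, 0)) (T.edge (t', 0)) → t ∈ D → t' ∈ D) →
        (T.toSurface p ∈ U D ↔ p.1 ∈ D) := by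
      intro D hD
      constructor
      · rintro ⟨q, hq, hqp⟩
        exact hD _ _ (T.joined_of_eqvGen ((T.toSurface_eq_iff q p).mp hqp)) hq
      · intro h
        exact ⟨p, h, rfl⟩
    have hC : ∀ t t', T.Joined (T.edge (t, 0)) (T.edge (t', 0)) → t ∈ C → t' ∈ C :=
      fun t t' h ht => Relation.EqvGen.trans _ _ _ ht h
    have hC' : ∀ t t', T.Joined (T.edge (t, 0)) (T.edge (t', 0)) → t ∈ Cᶜ → t' ∈ Cᶜ :=
      fun t t' h ht ht' => ht (hC t' t h.symm ht')
    rw [Set.mem_compl_iff, hmem C hC, hmem Cᶜ hC', Set.mem_compl_iff]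
  have hopen : IsOpen (U C) := by
    rw [← isClosed_compl_iff, hcompl]
    exact hclosed _
  let x₀ : stdSimplex ℝ (Fin 3) := ⟨Pi.single 0 1, single_mem_stdSimplex ℝ 0⟩
  have hne : (U C).Nonempty :=
    ⟨_, (s.1, x₀), T.joined_same_triangle s (s.1, 0) rfl, rfl⟩
  have huniv : U C = Set.univ := IsClopen.eq_univ ⟨hclosed C, hopen⟩ hne
  have hs' : s'.1 ∈ C := by
    by_contra h
    have : T.toSurface (s'.1, x₀) ∈ (U C)ᶜ := by
      rw [hcompl]
      exact ⟨(s'.1, x₀), h, rfl⟩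
    rw [huniv] at this
    exact this (Set.mem_univ _)
  exact Relation.EqvGen.trans _ _ _ hs' (T.joined_same_triangle (s'.1, 0) s' rfl)

/-- The triangulation quiver `(Q(S, T⃗), f)`. The vertices are the edges of `T`. For each triangle
with sides `s, s', s''` in the order of its orientation there are arrows `s → s' → s'' → s`
between the corresponding edges (`Sum.inl s` is the arrow starting at `s`), permuted cyclically by
`f`; for each boundary edge there is a loop (`Sum.inr s`) fixed by `f`. -/
def quiver [ConnectedSpace S] [CompactSpace S] [T2Space S] : TriangulationQuiver where
  Vertex := T.Edge
  Arrow := T.Side ⊕ T.FreeSide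
  src := T.arrowSrc
  tgt a := T.arrowSrc (T.arrowPerm a)
  bar := T.arrowBar
  src_surjective i := by
    obtain ⟨s, rfl⟩ := Quotient.exists_rep i
    exact ⟨Sum.inl s, rfl⟩
  bar_ne := by
    rintro (s | s)
    · by_cases h : T.pairing s = s <;> simp [arrowBar, h]
    · simp [arrowBar]
  src_bar := by
    rintro (s | s)
    · by_cases h : T.pairing s = s
      · simp [arrowBar, arrowSrc, h]
      · simpa [arrowBar, arrowSrc, h] using
          ((T.edge_eq_iff s (T.pairing s)).mpr (Or.inr rfl)).symm
    · rfl
  eq_or_eq_bar := by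
    rintro (s | s) (s' | s') h
    · rcases (T.edge_eq_iff s s').mp h.symm with rfl | rfl
      · exact Or.inl rfl
      · by_cases hs : T.pairing s = s
        · exact Or.inl (by rw [hs])
        · exact Or.inr (by simp [arrowBar, hs])
    · obtain ⟨s', hs'⟩ := s'
      have : s = s' := by
        rcases (T.edge_eq_iff s' s).mp h with rfl | rfl
        · rfl
        · exact hs'
      subst this
      exact Or.inr (by simp [arrowBar, hs'])
    · obtain ⟨s, hs⟩ := s
      refine Or.inr ?_
      rcases (T.edge_eq_iff s s').mp h.symm with rfl | rfl
      · rfl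
      · simp [arrowBar, hs]
    · obtain ⟨s, hs⟩ := s
      obtain ⟨s', hs'⟩ := s'
      refine Or.inl ?_
      rcases (T.edge_eq_iff s s').mp h.symm with rfl | rfl
      · rfl
      · simp [hs]
  connected := T.joined
  two_le_card := T.two_le_edges
  f := T.arrowPerm
  src_f _ := rfl
  f_f_f := by
    rintro (s | s)
    · exact congrArg Sum.inl (T.next_next_next s)
    · rfl

end DirectedTriangulation

/-! Write Λ for the weighted algebra, Λ(b) for a socle deformation, x_α for the element given by an
arrow α, and N for the kernel of the augmentation that kills all arrows. The idea is to lift the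
arrows of Λ/soc(Λ) to A, to correct the lifts until the relations of some Λ(b) hold exactly, and to
compare dimensions.

The relations hold for any lifts up to elements of soc(A), and the symmetrizing form controls these
defects: e_i soc(A) e_j = 0 for i ≠ j, and a nonzero element of e_i soc(A) has a nonzero value under
the trace s ↦ B(s, 1), which is invariant under cyclic rotation. Moreover soc(A)² = 0
(`socle_mul_socle`), so idempotents lift, and soc(A) ⊆ N² (`socle_le_sq`), so the lifted arrows
still generate.

A zero relation can fail only along a closed path, and a cyclic rotation of that path vanishes
(`IsSocleLift.mul_f_g`, `IsSocleLift.mul_g_f`). A relation α f(α) = c_ᾱ A_ᾱ is exact by definition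
of x_ᾱ when ᾱ is virtual. Otherwise it can fail only if t(f(α)) = s(α). Then either α is a border
loop, and the defect is a multiple of B_ᾱ, which is the border term; or ρ = ᾱ = f²(α) is a loop with
g(ρ) = ρ, and the defect is removed by replacing x_α with x_α − t x_ρ x_α. Both cases use that B_ᾱ
does not vanish in A, which follows from its nonvanishing in Λ. The latter is seen on an explicit
module with basis the paths starting at a given vertex (`isSolution_string`).

This gives a surjection Λ(b) → A. It is bijective because dim Λ(b) ≤ dim Λ ≤ dim A. For the first
inequality, Λ(b) modulo its border paths B is a quotient of Λ modulo its own, and those of Λ are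
linearly independent (`finrank_le`). For the second, the quotients by the socles are isomorphic, dim
soc(Λ) is at most the number of vertices by self-injectivity, and dim soc(A) equals that number by
symmetry. Without boundary the only border function is zero. -/

namespace TriangulationQuiver

/-! ### Combinatorics of f, g and the lengths m_α n_α. -/

section Combinatorics

variable {Q : TriangulationQuiver}

theorem bar_bar (a : Q.Arrow) : Q.bar (Q.bar a) = a := by
  rcases Q.eq_or_eq_bar (Q.bar a) a (Q.src_bar a).symm with h | h
  · exact absurd h.symm (Q.bar_ne a)
  · exact h.symm

theorem bar_injective : Function.Injective Q.bar := fun a b h => by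
  rw [← bar_bar a, h, bar_bar]

theorem g_f_f_bar (a : Q.Arrow) : Q.g (Q.f (Q.f (Q.bar a))) = a := by
  simp [g, Q.f_f_f, bar_bar]

theorem g_f_f (a : Q.Arrow) : Q.g (Q.f (Q.f a)) = Q.bar a := by
  simp [g, Q.f_f_f]

theorem bar_g (a : Q.Arrow) : Q.bar (Q.g a) = Q.f a := bar_bar _

theorem bar_f (a : Q.Arrow) : Q.bar (Q.f a) = Q.g a := rfl

theorem g_injective : Function.Injective Q.g := bar_injective.comp Q.f.injective

theorem f_f_bar_g (a : Q.Arrow) : Q.f (Q.f (Q.bar (Q.g a))) = a := by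
  rw [bar_g, Q.f_f_f]

theorem src_g (a : Q.Arrow) : Q.src (Q.g a) = Q.tgt a := by
  rw [g, Q.src_bar, Q.src_f]

theorem g_ne_f (a : Q.Arrow) : Q.g a ≠ Q.f a := Q.bar_ne _

theorem tgt_eq_iff (a b : Q.Arrow) : Q.tgt a = Q.src b ↔ b = Q.f a ∨ b = Q.g a := by
  constructor
  · intro h
    exact Q.eq_or_eq_bar (Q.f a) b (by rw [Q.src_f, h])
  · rintro (rfl | rfl)
    · exact (Q.src_f a).symm
    · exact (src_g a).symm

theorem tgt_f_f (a : Q.Arrow) : Q.tgt (Q.f (Q.f a)) = Q.src a := by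
  rw [← Q.src_f, Q.f_f_f]

theorem tgt_eq_src_iff (a b : Q.Arrow) :
    Q.tgt b = Q.src a ↔ b = Q.f (Q.f a) ∨ b = Q.f (Q.f (Q.bar a)) := by
  rw [tgt_eq_iff]
  constructor
  · rintro (rfl | rfl)
    · exact Or.inl (Q.f_f_f b).symm
    · exact Or.inr (f_f_bar_g b).symm
  · rintro (rfl | rfl)
    · exact Or.inl (Q.f_f_f a).symm
    · exact Or.inr (g_f_f_bar a).symm

/-- There are no two loops at a vertex. -/
theorem not_loop_bar {a : Q.Arrow} (h : Q.tgt a = Q.src a) : Q.tgt (Q.bar a) ≠ Q.src a := by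
  intro h'
  -- With two loops at a vertex, the arrows starting there and the arrows ending there are the same,
  -- so the vertex would be a whole component of the quiver.
  have key : ∀ b, Q.src b = Q.src a ↔ Q.tgt b = Q.src a := by
    intro b
    constructor
    · intro hb
      rcases Q.eq_or_eq_bar a b hb with rfl | rfl
      · exact h
      · exact h'
    · intro hb
      have h1 : Q.f a = a ∨ Q.f a = Q.bar a := Q.eq_or_eq_bar a _ (by rw [Q.src_f, h])
      have h2 : Q.f (Q.bar a) = a ∨ Q.f (Q.bar a) = Q.bar a :=
        Q.eq_or_eq_bar a _ (by rw [Q.src_f, h'])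
      have h3 : Q.f b = a ∨ Q.f b = Q.bar a := Q.eq_or_eq_bar a _ (by rw [Q.src_f, hb])
      have hne := Q.bar_ne a
      have : b = a ∨ b = Q.bar a := by
        rcases h1 with h1 | h1 <;> rcases h2 with h2 | h2
        · exact absurd (Q.f.injective (h2.trans h1.symm)) hne
        · rcases h3 with h3 | h3
          · exact Or.inl (Q.f.injective (h3.trans h1.symm))
          · exact Or.inr (Q.f.injective (h3.trans h2.symm))
        · rcases h3 with h3 | h3
          · exact Or.inr (Q.f.injective (h3.trans h2.symm))
          · exact Or.inl (Q.f.injective (h3.trans h1.symm))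
        · exact absurd (Q.f.injective (h2.trans h1.symm)) hne
      rcases this with rfl | rfl
      · rfl
      · exact Q.src_bar a
  have hall : ∀ i j, Relation.EqvGen (fun i j => ∃ a, Q.src a = i ∧ Q.tgt a = j) i j →
      (i = Q.src a ↔ j = Q.src a) := by
    intro i j hij
    induction hij with
    | rel i j h => obtain ⟨b, rfl, rfl⟩ := h; exact key b
    | refl => rfl
    | symm _ _ _ ih => exact ih.symm
    | trans _ _ _ _ _ ih₁ ih₂ => exact ih₁.trans ih₂
  have : Subsingleton Q.Vertex := ⟨fun i j => by
    rw [((hall _ i (Q.connected _ _)).mp rfl), ((hall _ j (Q.connected _ _)).mp rfl)]⟩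
  have := Fintype.card_le_one_iff_subsingleton.mpr this
  have := Q.two_le_card
  omega

theorem f_eq_bar_of_loop {a : Q.Arrow} (h : Q.tgt a = Q.src a) (hb : ¬ Q.IsBorderLoop a) :
    Q.f a = Q.bar a :=
  (Q.eq_or_eq_bar a (Q.f a) (by rw [Q.src_f, h])).resolve_left hb

theorem g_eq_of_loop {a : Q.Arrow} (h : Q.tgt a = Q.src a) (hb : ¬ Q.IsBorderLoop a) :
    Q.g a = a := by
  rw [g, f_eq_bar_of_loop h hb, bar_bar]

theorem IsBorderLoop.tgt_eq {a : Q.Arrow} (h : Q.IsBorderLoop a) : Q.tgt a = Q.src a := by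
  rw [← Q.src_f, h]

theorem IsBorderLoop.g_eq {a : Q.Arrow} (h : Q.IsBorderLoop a) : Q.g a = Q.bar a := by
  rw [g, h]

theorem n_g (a : Q.Arrow) : Q.n (Q.g a) = Q.n a :=
  Function.minimalPeriod_apply (Function.Injective.mem_periodicPts g_injective a)

namespace WeightFunction

variable (m : Q.WeightFunction)

/-- The length `m_α n_α` of the path `B_α`. -/
noncomputable def len (a : Q.Arrow) : ℕ := m.m a * Q.n a

theorem two_le_len (a : Q.Arrow) : 2 ≤ m.len a := m.two_le a

theorem isVirtual_iff (a : Q.Arrow) : m.IsVirtual a ↔ m.len a = 2 := Iff.rfl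

theorem len_g (a : Q.Arrow) : m.len (Q.g a) = m.len a := by
  rw [len, m.m_g, n_g, len]

theorem len_iterate (k : ℕ) (a : Q.Arrow) : m.len (Q.g^[k] a) = m.len a := by
  induction k with
  | zero => rfl
  | succ k ih => rw [Function.iterate_succ_apply', len_g, ih]

/-- f²(α) and ᾱ lie on one g-cycle. This turns the exceptions of the zero relations that mention
f²(α) into conditions on ᾱ. -/
theorem len_f_f (a : Q.Arrow) : m.len (Q.f (Q.f a)) = m.len (Q.bar a) := by
  rw [← g_f_f a, len_g]

theorem len_bar_f (a : Q.Arrow) : m.len (Q.bar (Q.f a)) = m.len a := m.len_g a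

theorem iterate_g_len (a : Q.Arrow) : Q.g^[m.len a] a = a :=
  ((Function.isPeriodicPt_minimalPeriod Q.g a).const_mul (m.m a))

theorem iterate_g_len_sub_one (a : Q.Arrow) :
    Q.g^[m.len a - 1] a = Q.f (Q.f (Q.bar a)) := by
  apply g_injective
  have h : m.len a - 1 + 1 = m.len a := by have := m.two_le_len a; omega
  rw [← Function.iterate_succ_apply' Q.g, Nat.succ_eq_add_one, h, iterate_g_len, g_f_f_bar]

theorem f_iterate_g_len_sub_two (a : Q.Arrow) :
    Q.f (Q.g^[m.len a - 2] a) = Q.g (Q.f (Q.bar a)) := by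
  have h : m.len a - 2 + 1 = m.len a - 1 := by have := m.two_le_len a; omega
  rw [← bar_g, ← Function.iterate_succ_apply' Q.g, Nat.succ_eq_add_one, h,
    iterate_g_len_sub_one, g]

theorem g_g_of_len_eq_two {a : Q.Arrow} (h : m.len a = 2) : Q.g (Q.g a) = a := by
  have := m.iterate_g_len a
  rwa [h] at this

theorem g_g_g_of_len_eq_three {a : Q.Arrow} (h : m.len a = 3) : Q.g (Q.g (Q.g a)) = a := by
  have := m.iterate_g_len a
  rwa [h] at this

theorem three_le_len_bar {a : Q.Arrow} (h : m.len a = 2) : 3 ≤ m.len (Q.bar a) := by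
  by_cases hl : Q.src a = Q.tgt a
  · exact le_trans (by norm_num) (m.four_le (Q.bar a) (by rwa [bar_bar]) (by rwa [bar_bar]))
  · exact m.three_le (Q.bar a) (by rwa [bar_bar]) (by rwa [bar_bar])

theorem four_le_len_bar {a : Q.Arrow} (h : m.len a = 2) (hl : Q.tgt a = Q.src a) :
    4 ≤ m.len (Q.bar a) :=
  m.four_le (Q.bar a) (by rwa [bar_bar]) (by rw [bar_bar, hl])

theorem len_f_ne_two_of_len {a : Q.Arrow} (h : m.len a = 2) : m.len (Q.f a) ≠ 2 := by
  intro h'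
  have := m.three_le_len_bar h'
  rw [len_bar_f] at this
  omega

theorem len_f_g_ne_two {a : Q.Arrow} (h : m.len (Q.f a) = 2) : m.len (Q.f (Q.g a)) ≠ 2 := by
  intro h'
  -- `x = f (g a)` and `f x` would both be virtual
  apply m.len_f_ne_two_of_len h'
  rw [len_f_f, bar_g, h]

theorem len_bar_ne_two_of_len {a : Q.Arrow} (h : m.len a = 2) : m.len (Q.bar a) ≠ 2 := by
  have := m.three_le_len_bar h
  omega

theorem three_le_len {a : Q.Arrow} (h : m.len a ≠ 2) : 3 ≤ m.len a := by
  have := m.two_le_len a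
  omega

theorem len_border {a : Q.Arrow} (h : Q.IsBorderLoop a) : m.len (Q.bar a) = m.len a := by
  rw [← h.g_eq, len_g]

theorem len_border_ne_two {a : Q.Arrow} (h : Q.IsBorderLoop a) : m.len a ≠ 2 := fun h2 =>
  m.len_bar_ne_two_of_len h2 (by rw [len_border m h, h2])

/-- If `f α` is virtual, then `α` and `ᾱ` do not both have `g`-cycles of length three. -/
theorem not_len_eq_three {a : Q.Arrow} (hv : m.len (Q.f a) = 2) (h : m.len a = 3)
    (h' : m.len (Q.bar a) = 3) : False := by
  have h1 : Q.g (Q.g (Q.bar a)) = Q.f (Q.f a) := by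
    apply g_injective
    rw [m.g_g_g_of_len_eq_three h', g_f_f]
  have h2 : Q.g (Q.g a) = Q.f (Q.f (Q.bar a)) := by
    apply g_injective
    rw [m.g_g_g_of_len_eq_three h, g_f_f_bar]
  have h3 : Q.f (Q.g (Q.bar a)) = Q.g (Q.f a) := by
    rw [← bar_g, h1]; rfl
  have h4 : Q.f (Q.g (Q.f a)) = Q.g a := by
    rw [← bar_g, m.g_g_of_len_eq_two hv, bar_f]
  have h5 : Q.f (Q.g a) = Q.g (Q.bar a) := by
    rw [← h4, ← h3, Q.f_f_f]
  have h6 : Q.f (Q.g a) = Q.g (Q.f (Q.bar a)) := by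
    rw [← bar_g, h2]; rfl
  -- So ᾱ is a border loop and f(α) a virtual loop. The weight condition for virtual loops then
  -- demands length at least four on the g-cycle of α.
  have h7 : Q.f (Q.bar a) = Q.bar a := g_injective (h6.symm.trans h5)
  have h8 : Q.g (Q.bar a) = a := by rw [g, h7, bar_bar]
  have hl : Q.tgt (Q.f a) = Q.src (Q.f a) := by
    rw [← Q.src_f, ← h1, h8, Q.src_f, src_g]
  have := m.four_le_len_bar hv hl
  rw [len_bar_f] at this
  omega

/-- Length three also allows m = 3 and n = 1. In that case g fixes α, so f(α) = ᾱ, and virtuality of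
f(α) would give f²(α) = g(f(α)), which is impossible. Hence the exceptions depend on lengths alone.
-/
theorem exception_iff (a : Q.Arrow) :
    (m.len (Q.f a) = 2 ∧ m.m a = 1 ∧ Q.n a = 3) ↔ m.len (Q.f a) = 2 ∧ m.len a = 3 := by
  refine and_congr_right fun hv => ?_
  unfold len
  constructor
  · rintro ⟨h1, h2⟩
    rw [h1, h2]
  · intro h3
    have hd : Q.n a ∣ 3 := ⟨m.m a, by rw [← h3, mul_comm]⟩
    rcases (Nat.dvd_prime Nat.prime_three).mp hd with h1 | h1
    · exfalso
      have h2 : Q.g a = a := Function.minimalPeriod_eq_one_iff_isFixedPt.mp h1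
      have h3 : Q.f a = Q.bar a := by rw [← bar_g, h2]
      have h4 : Q.f (Q.f a) = Q.g (Q.f a) := by
        apply g_injective
        rw [g_f_f, m.g_g_of_len_eq_two hv, h3]
      exact g_ne_f _ h4.symm
    · rw [h1] at h3
      exact ⟨by omega, h1⟩

end WeightFunction

end Combinatorics

end TriangulationQuiver

namespace TriangulationQuiver

universe u v

/-! ### Solutions of the relations and the universal property of the algebras. -/

section Solutions

variable {Q : TriangulationQuiver} {K : Type u} [Field K] {R : Type v} [Ring R] [Algebra K R]

/-- The product `x_α x_{g(α)} ⋯` of `l` factors along the `g`-cycle of `α`. -/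
def gProd (x : Q.Arrow → R) (a : Q.Arrow) (l : ℕ) : R :=
  ((List.range l).map fun k => x (Q.g^[k] a)).prod

@[simp] theorem gProd_zero (x : Q.Arrow → R) (a : Q.Arrow) : gProd x a 0 = 1 := rfl

theorem gProd_succ (x : Q.Arrow → R) (a : Q.Arrow) (l : ℕ) :
    gProd x a (l + 1) = gProd x a l * x (Q.g^[l] a) := by
  simp [gProd, List.range_succ]

@[simp] theorem gProd_one (x : Q.Arrow → R) (a : Q.Arrow) : gProd x a 1 = x a := by
  simp [gProd_succ]

theorem gProd_add (x : Q.Arrow → R) (a : Q.Arrow) (k l : ℕ) :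
    gProd x a (k + l) = gProd x a k * gProd x (Q.g^[k] a) l := by
  induction l with
  | zero => simp
  | succ l ih =>
    rw [← add_assoc, gProd_succ, ih, gProd_succ, mul_assoc, ← Function.iterate_add_apply,
      add_comm l k]

theorem gProd_succ' (x : Q.Arrow → R) (a : Q.Arrow) (l : ℕ) :
    gProd x a (l + 1) = x a * gProd x (Q.g a) l := by
  rw [add_comm, gProd_add, gProd_one, Function.iterate_one]

theorem gProd_two (x : Q.Arrow → R) (a : Q.Arrow) : gProd x a 2 = x a * x (Q.g a) := by
  rw [gProd_succ', gProd_one]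

theorem map_gProd {R' : Type*} [Ring R'] (F : R →+* R') (x : Q.Arrow → R) (a : Q.Arrow) (l : ℕ) :
    F (gProd x a l) = gProd (fun a => F (x a)) a l := by
  simp [gProd, map_list_prod, Function.comp_def]

/-- Idempotents and elements of `R` that define an algebra homomorphism from the path algebra. -/
structure IsPathSystem (e : Q.Vertex → R) (x : Q.Arrow → R) : Prop where
  complete : CompleteOrthogonalIdempotents e
  src_mul : ∀ a, e (Q.src a) * x a = x a
  mul_tgt : ∀ a, x a * e (Q.tgt a) = x a

/-- Idempotents and elements of `R` that satisfy the relations of `Λ(Q, f, m, c, b)`. -/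
structure IsSolution (m : Q.WeightFunction) (c : Q.ParameterFunction K) (b : Q.BorderFunction K)
    (e : Q.Vertex → R) (x : Q.Arrow → R) : Prop extends IsPathSystem e x where
  mul_f : ∀ a, ¬ Q.IsBorderLoop a →
    x a * x (Q.f a) = c.c (Q.bar a) • gProd x (Q.bar a) (m.len (Q.bar a) - 1)
  border_sq : ∀ a (h : Q.IsBorderLoop a),
    x a * x a = c.c (Q.bar a) • gProd x (Q.bar a) (m.len (Q.bar a) - 1) +
      b ⟨Q.src a, a, h, rfl⟩ • gProd x (Q.bar a) (m.len (Q.bar a))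
  mul_f_g : ∀ a, m.len (Q.bar a) ≠ 2 → ¬ (m.len (Q.f (Q.bar a)) = 2 ∧ m.len (Q.bar a) = 3) →
    x a * x (Q.f a) * x (Q.g (Q.f a)) = 0
  mul_g_f : ∀ a, m.len (Q.f a) ≠ 2 → ¬ (m.len (Q.bar a) = 2 ∧ m.len (Q.f a) = 3) →
    x a * x (Q.g a) * x (Q.f (Q.g a)) = 0

namespace IsPathSystem

variable {e : Q.Vertex → R} {x : Q.Arrow → R}

theorem map (h : IsPathSystem e x) {R' : Type*} [Ring R'] (F : R →+* R') :
    IsPathSystem (fun i => F (e i)) fun a => F (x a) where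
  complete := h.complete.map F
  src_mul a := by rw [← map_mul, h.src_mul]
  mul_tgt a := by rw [← map_mul, h.mul_tgt]

theorem mul_eq_zero (h : IsPathSystem e x) {i j : Q.Vertex} {y z : R} (hy : y * e i = y)
    (hz : e j * z = z) (hij : i ≠ j) : y * z = 0 := by
  rw [← hy, ← hz, mul_assoc, ← mul_assoc (e i), h.complete.ortho hij, zero_mul, mul_zero]

theorem mul_arrow_eq_zero (h : IsPathSystem e x) {a b : Q.Arrow} (hab : Q.tgt a ≠ Q.src b) :
    x a * x b = 0 :=
  h.mul_eq_zero (h.mul_tgt a) (h.src_mul b) hab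

theorem src_mul_gProd (h : IsPathSystem e x) (a : Q.Arrow) {l : ℕ} (hl : l ≠ 0) :
    e (Q.src a) * gProd x a l = gProd x a l := by
  obtain ⟨l, rfl⟩ := Nat.exists_eq_succ_of_ne_zero hl
  rw [gProd_succ', ← mul_assoc, h.src_mul]

theorem gProd_mul_src (h : IsPathSystem e x) (a : Q.Arrow) {l : ℕ} (hl : l ≠ 0) :
    gProd x a l * e (Q.src (Q.g^[l] a)) = gProd x a l := by
  obtain ⟨l, rfl⟩ := Nat.exists_eq_succ_of_ne_zero hl
  rw [gProd_succ, mul_assoc, Function.iterate_succ_apply', src_g, h.mul_tgt]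

theorem mul_e_eq_zero (h : IsPathSystem e x) {i j : Q.Vertex} {y : R} (hy : y * e i = y)
    (hij : i ≠ j) : y * e j = 0 :=
  h.mul_eq_zero hy (h.complete.idem j) hij

theorem e_mul_eq_zero (h : IsPathSystem e x) {i j : Q.Vertex} {y : R} (hy : e i * y = y)
    (hij : j ≠ i) : e j * y = 0 :=
  h.mul_eq_zero (h.complete.idem j) hy hij

theorem eq_sum (h : IsPathSystem e x) (r : R) : r = ∑ i, r * e i := by
  rw [← Finset.mul_sum, h.complete.complete, mul_one]

theorem eq_sum' (h : IsPathSystem e x) (r : R) : r = ∑ i, e i * r := by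
  rw [← Finset.sum_mul, h.complete.complete, one_mul]

/-- The algebra homomorphism from the path algebra. -/
theorem exists_lift (h : IsPathSystem e x) :
    ∃ F : Q.PathAlgebra K →ₐ[K] R, (∀ a, F (arr K a) = x a) ∧
      ∀ i, F (RingQuot.mkAlgHom K (Q.PathRel K) (FreeAlgebra.ι K (Sum.inl i))) = e i := by
  let F₀ : FreeAlgebra K (Q.Vertex ⊕ Q.Arrow) →ₐ[K] R := FreeAlgebra.lift K (Sum.elim e x)
  have hF₀ : ∀ ⦃y z⦄, Q.PathRel K y z → F₀ y = F₀ z := by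
    intro y z hyz
    cases hyz with
    | idem i =>
      rw [map_mul]
      simp only [F₀, FreeAlgebra.lift_ι_apply, Sum.elim_inl]
      exact h.complete.idem i
    | orth i j hij => simpa [F₀] using h.complete.ortho hij
    | sum_eq_one => simpa [F₀] using h.complete.complete
    | src_mul a => simpa [F₀] using h.src_mul a
    | mul_tgt a => simpa [F₀] using h.mul_tgt a
  refine ⟨RingQuot.liftAlgHom K ⟨F₀, hF₀⟩, fun a => ?_, fun i => ?_⟩
  · exact (RingQuot.liftAlgHom_mkAlgHom_apply K F₀ hF₀ _).trans (by simp [F₀])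
  · exact (RingQuot.liftAlgHom_mkAlgHom_apply K F₀ hF₀ _).trans (by simp [F₀])

end IsPathSystem

theorem map_gPath (F : Q.PathAlgebra K →ₐ[K] R) (a : Q.Arrow) (l : ℕ) :
    F (gPath K a l) = gProd (fun a => F (arr K a)) a l :=
  map_gProd (F : Q.PathAlgebra K →+* R) (fun a => arr K a) a l

namespace SocleDeformedAlgebra

variable (m : Q.WeightFunction) (c : Q.ParameterFunction K) (b : Q.BorderFunction K)

/-- The quotient map from the path algebra. -/
noncomputable def proj : Q.PathAlgebra K →ₐ[K] SocleDeformedAlgebra m c b :=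
  RingQuot.mkAlgHom K (AlgebraRel m c b)

/-- The idempotent of a vertex. -/
noncomputable def vertex (i : Q.Vertex) : SocleDeformedAlgebra m c b :=
  proj m c b (RingQuot.mkAlgHom K (Q.PathRel K) (FreeAlgebra.ι K (Sum.inl i)))

/-- An arrow as an element of the algebra. -/
noncomputable def arrow (a : Q.Arrow) : SocleDeformedAlgebra m c b :=
  proj m c b (arr K a)

theorem isPathSystem : IsPathSystem (vertex m c b) (arrow m c b) := by
  let G : FreeAlgebra K (Q.Vertex ⊕ Q.Arrow) →ₐ[K] Q.PathAlgebra K :=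
    RingQuot.mkAlgHom K (Q.PathRel K)
  have hG : ∀ {y z}, Q.PathRel K y z → proj m c b (G y) = proj m c b (G z) := fun h =>
    congrArg _ (RingQuot.mkAlgHom_rel K h)
  refine ⟨⟨⟨fun i => ?_, fun i j hij => ?_⟩, ?_⟩, fun a => ?_, fun a => ?_⟩
  · have := hG (.idem i)
    rwa [map_mul, map_mul] at this
  · have := hG (.orth i j hij)
    rwa [map_mul, map_mul, map_zero, map_zero] at this
  · have := hG .sum_eq_one
    rwa [map_sum, map_sum, map_one, map_one] at this
  · have := hG (.src_mul a)
    rwa [map_mul, map_mul] at this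
  · have := hG (.mul_tgt a)
    rwa [map_mul, map_mul] at this

theorem isSolution : IsSolution m c b (vertex m c b) (arrow m c b) := by
  have hG : ∀ {y z}, AlgebraRel m c b y z → proj m c b y = proj m c b z := fun h =>
    RingQuot.mkAlgHom_rel K h
  have hA : ∀ a l, proj m c b (gPath K a l) = gProd (arrow m c b) a l :=
    fun a l => map_gPath (proj m c b) a l
  refine { isPathSystem m c b with
    mul_f := fun a h => ?_
    border_sq := fun a h => ?_
    mul_f_g := fun a h1 h2 => ?_
    mul_g_f := fun a h1 h2 => ?_ }
  · have := hG (.mul_f (b := b) (c := c) (m := m) a h)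
    rwa [map_mul, map_smul, WeightFunction.pathA, hA] at this
  · have := hG (.border_sq (b := b) (c := c) (m := m) a h)
    rwa [map_mul, map_add, map_smul, map_smul, WeightFunction.pathA, hA, WeightFunction.pathB, hA]
      at this
  · have := hG (.mul_f_g (b := b) (c := c) (m := m) a (by
      rw [m.isVirtual_iff, m.isVirtual_iff, m.len_f_f, m.exception_iff]
      exact not_or.mpr ⟨h1, h2⟩))
    rwa [map_mul, map_mul, map_zero] at this
  · have := hG (.mul_g_f (b := b) (c := c) (m := m) a (by
      rw [m.isVirtual_iff, m.isVirtual_iff, m.exception_iff, m.len_f_f]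
      exact not_or.mpr ⟨h1, h2⟩))
    rwa [map_mul, map_mul, map_zero] at this

variable {m c b}

theorem exists_lift {e : Q.Vertex → R} {x : Q.Arrow → R} (h : IsSolution m c b e x) :
    ∃ F : SocleDeformedAlgebra m c b →ₐ[K] R,
      (∀ i, F (vertex m c b i) = e i) ∧ ∀ a, F (arrow m c b a) = x a := by
  obtain ⟨G, hGx, hGe⟩ := h.toIsPathSystem.exists_lift (K := K)
  have hA : ∀ a l, G (gPath K a l) = gProd x a l := fun a l => by
    rw [map_gPath]
    exact congrArg (fun y => gProd y a l) (funext hGx)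
  have hG : ∀ ⦃y z⦄, AlgebraRel m c b y z → G y = G z := by
    intro y z hyz
    cases hyz with
    | mul_f a ha => rw [map_mul, map_smul, WeightFunction.pathA, hA, hGx, hGx]; exact h.mul_f a ha
    | border_sq a ha =>
      rw [map_mul, map_add, map_smul, map_smul, WeightFunction.pathA, hA, WeightFunction.pathB,
        hA, hGx]
      exact h.border_sq a ha
    | mul_f_g a ha =>
      rw [m.isVirtual_iff, m.isVirtual_iff, m.len_f_f, m.exception_iff, not_or] at ha
      rw [map_mul, map_mul, map_zero, hGx, hGx, hGx]
      exact h.mul_f_g a ha.1 ha.2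
    | mul_g_f a ha =>
      rw [m.isVirtual_iff, m.isVirtual_iff, m.exception_iff, m.len_f_f, not_or] at ha
      rw [map_mul, map_mul, map_zero, hGx, hGx, hGx]
      exact h.mul_g_f a ha.1 ha.2
  refine ⟨RingQuot.liftAlgHom K ⟨G, hG⟩, fun i => ?_, fun a => ?_⟩
  · exact (RingQuot.liftAlgHom_mkAlgHom_apply K G hG _).trans (hGe i)
  · exact (RingQuot.liftAlgHom_mkAlgHom_apply K G hG _).trans (hGx a)

theorem adjoin_eq_top :
    Algebra.adjoin K (Set.range (vertex m c b) ∪ Set.range (arrow m c b)) = ⊤ := by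
  have hs : Function.Surjective
      ((proj m c b).comp (RingQuot.mkAlgHom K (Q.PathRel K) : _ →ₐ[K] Q.PathAlgebra K)) :=
    (RingQuot.mkAlgHom_surjective K _).comp (RingQuot.mkAlgHom_surjective K _)
  rw [← (AlgHom.range_eq_top _).mpr hs, ← Algebra.map_top, ← FreeAlgebra.adjoin_range_ι,
    AlgHom.map_adjoin, ← Set.range_comp]
  congr 1
  ext y
  simp only [Set.mem_union, Set.mem_range, Function.comp_apply, Sum.exists]
  rfl

/-- A subspace that contains `1` and is stable under right multiplication by the vertices and the
arrows is the whole algebra. -/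
theorem eq_top_of_mul_mem {W : Submodule K (SocleDeformedAlgebra m c b)} (h1 : 1 ∈ W)
    (he : ∀ w ∈ W, ∀ i, w * vertex m c b i ∈ W) (hx : ∀ w ∈ W, ∀ a, w * arrow m c b a ∈ W) :
    W = ⊤ := by
  have key : ∀ r : SocleDeformedAlgebra m c b, ∀ w ∈ W, w * r ∈ W := by
    intro r
    have hr : r ∈ Algebra.adjoin K (Set.range (vertex m c b) ∪ Set.range (arrow m c b)) := by
      rw [adjoin_eq_top]; trivial
    induction hr using Algebra.adjoin_induction with
    | mem y hy =>
      rcases hy with ⟨i, rfl⟩ | ⟨a, rfl⟩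
      · exact fun w hw => he w hw i
      · exact fun w hw => hx w hw a
    | algebraMap k =>
      intro w hw
      rw [← Algebra.commutes, ← Algebra.smul_def]
      exact W.smul_mem k hw
    | add y z _ _ hy hz =>
      intro w hw
      rw [mul_add]
      exact W.add_mem (hy w hw) (hz w hw)
    | mul y z _ _ hy hz =>
      intro w hw
      rw [← mul_assoc]
      exact hz _ (hy w hw)
  rw [eq_top_iff]
  intro r _
  simpa using key r 1 h1

end SocleDeformedAlgebra

end Solutions

end TriangulationQuiver

namespace TriangulationQuiver

universe u v

/-! ### Consequences of the relations with zero border function. -/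

section Relations

variable {Q : TriangulationQuiver} {K : Type u} [Field K] {R : Type v} [Ring R] [Algebra K R]

theorem WeightFunction.f_f_bar_of_len_eq_two (m : Q.WeightFunction) {a : Q.Arrow}
    (h : m.len a = 2) : Q.f (Q.f (Q.bar a)) = Q.g a := by
  apply g_injective
  rw [g_f_f_bar, m.g_g_of_len_eq_two h]

theorem WeightFunction.g_f_bar_of_len_eq_two (m : Q.WeightFunction) {a : Q.Arrow}
    (h : m.len a = 2) : Q.g (Q.f (Q.bar a)) = Q.f a := by
  rw [← bar_f, m.f_f_bar_of_len_eq_two h, bar_g]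

/-- The condition under which `A_α x_β` is not zero, where `β` is the arrow that does not follow
`A_α` on its `g`-cycle. -/
def WeightFunction.IsExceptional (m : Q.WeightFunction) (a : Q.Arrow) : Prop :=
  m.len a = 2 ∨ m.len (Q.f a) = 2 ∧ m.len a = 3

/-- An exceptional A_α can turn into A_ᾱ; this lemma prevents it from turning back, which is needed
for nilpotency of the arrows. -/
theorem WeightFunction.IsExceptional.not_bar {m : Q.WeightFunction} {a : Q.Arrow}
    (h : m.IsExceptional a) : ¬ m.IsExceptional (Q.bar a) := by
  rintro (h' | ⟨h1', h2'⟩)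
  · rcases h with h | ⟨h1, h2⟩
    · exact m.len_bar_ne_two_of_len h h'
    · refine m.len_f_ne_two_of_len h1 ?_
      rw [m.len_f_f, h']
  · rcases h with h | ⟨h1, h2⟩
    · refine m.len_f_ne_two_of_len h1' ?_
      rw [m.len_f_f, bar_bar, h]
    · exact m.not_len_eq_three h1 h2 h2'

namespace IsSolution

variable {m : Q.WeightFunction} {c : Q.ParameterFunction K} {e : Q.Vertex → R} {x : Q.Arrow → R}

section

variable {b : Q.BorderFunction K}

theorem map (h : IsSolution m c b e x) {R' : Type*} [Ring R'] [Algebra K R'] (F : R →ₐ[K] R') :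
    IsSolution m c b (fun i => F (e i)) fun a => F (x a) := by
  have hF : ∀ a l, F (gProd x a l) = gProd (fun a => F (x a)) a l :=
    fun a l => map_gProd (F : R →+* R') x a l
  refine { h.toIsPathSystem.map (F : R →+* R') with
    mul_f := fun a ha => ?_
    border_sq := fun a ha => ?_
    mul_f_g := fun a h1 h2 => ?_
    mul_g_f := fun a h1 h2 => ?_ }
  · rw [← map_mul, h.mul_f a ha, map_smul, hF]
  · rw [← map_mul, h.border_sq a ha, map_add, map_smul, map_smul, hF, hF]
  · rw [← map_mul, ← map_mul, h.mul_f_g a h1 h2, map_zero]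
  · rw [← map_mul, ← map_mul, h.mul_g_f a h1 h2, map_zero]

end

variable (h : IsSolution m c 0 e x)
include h

theorem mul_f' (a : Q.Arrow) :
    x a * x (Q.f a) = c.c (Q.bar a) • gProd x (Q.bar a) (m.len (Q.bar a) - 1) := by
  by_cases ha : Q.IsBorderLoop a
  · have := h.border_sq a ha
    rw [Pi.zero_apply, zero_smul, add_zero] at this
    rwa [show Q.f a = a from ha]
  · exact h.mul_f a ha

theorem mul_f_of_len_eq_two {a : Q.Arrow} (ha : m.len (Q.bar a) = 2) :
    x a * x (Q.f a) = c.c (Q.bar a) • x (Q.bar a) := by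
  rw [h.mul_f', ha, gProd_one]

/-- The triangle path α f(α) f²(α) can be rewritten in two ways: its first two arrows give a
multiple of A_ᾱ, its last two a multiple of A_{g(α)}. This lemma and the next one are the two
readings; together they identify c_ᾱ B_ᾱ with c_α B_α. -/
theorem smul_gProd_len (a : Q.Arrow) :
    c.c (Q.bar a) • gProd x (Q.bar a) (m.len (Q.bar a)) =
      x a * x (Q.f a) * x (Q.f (Q.f a)) := by
  have h2 := m.two_le_len (Q.bar a)
  obtain ⟨l, hl⟩ : ∃ l, m.len (Q.bar a) = l + 1 := ⟨m.len (Q.bar a) - 1, by omega⟩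
  have h3 := m.iterate_g_len_sub_one (Q.bar a)
  rw [hl, Nat.add_sub_cancel, bar_bar] at h3
  rw [h.mul_f', hl, gProd_succ, h3, Nat.add_sub_cancel, smul_mul_assoc]

theorem smul_gProd_len' (a : Q.Arrow) :
    c.c a • gProd x a (m.len a) = x a * x (Q.f a) * x (Q.f (Q.f a)) := by
  have h2 := m.two_le_len a
  obtain ⟨l, hl⟩ : ∃ l, m.len a = l + 1 := ⟨m.len a - 1, by omega⟩
  rw [mul_assoc, h.mul_f', bar_f, m.len_g, c.c_g, hl, gProd_succ', Nat.add_sub_cancel,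
    mul_smul_comm]

theorem smul_gProd_len_bar (a : Q.Arrow) :
    c.c (Q.bar a) • gProd x (Q.bar a) (m.len (Q.bar a)) = c.c a • gProd x a (m.len a) :=
  (h.smul_gProd_len a).trans (h.smul_gProd_len' a).symm

/-- Up to a nonzero scalar B_α x_α is the product along ᾱ, f(ᾱ), f²(ᾱ), α. As α = g(f²(ᾱ)), the last
three factors are a zero relation at f(ᾱ), unless one of its two exceptions occurs; there a virtual
arrow is substituted and another zero relation appears. -/
theorem gProd_len_succ (a : Q.Arrow) : gProd x a (m.len a + 1) = 0 := by
  have hc := c.c_ne_zero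
  suffices hs : c.c a • gProd x a (m.len a + 1) = 0 from (smul_eq_zero.mp hs).resolve_left (hc a)
  rw [gProd_succ, m.iterate_g_len, ← smul_mul_assoc, ← h.smul_gProd_len_bar a,
    h.smul_gProd_len', mul_assoc, mul_assoc, ← mul_assoc (x (Q.f _))]
  have hgf : Q.g (Q.f (Q.f (Q.bar a))) = a := g_f_f_bar a
  by_cases h1 : m.len (Q.bar a) = 2
  · have h2 : Q.f (Q.g (Q.bar a)) = a := by
      rw [← bar_g, m.g_g_of_len_eq_two h1, bar_bar]
    have h3 := h.mul_g_f (Q.bar a) (m.len_f_ne_two_of_len h1)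
      (fun hh => m.len_bar_ne_two_of_len h1 hh.1)
    rw [h2] at h3
    rw [h.mul_f_of_len_eq_two (by rw [bar_f, m.len_g, h1]), bar_f, smul_mul_assoc, mul_smul_comm,
      ← mul_assoc, h3, smul_zero]
  by_cases h4 : m.len (Q.f (Q.g (Q.bar a))) = 2 ∧ m.len (Q.bar a) = 3
  · obtain ⟨h4, h5⟩ := h4
    have h6 : Q.g (Q.g (Q.bar a)) = Q.f (Q.f a) := by
      apply g_injective
      rw [m.g_g_g_of_len_eq_three h5, g_f_f]
    have h7 : Q.f (Q.g (Q.bar a)) = Q.g (Q.f a) := by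
      rw [← bar_g, h6]; rfl
    have hfa : m.len (Q.f a) = 2 := by rw [← m.len_g, ← h7, h4]
    have h8 : x a * x (Q.f a) = c.c (Q.bar a) • (x (Q.bar a) * x (Q.g (Q.bar a))) := by
      rw [h.mul_f', h5, gProd_two]
    -- Up to scalars this is x_ᾱ A_{f(ᾱ)}, and A_{f(ᾱ)} has length at least two, so the product
    -- begins with the zero relation at ᾱ.
    have h9 : x a * x (Q.f a) * x (Q.g (Q.f a)) = 0 := by
      obtain ⟨l, hl⟩ : ∃ l, m.len (Q.f (Q.bar a)) - 1 = l + 1 + 1 := by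
        have := m.three_le_len (a := Q.f (Q.bar a)) (fun hh => m.len_f_g_ne_two hh h4)
        exact ⟨m.len (Q.f (Q.bar a)) - 3, by omega⟩
      have h10 := h.mul_f_g (Q.bar a)
        (by rw [bar_bar]; exact fun hh => m.len_f_ne_two_of_len hh hfa)
        (by rw [bar_bar]; exact fun hh => m.not_len_eq_three hh.1 hh.2 h5)
      rw [h8, ← h7, smul_mul_assoc, mul_assoc, h.mul_f', bar_g, hl, gProd_succ', gProd_succ',
        mul_smul_comm, ← mul_assoc, ← mul_assoc, h10, zero_mul, smul_zero, smul_zero]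
    have h11 : x (Q.f (Q.f a)) * x a = c.c (Q.g (Q.f a)) • x (Q.g (Q.f a)) := by
      have := h.mul_f_of_len_eq_two (a := Q.f (Q.f a)) (by rw [bar_f, m.len_g, hfa])
      rwa [Q.f_f_f, bar_f] at this
    have h12 : x (Q.f (Q.bar a)) * x (Q.f (Q.f (Q.bar a))) =
        c.c (Q.bar a) • (x (Q.g (Q.bar a)) * x (Q.f (Q.f a))) := by
      rw [h.mul_f', bar_f, m.len_g, h5, gProd_two, h6, c.c_g]
    rw [h12, smul_mul_assoc, mul_smul_comm, mul_assoc, h11, mul_smul_comm, mul_smul_comm,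
      ← mul_assoc, smul_comm, ← smul_mul_assoc, ← h8, h9, smul_zero]
  · have := h.mul_f_g (Q.f (Q.bar a)) (by rwa [bar_f, m.len_g]) (by rwa [bar_f, m.len_g])
    rw [hgf] at this
    rw [this, mul_zero]

theorem gProd_eq_zero {a : Q.Arrow} {l : ℕ} (hl : m.len a < l) : gProd x a l = 0 := by
  obtain ⟨k, rfl⟩ := Nat.exists_eq_add_of_le (Nat.succ_le_of_lt hl)
  rw [gProd_add, Nat.succ_eq_add_one, h.gProd_len_succ, zero_mul]

theorem gProd_len_mul (a y : Q.Arrow) : gProd x a (m.len a) * x y = 0 := by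
  have h2 := m.two_le_len a
  by_cases hy : Q.src y = Q.src a
  · rcases Q.eq_or_eq_bar a y hy with rfl | rfl
    · have := h.gProd_len_succ y
      rwa [gProd_succ, m.iterate_g_len] at this
    · have h1 := h.gProd_len_succ (Q.bar a)
      rw [gProd_succ, m.iterate_g_len] at h1
      have h3 := congrArg (· * x (Q.bar a)) (h.smul_gProd_len_bar a)
      simp only [smul_mul_assoc, h1, smul_zero] at h3
      exact (smul_eq_zero.mp h3.symm).resolve_left (c.c_ne_zero a)
  · have := h.gProd_mul_src a (l := m.len a) (by omega)
    rw [m.iterate_g_len] at this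
    exact h.mul_eq_zero this (h.src_mul y) (Ne.symm hy)

/-- The product of `A_α` with the arrow that does not follow it on its `g`-cycle. -/
theorem gProd_len_sub_one_mul (a : Q.Arrow) :
    ∃ k : K, gProd x a (m.len a - 1) * x (Q.g (Q.f (Q.bar a))) =
      k • gProd x (Q.bar a) (m.len (Q.bar a) - 1) ∧ (k ≠ 0 → m.IsExceptional a) := by
  by_cases hE : m.IsExceptional a
  · refine (?_ : ∃ k : K, _).imp fun k hk => ⟨hk, fun _ => hE⟩
    rcases hE with h1 | ⟨h1, h2⟩
    · exact ⟨c.c (Q.bar a), by rw [m.g_f_bar_of_len_eq_two h1, h1, gProd_one, h.mul_f']⟩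
    · have h3 : Q.g (Q.f (Q.bar a)) = Q.f (Q.g a) := by
        rw [← m.f_iterate_g_len_sub_two, h2, Function.iterate_one]
      refine ⟨c.c (Q.f a) * c.c (Q.bar a), ?_⟩
      rw [h3, h2, gProd_two, mul_assoc, h.mul_f_of_len_eq_two (by rwa [bar_g]), bar_g,
        mul_smul_comm, h.mul_f', mul_smul]
  · refine ⟨0, ?_, fun h => absurd rfl h⟩
    have h1 := h.mul_f_g (Q.bar a) (by rw [bar_bar]; exact fun hh => hE (Or.inl hh))
      (by rw [bar_bar]; exact fun hh => hE (Or.inr hh))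
    rw [h.mul_f', bar_bar, smul_mul_assoc] at h1
    rw [zero_smul]
    exact (smul_eq_zero.mp h1).resolve_left (c.c_ne_zero a)

/-- The product of a path on a `g`-cycle with the arrow that does not follow it. -/
theorem gProd_mul_f_mem (a : Q.Arrow) (k : ℕ) :
    gProd x a (k + 1) * x (Q.f (Q.g^[k] a)) ∈ Submodule.span K
      {gProd x (Q.bar a) (m.len (Q.bar a) - 1), gProd x a (m.len a - 1), gProd x a (m.len a)} := by
  induction k with
  | zero =>
    rw [zero_add, gProd_one, Function.iterate_zero_apply, h.mul_f']
    exact Submodule.smul_mem _ _ (Submodule.subset_span (Or.inl rfl))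
  | succ k ih =>
    have hlen := m.len_iterate k a
    rw [Function.iterate_succ_apply']
    have h0 : gProd x a (k + 1 + 1) =
        gProd x a k * (x (Q.g^[k] a) * x (Q.g (Q.g^[k] a))) := by
      rw [gProd_succ, gProd_succ, Function.iterate_succ_apply', mul_assoc]
    generalize hy : Q.g^[k] a = y at *
    rw [h0]
    -- If f(y) is virtual, then x_{g(y)} x_{f(g(y))} is a multiple of x_{f(y)}, which shortens the
    -- path by one arrow and allows the induction.
    by_cases h1 : m.len (Q.f y) = 2
    · rw [mul_assoc, mul_assoc, h.mul_f_of_len_eq_two (a := Q.g y) (by rwa [bar_g]), bar_g,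
        mul_smul_comm, mul_smul_comm, ← mul_assoc]
      refine Submodule.smul_mem _ _ ?_
      rwa [gProd_succ, hy] at ih
    -- In the other exception the last three arrows give a multiple of A_y. Appended to the initial
    -- path of length k, it is A_α for k = 0, B_α for k = 1, and zero for longer initial paths.
    by_cases h2 : m.len (Q.bar y) = 2 ∧ m.len (Q.f y) = 3
    · obtain ⟨h2, h3⟩ := h2
      have h4 : Q.g (Q.f y) = Q.f (Q.bar y) := by
        rw [← m.g_f_bar_of_len_eq_two h2, bar_bar]
      have h5 : x y * x (Q.g y) * x (Q.f (Q.g y)) =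
          (c.c (Q.f y) * (c.c (Q.bar y) * c.c y)) • gProd x y (m.len y - 1) := by
        rw [mul_assoc, h.mul_f', bar_g, h3, gProd_two, mul_smul_comm, ← mul_assoc,
          h.mul_f_of_len_eq_two h2, smul_mul_assoc, h4, h.mul_f', bar_bar, mul_smul, mul_smul]
      have h6 : gProd x a k * gProd x y (m.len y - 1) = gProd x a (k + (m.len a - 1)) := by
        rw [gProd_add, hy, ← hlen]
      rw [mul_assoc, h5, mul_smul_comm, h6]
      refine Submodule.smul_mem _ _ ?_
      have := m.two_le_len a
      rcases k with _ | _ | k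
      · exact Submodule.subset_span (by simp)
      · rw [show 0 + 1 + (m.len a - 1) = m.len a by omega]
        exact Submodule.subset_span (by simp)
      · rw [h.gProd_eq_zero (a := a) (l := k + 1 + 1 + (m.len a - 1)) (by omega)]
        exact Submodule.zero_mem _
    · rw [mul_assoc, h.mul_g_f y h1 h2, mul_zero]
      exact Submodule.zero_mem _

end IsSolution

end Relations

end TriangulationQuiver

namespace TriangulationQuiver

universe u v

/-! ### Nilpotency of the arrows and spanning by paths along g-cycles. -/

section Filtration

variable {Q : TriangulationQuiver} {K : Type u} [Field K] {R : Type v} [Ring R] [Algebra K R]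

/-- The span of the paths of length at least `k` on the `g`-cycles. -/
def pathSpan (K : Type u) [Field K] [Algebra K R] (x : Q.Arrow → R) (k : ℕ) : Submodule K R :=
  Submodule.span K {y | ∃ a l, k ≤ l ∧ y = gProd x a l}

/-- The span of the paths `A_α` and `B_α`. -/
def endSpan (m : Q.WeightFunction) (K : Type u) [Field K] [Algebra K R] (x : Q.Arrow → R) :
    Submodule K R :=
  Submodule.span K (Set.range (fun a => gProd x a (m.len a - 1)) ∪
    Set.range fun a => gProd x a (m.len a))

theorem gProd_mem_pathSpan {x : Q.Arrow → R} {k l : ℕ} (a : Q.Arrow) (h : k ≤ l) :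
    gProd x a l ∈ pathSpan K x k :=
  Submodule.subset_span ⟨a, l, h, rfl⟩

theorem endSpan_le_pathSpan (m : Q.WeightFunction) (x : Q.Arrow → R) :
    endSpan m K x ≤ pathSpan K x 1 := by
  refine Submodule.span_le.mpr ?_
  rintro _ (⟨a, rfl⟩ | ⟨a, rfl⟩)
  · exact gProd_mem_pathSpan a (by have := m.two_le_len a; omega)
  · exact gProd_mem_pathSpan a (by have := m.two_le_len a; omega)

theorem pathSpan_anti (x : Q.Arrow → R) {k l : ℕ} (h : k ≤ l) :
    pathSpan K x l ≤ pathSpan K x k := by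
  refine Submodule.span_le.mpr ?_
  rintro _ ⟨a, l', hl, rfl⟩
  exact gProd_mem_pathSpan a (h.trans hl)

namespace IsSolution

variable {m : Q.WeightFunction} {c : Q.ParameterFunction K} {e : Q.Vertex → R} {x : Q.Arrow → R}
variable (h : IsSolution m c 0 e x)
include h

theorem gProd_mul_cases (a : Q.Arrow) {l : ℕ} (hl : l ≠ 0) (y : Q.Arrow) :
    gProd x a l * x y = 0 ∨ y = Q.g^[l] a ∨ y = Q.f (Q.g^[l - 1] a) := by
  obtain ⟨l, rfl⟩ := Nat.exists_eq_succ_of_ne_zero hl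
  by_cases hy : Q.tgt (Q.g^[l] a) = Q.src y
  · refine Or.inr ?_
    rw [Function.iterate_succ_apply', Nat.succ_sub_one]
    exact ((tgt_eq_iff _ _).mp hy).symm
  · exact Or.inl (h.mul_eq_zero (h.gProd_mul_src a hl) (h.src_mul y)
      (by rwa [Function.iterate_succ_apply', src_g]))

theorem gProd_mul_mem (a : Q.Arrow) {l : ℕ} (hl : l ≠ 0) (y : Q.Arrow) :
    gProd x a l * x y ∈ pathSpan K x (l + 1) ⊔ endSpan m K x := by
  rcases h.gProd_mul_cases a hl y with h0 | rfl | rfl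
  · rw [h0]; exact Submodule.zero_mem _
  · rw [← gProd_succ]
    exact Submodule.mem_sup_left (gProd_mem_pathSpan a le_rfl)
  · refine Submodule.mem_sup_right ?_
    obtain ⟨l, rfl⟩ := Nat.exists_eq_succ_of_ne_zero hl
    refine Submodule.span_mono ?_ (h.gProd_mul_f_mem a l)
    rintro _ (rfl | rfl | rfl)
    · exact Or.inl ⟨_, rfl⟩
    · exact Or.inl ⟨_, rfl⟩
    · exact Or.inr ⟨_, rfl⟩

theorem gProd_len_sub_one_mul_cases (a y : Q.Arrow) :
    gProd x a (m.len a - 1) * x y = 0 ∨ gProd x a (m.len a - 1) * x y = gProd x a (m.len a) ∨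
      m.IsExceptional a ∧ ∃ k : K, gProd x a (m.len a - 1) * x y =
        k • gProd x (Q.bar a) (m.len (Q.bar a) - 1) := by
  have h2 := m.two_le_len a
  rcases h.gProd_mul_cases a (l := m.len a - 1) (by omega) y with h0 | rfl | rfl
  · exact Or.inl h0
  · rw [← gProd_succ]
    exact Or.inr (Or.inl (by congr 1; omega))
  · obtain ⟨k, hk, hk'⟩ := h.gProd_len_sub_one_mul a
    rw [Nat.sub_sub, show 1 + 1 = 2 from rfl, m.f_iterate_g_len_sub_two, hk]
    by_cases h0 : k = 0
    · exact Or.inl (by rw [h0, zero_smul])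
    · exact Or.inr (Or.inr ⟨hk' h0, k, rfl⟩)

theorem endSpan_mul : endSpan m K x * Submodule.span K (Set.range x) ≤
    Submodule.span K ({y | ∃ a, m.IsExceptional a ∧
      y = gProd x (Q.bar a) (m.len (Q.bar a) - 1)} ∪ Set.range fun a => gProd x a (m.len a)) := by
  rw [endSpan, Submodule.span_mul_span, Submodule.span_le]
  rintro _ ⟨_, ⟨a, rfl⟩ | ⟨a, rfl⟩, _, ⟨y, rfl⟩, rfl⟩
  · simp only [SetLike.mem_coe]
    rcases h.gProd_len_sub_one_mul_cases a y with h0 | h0 | ⟨hE, k, hk⟩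
    · rw [h0]; exact Submodule.zero_mem _
    · rw [h0]; exact Submodule.subset_span (Or.inr ⟨a, rfl⟩)
    · rw [hk]; exact Submodule.smul_mem _ _ (Submodule.subset_span (Or.inl ⟨a, hE, rfl⟩))
  · simp only [SetLike.mem_coe]
    rw [h.gProd_len_mul]
    exact Submodule.zero_mem _

/-- An arrow takes A_α to zero, to B_α or, only for exceptional α, to a multiple of A_ᾱ. Since ᾱ is
then not exceptional, a second arrow leads at most to some B, and a third one kills it. -/
theorem endSpan_mul_mul_mul : endSpan m K x * Submodule.span K (Set.range x) *
    Submodule.span K (Set.range x) * Submodule.span K (Set.range x) = ⊥ := by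
  have h1 : endSpan m K x * Submodule.span K (Set.range x) * Submodule.span K (Set.range x) ≤
      Submodule.span K (Set.range fun a => gProd x a (m.len a)) := by
    refine (mul_le_mul' h.endSpan_mul le_rfl).trans ?_
    rw [Submodule.span_mul_span, Submodule.span_le]
    rintro _ ⟨_, ⟨a, hE, rfl⟩ | ⟨a, rfl⟩, _, ⟨y, rfl⟩, rfl⟩
    · simp only [SetLike.mem_coe]
      rcases h.gProd_len_sub_one_mul_cases (Q.bar a) y with h0 | h0 | ⟨hE', k, hk⟩
      · rw [h0]; exact Submodule.zero_mem _
      · rw [h0]; exact Submodule.subset_span ⟨_, rfl⟩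
      · exact absurd hE' hE.not_bar
    · simp only [SetLike.mem_coe]
      rw [h.gProd_len_mul]
      exact Submodule.zero_mem _
  rw [eq_bot_iff]
  refine (mul_le_mul' h1 le_rfl).trans ?_
  rw [Submodule.span_mul_span, Submodule.span_le]
  rintro _ ⟨_, ⟨a, rfl⟩, _, ⟨y, rfl⟩, rfl⟩
  exact h.gProd_len_mul a y

theorem exists_pathSpan_eq_bot : ∃ k, pathSpan K x (k + 1) = ⊥ := by
  refine ⟨∑ a, m.len a, ?_⟩
  rw [pathSpan, Submodule.span_eq_bot]
  rintro _ ⟨a, l, hl, rfl⟩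
  refine h.gProd_eq_zero (lt_of_lt_of_le (Nat.lt_succ_of_le ?_) hl)
  exact Finset.single_le_sum (f := fun a => m.len a) (fun _ _ => Nat.zero_le _)
    (Finset.mem_univ a)

/-- Each further arrow either lengthens a path on its g-cycle or turns off it. Turning off leads
into `endSpan`, which is stable under multiplication by arrows, and paths that are too long vanish.
-/
theorem pathSpan_mul_pow (k : ℕ) : pathSpan K x 1 * Submodule.span K (Set.range x) ^ k ≤
    pathSpan K x (k + 1) ⊔ endSpan m K x := by
  induction k with
  | zero => simp
  | succ k ih =>
    rw [pow_succ, ← mul_assoc]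
    refine (mul_le_mul' ih le_rfl).trans ?_
    rw [Submodule.sup_mul]
    refine sup_le ?_ ?_
    · rw [pathSpan, Submodule.span_mul_span, Submodule.span_le]
      rintro _ ⟨_, ⟨a, l, hl, rfl⟩, _, ⟨y, rfl⟩, rfl⟩
      exact sup_le_sup_right (pathSpan_anti x (Nat.succ_le_succ hl)) _
        (h.gProd_mul_mem a (by omega) y)
    · refine (h.endSpan_mul.trans (Submodule.span_mono ?_)).trans le_sup_right
      rintro _ (⟨a, -, rfl⟩ | ⟨a, rfl⟩)
      · exact Or.inl ⟨_, rfl⟩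
      · exact Or.inr ⟨_, rfl⟩

theorem exists_pow_eq_bot : ∃ k, Submodule.span K (Set.range x) ^ k = ⊥ := by
  obtain ⟨k, hk⟩ := h.exists_pathSpan_eq_bot
  refine ⟨1 + k + 1 + 1 + 1, ?_⟩
  have h1 : Submodule.span K (Set.range x) ≤ pathSpan K x 1 := by
    rw [Submodule.span_le]
    rintro _ ⟨a, rfl⟩
    exact Submodule.subset_span ⟨a, 1, le_rfl, (gProd_one x a).symm⟩
  have h2 : Submodule.span K (Set.range x) ^ (1 + k) ≤ endSpan m K x := by
    rw [pow_add, pow_one]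
    refine (mul_le_mul' h1 le_rfl).trans ((h.pathSpan_mul_pow k).trans ?_)
    rw [hk, bot_sup_eq]
  rw [eq_bot_iff, ← h.endSpan_mul_mul_mul, pow_succ, pow_succ, pow_succ]
  exact mul_le_mul' (mul_le_mul' (mul_le_mul' h2 le_rfl) le_rfl) le_rfl

theorem finite_pathSpan : (pathSpan K x 1).FG := by
  obtain ⟨k, hk⟩ := h.exists_pathSpan_eq_bot
  refine Submodule.fg_def.mpr ⟨Set.range fun p : Q.Arrow × Fin (k + 1) => gProd x p.1 (p.2 + 1),
    Set.finite_range _, le_antisymm ?_ ?_⟩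
  · rw [Submodule.span_le]
    rintro _ ⟨p, rfl⟩
    exact gProd_mem_pathSpan _ (by omega)
  · refine Submodule.span_le.mpr ?_
    rintro _ ⟨a, l, hl, rfl⟩
    by_cases hlk : l < k + 1
    · refine Submodule.subset_span ⟨(a, ⟨l - 1, by omega⟩), ?_⟩
      simp only
      congr 1
      omega
    · have : gProd x a l ∈ pathSpan K x (k + 1) := gProd_mem_pathSpan a (by omega)
      rw [hk, Submodule.mem_bot] at this
      rw [this]
      exact Submodule.zero_mem _

end IsSolution

theorem gProd_zero_fun (a : Q.Arrow) {l : ℕ} (hl : l ≠ 0) :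
    gProd (0 : Q.Arrow → R) a l = 0 := by
  obtain ⟨l, rfl⟩ := Nat.exists_eq_succ_of_ne_zero hl
  rw [gProd_succ, Pi.zero_apply, mul_zero]

end Filtration

/-! ### The augmentation of Λ and its nilpotent kernel. -/

section Augmentation

variable {Q : TriangulationQuiver} {K : Type u} [Field K] {R : Type v} [Ring R] [Algebra K R]

/-- The augmentation of `Λ` that maps all arrows to zero. -/
theorem exists_augmentation [DecidableEq Q.Vertex] (m : Q.WeightFunction)
    (c : Q.ParameterFunction K) (b : Q.BorderFunction K) :
    ∃ ε : SocleDeformedAlgebra m c b →ₐ[K] (Q.Vertex → K),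
      (∀ i, ε (SocleDeformedAlgebra.vertex m c b i) = Pi.single i 1) ∧
      ∀ a, ε (SocleDeformedAlgebra.arrow m c b a) = 0 := by
  have hlen : ∀ a, m.len a ≠ 0 ∧ m.len a - 1 ≠ 0 := fun a => by
    have := m.two_le_len a
    omega
  have h : IsSolution m c b (fun i => (Pi.single i 1 : Q.Vertex → K)) 0 :=
    { complete := CompleteOrthogonalIdempotents.single _
      src_mul := fun a => by simp
      mul_tgt := fun a => by simp
      mul_f := fun a _ => by simp [gProd_zero_fun _ (hlen _).2]
      border_sq := fun a _ => by simp [gProd_zero_fun _ (hlen _).2, gProd_zero_fun _ (hlen _).1]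
      mul_f_g := fun a _ _ => by simp
      mul_g_f := fun a _ _ => by simp }
  exact SocleDeformedAlgebra.exists_lift h

end Augmentation

namespace WeightedAlgebra

open SocleDeformedAlgebra

variable {Q : TriangulationQuiver} {K : Type u} [Field K] (m : Q.WeightFunction)
  (c : Q.ParameterFunction K)

theorem isSolution : IsSolution m c 0 (vertex m c 0) (arrow m c 0) :=
  SocleDeformedAlgebra.isSolution m c 0

/-- Multiplying a path along a g-cycle by an arrow gives again a combination of such paths, so these
and the vertices span. Finite dimension follows, as only finitely many of the paths are nonzero. -/
theorem span_vertex_sup_pathSpan :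
    Submodule.span K (Set.range (vertex m c 0)) ⊔ pathSpan K (arrow m c 0) 1 = ⊤ := by
  have h := isSolution m c
  refine eq_top_of_mul_mem ?_ ?_ ?_
  · rw [← h.complete.complete]
    exact Submodule.sum_mem _ fun i _ => Submodule.mem_sup_left (Submodule.subset_span ⟨i, rfl⟩)
  · intro w hw i
    obtain ⟨w, hw₁, w', hw', rfl⟩ := Submodule.mem_sup.mp hw
    clear hw
    rw [add_mul]
    refine Submodule.add_mem _ ?_ ?_
    · refine Submodule.mem_sup_left ?_
      clear hw'
      induction hw₁ using Submodule.span_induction with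
      | mem w hw =>
        obtain ⟨j, rfl⟩ := hw
        by_cases hij : j = i
        · subst hij
          rw [h.complete.idem j]
          exact Submodule.subset_span ⟨j, rfl⟩
        · rw [h.complete.ortho hij]
          exact Submodule.zero_mem _
      | zero => rw [zero_mul]; exact Submodule.zero_mem _
      | add y z _ _ hy hz => rw [add_mul]; exact Submodule.add_mem _ hy hz
      | smul k y _ hy => rw [smul_mul_assoc]; exact Submodule.smul_mem _ _ hy
    · refine Submodule.mem_sup_right ?_
      clear hw₁
      induction hw' using Submodule.span_induction with
      | mem w hw =>
        obtain ⟨a, l, hl, rfl⟩ := hw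
        by_cases hij : Q.src (Q.g^[l] a) = i
        · subst hij
          rw [h.gProd_mul_src a (by omega)]
          exact gProd_mem_pathSpan a hl
        · rw [h.mul_e_eq_zero (h.gProd_mul_src a (by omega)) hij]
          exact Submodule.zero_mem _
      | zero => rw [zero_mul]; exact Submodule.zero_mem _
      | add y z _ _ hy hz => rw [add_mul]; exact Submodule.add_mem _ hy hz
      | smul k y _ hy => rw [smul_mul_assoc]; exact Submodule.smul_mem _ _ hy
  · intro w hw a
    refine Submodule.mem_sup_right ?_
    obtain ⟨w, hw₁, w', hw', rfl⟩ := Submodule.mem_sup.mp hw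
    clear hw
    rw [add_mul]
    refine Submodule.add_mem _ ?_ ?_
    · clear hw'
      induction hw₁ using Submodule.span_induction with
      | mem w hw =>
        obtain ⟨j, rfl⟩ := hw
        by_cases hij : Q.src a = j
        · subst hij
          rw [h.src_mul, ← gProd_one (arrow m c 0)]
          exact gProd_mem_pathSpan a le_rfl
        · rw [h.e_mul_eq_zero (h.src_mul a) (Ne.symm hij)]
          exact Submodule.zero_mem _
      | zero => rw [zero_mul]; exact Submodule.zero_mem _
      | add y z _ _ hy hz => rw [add_mul]; exact Submodule.add_mem _ hy hz
      | smul k y _ hy => rw [smul_mul_assoc]; exact Submodule.smul_mem _ _ hy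
    · have h1 := (Submodule.mul_mem_mul hw' (Submodule.subset_span ⟨a, rfl⟩) :
        w' * arrow m c 0 a ∈ pathSpan K (arrow m c 0) 1 *
          Submodule.span K (Set.range (arrow m c 0)))
      have h2 := h.pathSpan_mul_pow 1
      rw [pow_one] at h2
      exact sup_le (pathSpan_anti _ (by omega)) (endSpan_le_pathSpan m _) (h2 h1)

theorem module_finite : Module.Finite K (WeightedAlgebra m c) := by
  refine ⟨?_⟩
  rw [← span_vertex_sup_pathSpan m c]
  exact (Submodule.fg_span (Set.finite_range _)).sup (isSolution m c).finite_pathSpan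

variable {m c} [DecidableEq Q.Vertex] {ε : WeightedAlgebra m c →ₐ[K] (Q.Vertex → K)}
  (hεe : ∀ i, ε (vertex m c 0 i) = Pi.single i 1) (hεx : ∀ a, ε (arrow m c 0 a) = 0)
include hεe hεx

theorem ker_eq_pathSpan : LinearMap.ker ε.toLinearMap = pathSpan K (arrow m c 0) 1 := by
  have hle : pathSpan K (arrow m c 0) 1 ≤ LinearMap.ker ε.toLinearMap := by
    refine Submodule.span_le.mpr ?_
    rintro _ ⟨a, l, hl, rfl⟩
    obtain ⟨l, rfl⟩ := Nat.exists_eq_add_of_le' hl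
    simp only [SetLike.mem_coe, LinearMap.mem_ker, AlgHom.toLinearMap_apply]
    rw [gProd_succ, map_mul, hεx, mul_zero]
  refine le_antisymm ?_ hle
  intro r hr
  have hr' : r ∈ Submodule.span K (Set.range (vertex m c 0)) ⊔ pathSpan K (arrow m c 0) 1 := by
    rw [span_vertex_sup_pathSpan]; trivial
  obtain ⟨d, hd, n, hn, rfl⟩ := Submodule.mem_sup.mp hr'
  obtain ⟨k, rfl⟩ := (Submodule.mem_span_range_iff_exists_fun K).mp hd
  have h0 : ∀ j, k j = 0 := by
    intro j
    rw [LinearMap.mem_ker, map_add, (LinearMap.mem_ker.mp (hle hn)), add_zero] at hr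
    have := congrFun hr j
    simpa [hεe, Finset.sum_apply, Pi.single_apply] using this
  simpa [h0] using hn

theorem ker_eq_mul_top : LinearMap.ker ε.toLinearMap =
    Submodule.span K (Set.range (arrow m c 0)) * ⊤ := by
  refine le_antisymm ?_ ?_
  · rw [ker_eq_pathSpan hεe hεx]
    refine Submodule.span_le.mpr ?_
    rintro _ ⟨a, l, hl, rfl⟩
    obtain ⟨l, rfl⟩ := Nat.exists_eq_add_of_le' hl
    simp only [SetLike.mem_coe]
    rw [gProd_succ']
    exact Submodule.mul_mem_mul (Submodule.subset_span ⟨a, rfl⟩) trivial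
  · rw [Submodule.mul_le]
    intro y hy r _
    have : Submodule.span K (Set.range (arrow m c 0)) ≤ LinearMap.ker ε.toLinearMap := by
      rw [Submodule.span_le]
      rintro _ ⟨a, rfl⟩
      exact hεx a
    have := this hy
    rw [LinearMap.mem_ker, AlgHom.toLinearMap_apply] at this ⊢
    rw [map_mul, this, zero_mul]

/-- The kernel is XΛ for the span X of the arrows, and ΛX ⊆ XΛ. So in a product of many kernel
elements all the arrows can be collected in front, where a power of X vanishes. -/
theorem exists_ker_pow_eq_bot : ∃ k, LinearMap.ker ε.toLinearMap ^ k = ⊥ := by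
  obtain ⟨k, hk⟩ := (isSolution m c).exists_pow_eq_bot
  refine ⟨k + 1, ?_⟩
  have hker := ker_eq_mul_top hεe hεx
  have key : ∀ k, LinearMap.ker ε.toLinearMap ^ (k + 1) ≤
      Submodule.span K (Set.range (arrow m c 0)) ^ (k + 1) * ⊤ := by
    intro k
    induction k with
    | zero => rw [zero_add, pow_one, pow_one, hker]
    | succ k ih =>
      have h1 : (⊤ : Submodule K (WeightedAlgebra m c)) *
          Submodule.span K (Set.range (arrow m c 0)) ≤ LinearMap.ker ε.toLinearMap := by
        rw [Submodule.mul_le]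
        intro r _ y hy
        have : y ∈ LinearMap.ker ε.toLinearMap := by
          rw [hker, ← mul_one y]
          exact Submodule.mul_mem_mul hy trivial
        rw [LinearMap.mem_ker, AlgHom.toLinearMap_apply] at this ⊢
        rw [map_mul, this, mul_zero]
      calc LinearMap.ker ε.toLinearMap ^ (k + 1 + 1)
          ≤ Submodule.span K (Set.range (arrow m c 0)) ^ (k + 1) * ⊤ *
            (Submodule.span K (Set.range (arrow m c 0)) * ⊤) := by
            rw [pow_succ]
            exact mul_le_mul' ih hker.le
        _ = Submodule.span K (Set.range (arrow m c 0)) ^ (k + 1) *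
            (⊤ * Submodule.span K (Set.range (arrow m c 0))) * ⊤ := by simp only [mul_assoc]
        _ ≤ Submodule.span K (Set.range (arrow m c 0)) ^ (k + 1) *
            (Submodule.span K (Set.range (arrow m c 0)) * ⊤) * ⊤ := by
            exact mul_le_mul' (mul_le_mul' le_rfl (h1.trans hker.le)) le_rfl
        _ ≤ Submodule.span K (Set.range (arrow m c 0)) ^ (k + 1 + 1) * ⊤ := by
            rw [pow_succ _ (k + 1), mul_assoc, mul_assoc, mul_assoc]
            exact mul_le_mul' le_rfl (mul_le_mul' le_rfl le_top)
  rw [eq_bot_iff]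
  refine (key k).trans ?_
  rw [pow_succ, hk, Submodule.bot_mul, Submodule.bot_mul]

/-- The augmentation ideal is generated by the arrows modulo its square. -/
theorem ker_le_span_sup_sq : LinearMap.ker ε.toLinearMap ≤
    Submodule.span K (Set.range (arrow m c 0)) ⊔ LinearMap.ker ε.toLinearMap ^ 2 := by
  have hX : Submodule.span K (Set.range (arrow m c 0)) ≤ LinearMap.ker ε.toLinearMap := by
    rw [Submodule.span_le]
    rintro _ ⟨a, rfl⟩
    exact hεx a
  rw [ker_eq_pathSpan hεe hεx]
  refine Submodule.span_le.mpr ?_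
  rintro _ ⟨a, l, hl, rfl⟩
  obtain ⟨l, rfl⟩ := Nat.exists_eq_add_of_le' hl
  simp only [SetLike.mem_coe]
  rcases l with _ | l
  · rw [zero_add, gProd_one]
    exact Submodule.mem_sup_left (Submodule.subset_span ⟨a, rfl⟩)
  · refine Submodule.mem_sup_right ?_
    rw [gProd_succ', sq]
    refine Submodule.mul_mem_mul ?_ (gProd_mem_pathSpan _ (by omega))
    rw [← gProd_one (arrow m c 0)]
    exact gProd_mem_pathSpan _ le_rfl

end WeightedAlgebra

end TriangulationQuiver

namespace FDAlgebra

universe u v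

/-! ### Socles of algebras with a nilpotent augmentation kernel. -/

section Augmented

variable {K : Type v} {R : Type u} [Field K] [Ring R] [Algebra K R] {V : Type*}
  {e : V → R} {ε : R →ₐ[K] (V → K)}

theorem pow_eq_zero_of_mem {N : Submodule K R} {k : ℕ} (hN : N ^ k = ⊥) {n : R} (hn : n ∈ N) :
    n ^ k = 0 := by
  have := Submodule.pow_mem_pow N hn k
  rwa [hN, Submodule.mem_bot] at this

theorem mul_mem_ker (ε : R →ₐ[K] (V → K)) {n : R} (hn : n ∈ LinearMap.ker ε.toLinearMap) (r : R) :
    n * r ∈ LinearMap.ker ε.toLinearMap := by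
  rw [LinearMap.mem_ker, AlgHom.toLinearMap_apply] at hn ⊢
  rw [map_mul, hn, zero_mul]

theorem mul_mem_ker' (ε : R →ₐ[K] (V → K)) (r : R) {n : R}
    (hn : n ∈ LinearMap.ker ε.toLinearMap) : r * n ∈ LinearMap.ker ε.toLinearMap := by
  rw [LinearMap.mem_ker, AlgHom.toLinearMap_apply] at hn ⊢
  rw [map_mul, hn, mul_zero]

/-- An element that is fixed up to a nonzero scalar by a nilpotent element vanishes. -/
theorem eq_zero_of_smul_add_mul_eq_zero {k : ℕ} (hN : LinearMap.ker ε.toLinearMap ^ k = ⊥)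
    {t : K} (ht : t ≠ 0) {n v : R} (hn : n ∈ LinearMap.ker ε.toLinearMap)
    (h : t • v + n * v = 0) : v = 0 := by
  have h1 : n * v = (-t) • v := by
    rw [neg_smul]; exact eq_neg_of_add_eq_zero_right h
  have h2 : ∀ l : ℕ, n ^ l * v = (-t) ^ l • v := by
    intro l
    induction l with
    | zero => simp
    | succ l ih => rw [pow_succ, mul_assoc, h1, mul_smul_comm, ih, smul_smul, pow_succ, mul_comm]
  have h3 := h2 k
  rw [pow_eq_zero_of_mem hN hn, zero_mul] at h3
  exact (smul_eq_zero.mp h3.symm).resolve_left (pow_ne_zero _ (neg_ne_zero.mpr ht))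

/-- If t lies in a simple right ideal and t n ≠ 0, then t n generates it, so t = t n r for some r.
Iterating gives t = t (n r)^k = 0. -/
theorem mul_eq_zero_of_mem_socle {k : ℕ} (hN : LinearMap.ker ε.toLinearMap ^ k = ⊥) {s n : R}
    (hs : s ∈ socle R) (hn : n ∈ LinearMap.ker ε.toLinearMap) : s * n = 0 := by
  let T : Submodule Rᵐᵒᵖ R :=
    { carrier := {s | ∀ n ∈ LinearMap.ker ε.toLinearMap, s * n = 0}
      add_mem' := fun {s t} hs ht n hn => by rw [add_mul, hs n hn, ht n hn, add_zero]
      zero_mem' := fun n _ => zero_mul n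
      smul_mem' := fun r s hs n hn => by
        rw [MulOpposite.smul_eq_mul_unop, mul_assoc]
        exact hs _ (mul_mem_ker' ε _ hn) }
  have hT : rightSocle R ≤ T := by
    refine sSup_le fun M hM t ht n hn => ?_
    have hM' : IsAtom M := (isSimpleModule_iff_isAtom).mp hM
    by_contra h0
    have hle : Submodule.span Rᵐᵒᵖ {t * n} ≤ M := by
      rw [Submodule.span_singleton_le_iff_mem]
      exact M.smul_mem (MulOpposite.op n) ht
    have heq := (hM'.le_iff.mp hle).resolve_left
      (fun hbot => h0 ((Submodule.span_singleton_eq_bot).mp hbot))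
    rw [← heq, Submodule.mem_span_singleton] at ht
    obtain ⟨r, hr⟩ := ht
    rw [MulOpposite.smul_eq_mul_unop, mul_assoc] at hr
    have hpow : ∀ l : ℕ, t * (n * r.unop) ^ l = t := by
      intro l
      induction l with
      | zero => simp
      | succ l ih => rw [pow_succ, ← mul_assoc, ih, hr]
    have := hpow k
    rw [pow_eq_zero_of_mem hN (mul_mem_ker ε hn _), mul_zero] at this
    exact h0 (by rw [← this, zero_mul])
  exact hT hs n hn

variable [Fintype V] [DecidableEq V]

theorem exists_eq_sum_add (hε : ∀ i, ε (e i) = Pi.single i 1) (r : R) :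
    ∃ n ∈ LinearMap.ker ε.toLinearMap, r = ∑ i, ε r i • e i + n := by
  refine ⟨r - ∑ i, ε r i • e i, ?_, by abel⟩
  rw [LinearMap.mem_ker, AlgHom.toLinearMap_apply, map_sub, map_sum, sub_eq_zero]
  ext j
  simp [hε, Finset.sum_apply, Pi.single_apply]

variable (he : CompleteOrthogonalIdempotents e) (hε : ∀ i, ε (e i) = Pi.single i 1)
include he hε

theorem exists_mul_e_eq (i : V) (r : R) :
    ∃ n ∈ LinearMap.ker ε.toLinearMap, e i * r = ε r i • e i + n := by
  obtain ⟨n, hn, hr⟩ := exists_eq_sum_add hε r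
  refine ⟨e i * n, mul_mem_ker' ε _ hn, ?_⟩
  conv_lhs => rw [hr]
  rw [mul_add, Finset.mul_sum]
  simp only [mul_smul_comm, he.mul_eq]
  simp

/-- On s e_i the algebra acts from the right through the i-th coordinate of ε, so each nonzero s e_i
spans a simple right ideal. -/
theorem mem_socle_of_mul_eq_zero {s : R}
    (hs : ∀ n ∈ LinearMap.ker ε.toLinearMap, s * n = 0) : s ∈ socle R := by
  have h1 : s = ∑ i, s * e i := by rw [← Finset.mul_sum, he.complete, mul_one]
  rw [h1]
  refine Ideal.sum_mem _ fun i _ => ?_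
  by_cases h0 : s * e i = 0
  · rw [h0]; exact Ideal.zero_mem _
  have hr : ∀ r : R, s * e i * r = ε r i • (s * e i) := by
    intro r
    obtain ⟨n, hn, hr⟩ := exists_mul_e_eq he hε i r
    rw [mul_assoc, hr, mul_add, hs n hn, add_zero, mul_smul_comm]
  have hatom : IsAtom (Submodule.span Rᵐᵒᵖ {s * e i}) := by
    refine ⟨fun hbot => h0 ((Submodule.span_singleton_eq_bot).mp hbot), fun M hM => ?_⟩
    by_contra hM0
    obtain ⟨y, hy, hy0⟩ := (Submodule.ne_bot_iff _).mp hM0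
    obtain ⟨r, rfl⟩ := Submodule.mem_span_singleton.mp (hM.le hy)
    rw [MulOpposite.smul_eq_mul_unop, hr] at hy hy0
    refine hM.not_ge ?_
    rw [Submodule.span_singleton_le_iff_mem]
    have hk : ε r.unop i ≠ 0 := fun h => hy0 (by rw [h, zero_smul])
    have := M.smul_mem (MulOpposite.op (algebraMap K R (ε r.unop i)⁻¹)) hy
    rw [MulOpposite.smul_eq_mul_unop, MulOpposite.unop_op, ← Algebra.commutes,
      ← Algebra.smul_def, smul_smul, inv_mul_cancel₀ hk, one_smul] at this
    exact this
  have : IsSimpleModule Rᵐᵒᵖ (Submodule.span Rᵐᵒᵖ {s * e i}) := isSimpleModule_iff_isAtom.mpr hatom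
  exact (le_sSup this : _ ≤ rightSocle R) (Submodule.mem_span_singleton_self _)

/-- The socle of an indecomposable projective module of a self-injective algebra is simple. -/
theorem exists_e_mul_mem_span {k : ℕ} (hN : LinearMap.ker ε.toLinearMap ^ k = ⊥)
    (hinj : IsSelfInjective R) (i : V) :
    ∃ w : R, ∀ s ∈ socle R, e i * s ∈ Submodule.span K {w} := by
  by_cases hz : ∀ s ∈ socle R, ∀ j, e i * s * e j = 0
  · refine ⟨0, fun s hs => ?_⟩
    have h1 : e i * s = ∑ j, e i * s * e j := by rw [← Finset.mul_sum, he.complete, mul_one]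
    rw [h1, Finset.sum_eq_zero fun j _ => hz s hs j]
    exact Submodule.zero_mem _
  push Not at hz
  obtain ⟨s₀, hs₀, j₀, hu0⟩ := hz
  refine ⟨e i * s₀ * e j₀, fun s hs => ?_⟩
  have h1 : e i * s = ∑ j, e i * s * e j := by rw [← Finset.mul_sum, he.complete, mul_one]
  rw [h1]
  refine Submodule.sum_mem _ fun j _ => ?_
  have hmul : ∀ s ∈ socle R, ∀ j, ∀ r : R, e i * s * e j * r = ε r j • (e i * s * e j) := by
    intro s hs j r
    obtain ⟨n, hn, hr⟩ := exists_mul_e_eq he hε j r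
    rw [mul_assoc, hr, mul_add, mul_assoc _ s n, mul_eq_zero_of_mem_socle hN hs hn, mul_zero,
      add_zero, mul_smul_comm]
  have hum := hmul s₀ hs₀ j₀
  have hvm := hmul s hs j
  have heu : e i * (e i * s₀ * e j₀) = e i * s₀ * e j₀ := by
    rw [← mul_assoc, ← mul_assoc, he.idem i]
  have hev : e i * (e i * s * e j) = e i * s * e j := by
    rw [← mul_assoc, ← mul_assoc, he.idem i]
  generalize e i * s₀ * e j₀ = u at *
  generalize e i * s * e j = v at *
  by_contra hv
  have hv0 : v ≠ 0 := fun h0 => hv (by rw [h0]; exact Submodule.zero_mem _)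
  have hu : u ∉ Submodule.span K {v} := by
    intro hu
    obtain ⟨t, rfl⟩ := Submodule.mem_span_singleton.mp hu
    have ht : t ≠ 0 := fun h => hu0 (by rw [h, zero_smul])
    exact hv (Submodule.mem_span_singleton.mpr ⟨t⁻¹, by rw [smul_smul, inv_mul_cancel₀ ht, one_smul]⟩)
  obtain ⟨φ, hφu, hφv⟩ := Submodule.exists_le_ker_of_notMem hu
  rw [Submodule.span_singleton_le_iff_mem, LinearMap.mem_ker] at hφv
  let P : Submodule Rᵐᵒᵖ R :=
    { carrier := {p | ∃ y z : K, p = y • u + z • v}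
      add_mem' := by
        rintro _ _ ⟨y, z, rfl⟩ ⟨y', z', rfl⟩
        exact ⟨y + y', z + z', by rw [add_smul, add_smul]; abel⟩
      zero_mem' := ⟨0, 0, by simp⟩
      smul_mem' := by
        rintro r _ ⟨y, z, rfl⟩
        refine ⟨y * ε r.unop j₀, z * ε r.unop j, ?_⟩
        rw [MulOpposite.smul_eq_mul_unop, add_mul, smul_mul_assoc, smul_mul_assoc, hum, hvm,
          smul_smul, smul_smul] }
  let h : P →ₗ[Rᵐᵒᵖ] R :=
    { toFun := fun p => φ p • u
      map_add' := fun p q => by rw [Submodule.coe_add, map_add, add_smul]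
      map_smul' := by
        rintro r ⟨_, y, z, rfl⟩
        simp only [Submodule.coe_smul, RingHom.id_apply, MulOpposite.smul_eq_mul_unop, add_mul,
          smul_mul_assoc, hum, hvm, map_add, map_smul, hφv, smul_zero, add_zero, smul_smul]
        congr 1
        simp only [smul_eq_mul]
        ring }
  -- Injectivity realizes u ↦ φ(u) u, v ↦ 0 by left multiplication with H(1). On e_i R, the element
  -- e_i H(1) is a scalar plus a nilpotent; it cannot both have the nonzero eigenvalue φ(u) at u and
  -- kill v.
  obtain ⟨H, hH⟩ := hinj.out P.subtype P.injective_subtype h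
  have hHmul : ∀ r, H r = H 1 * r := fun r => by
    have := H.map_smul (MulOpposite.op r) 1
    simpa using this
  have hHu : H 1 * u = φ u • u := by
    rw [← hHmul]
    exact hH ⟨u, 1, 0, by simp⟩
  have hHv : H 1 * v = 0 := by
    rw [← hHmul]
    have := hH ⟨v, 0, 1, by simp⟩
    rw [show H v = h ⟨v, 0, 1, by simp⟩ from this]
    change φ v • u = 0
    rw [hφv, zero_smul]
  obtain ⟨n, hn, hr⟩ := exists_mul_e_eq he hε i (H 1)
  have hmu : ε (H 1) i • u + n * u = φ u • u := by
    have : e i * (H 1) * u = φ u • u := by rw [mul_assoc, hHu, mul_smul_comm, heu]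
    rwa [hr, add_mul, smul_mul_assoc, heu] at this
  have hmv : ε (H 1) i • v + n * v = 0 := by
    have : e i * (H 1) * v = 0 := by rw [mul_assoc, hHv, mul_zero]
    rwa [hr, add_mul, smul_mul_assoc, hev] at this
  by_cases ht : ε (H 1) i = 0
  · rw [ht, zero_smul, zero_add] at hmu
    refine hu0 (eq_zero_of_smul_add_mul_eq_zero hN (t := -φ u) (neg_ne_zero.mpr hφu) hn ?_)
    rw [hmu, neg_smul, neg_add_cancel]
  · exact hv0 (eq_zero_of_smul_add_mul_eq_zero hN ht hn hmv)

theorem finrank_socle_le [Module.Finite K R] {k : ℕ} (hN : LinearMap.ker ε.toLinearMap ^ k = ⊥)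
    (hinj : IsSelfInjective R) :
    Module.finrank K ((socle R).restrictScalars K) ≤ Fintype.card V := by
  choose w hw using exists_e_mul_mem_span he hε hN hinj
  have hle : (socle R).restrictScalars K ≤ Submodule.span K (Set.range w) := by
    intro s hs
    have h1 : s = ∑ i, e i * s := by rw [← Finset.sum_mul, he.complete, one_mul]
    rw [h1]
    refine Submodule.sum_mem _ fun i _ => ?_
    exact Submodule.span_mono (by rintro _ rfl; exact ⟨i, rfl⟩) (hw i s hs)
  exact (Submodule.finrank_mono hle).trans (finrank_range_le_card w)

end Augmented

end FDAlgebra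

namespace FDAlgebra

universe u v

/-! ### Socles of symmetric algebras. -/

section Symmetric

variable {K : Type v} {A : Type u} [Field K] [Ring A] [Algebra K A]

/-- A nondegenerate, associative, symmetric bilinear form. -/
structure IsSymmetrizingForm (B : LinearMap.BilinForm K A) : Prop where
  nondegenerate : B.Nondegenerate
  symm : ∀ a b, B a b = B b a
  assoc : ∀ a b c, B (a * b) c = B a (b * c)

namespace IsSymmetrizingForm

variable {B : LinearMap.BilinForm K A} (hB : IsSymmetrizingForm B)
include hB

theorem isRefl : B.IsRefl := fun a b h => by rw [hB.symm, h]

theorem rotate (a b c : A) : B (a * b) c = B (c * a) b := by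
  rw [hB.symm, ← hB.assoc]

theorem eq_zero {x : A} (h : ∀ a, B x a = 0) : x = 0 :=
  hB.nondegenerate.1 x h

theorem apply_mul_one (x y : A) : B (x * y) 1 = B x y := by
  rw [hB.assoc, mul_one]

theorem apply_eq_zero {x y : A} (h : x * y = 0) : B x y = 0 := by
  rw [← hB.apply_mul_one, h, map_zero, LinearMap.zero_apply]

omit hB in
theorem _root_.FDAlgebra.isSemisimpleModule_rightSocle :
    IsSemisimpleModule Aᵐᵒᵖ (rightSocle A) := by
  rw [rightSocle, sSup_eq_iSup]
  exact isSemisimpleModule_biSup_of_isSemisimpleModule_submodule fun N hN => by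
    have : IsSimpleModule Aᵐᵒᵖ N := hN
    infer_instance

/-- The socle of an indecomposable symmetric algebra that is not semisimple has square zero. -/
theorem socle_mul_socle [Module.Finite K A] (hind : IsIndecomposable A)
    (hS : (1 : A) ∉ socle A) {s t : A} (hs : s ∈ socle A) (ht : t ∈ socle A) : s * t = 0 := by
  let S : Submodule K A := (socle A).restrictScalars K
  have hmemS : ∀ {x}, x ∈ S ↔ x ∈ socle A := Iff.rfl
  have hSr : ∀ {x} (a : A), x ∈ S → x * a ∈ S := fun a hx => Ideal.mul_mem_right a (socle A) hx
  have hSl : ∀ {x} (a : A), x ∈ S → a * x ∈ S := fun a hx => Ideal.mul_mem_left (socle A) a hx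
  -- the annihilator of the socle inside of the socle has a complement
  let Z : Submodule Aᵐᵒᵖ A :=
    { carrier := {x | x ∈ socle A ∧ ∀ y ∈ socle A, x * y = 0}
      add_mem' := fun {x y} hx hy => ⟨Ideal.add_mem _ hx.1 hy.1, fun z hz => by
        rw [add_mul, hx.2 z hz, hy.2 z hz, add_zero]⟩
      zero_mem' := ⟨Ideal.zero_mem _, fun y _ => zero_mul y⟩
      smul_mem' := fun r x hx => ⟨Ideal.mul_mem_right _ _ hx.1, fun y hy => by
        rw [MulOpposite.smul_eq_mul_unop, mul_assoc]
        exact hx.2 _ (Ideal.mul_mem_left _ _ hy)⟩ }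
  have hZ : Z ≤ rightSocle A := fun x hx => hx.1
  obtain ⟨C, hC⟩ : ∃ C : Submodule Aᵐᵒᵖ A, C ≤ rightSocle A ∧ Z ⊓ C = ⊥ ∧
      ∀ x ∈ rightSocle A, ∃ z ∈ Z, ∃ y ∈ C, x = z + y := by
    have := isSemisimpleModule_rightSocle (A := A)
    obtain ⟨C, hC⟩ := exists_isCompl (Z.submoduleOf (rightSocle A))
    refine ⟨C.map (rightSocle A).subtype, Submodule.map_subtype_le _ _, ?_, ?_⟩
    · rw [eq_bot_iff]
      rintro x ⟨hx, y, hy, rfl⟩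
      have : y ∈ Z.submoduleOf (rightSocle A) ⊓ C := ⟨hx, hy⟩
      rw [hC.inf_eq_bot, Submodule.mem_bot] at this
      rw [this]
      simp
    · intro x hx
      have : (⟨x, hx⟩ : rightSocle A) ∈ Z.submoduleOf (rightSocle A) ⊔ C := by
        rw [hC.sup_eq_top]; trivial
      obtain ⟨z, hz, y, hy, hzy⟩ := Submodule.mem_sup.mp this
      exact ⟨z, hz, y, ⟨y, hy, rfl⟩, by simpa using (congrArg Subtype.val hzy).symm⟩
  obtain ⟨hCS, hZC, hdec⟩ := hC
  have hSC : ∀ x ∈ S, ∀ y ∈ S, x * y ∈ C := by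
    intro x hx y hy
    obtain ⟨z, hz, w, hw, rfl⟩ := hdec x hx
    rw [add_mul, hz.2 y hy, zero_add]
    exact C.smul_mem (MulOpposite.op y) hw
  -- The form is nondegenerate on I = S·S, because I lies in the complement C. So A is the direct
  -- sum of the two-sided ideals I and I^⊥, and the component of 1 in I is a central idempotent,
  -- hence 0 or 1; the value 1 would put 1 into the socle.
  let I : Submodule K A := S * S
  have hIC : ∀ x ∈ I, x ∈ C := by
    intro x hx
    induction hx using Submodule.mul_induction_on' with
    | mem_mul_mem x hx y hy => exact hSC x hx y hy
    | add x _ y _ hx hy => exact C.add_mem hx hy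
  have hZmem : ∀ x ∈ S, (∀ y ∈ S, B x y = 0) → x ∈ Z := by
    intro x hx h
    refine ⟨hx, fun y hy => hB.eq_zero fun a => ?_⟩
    rw [hB.assoc]
    exact h _ (hSr a hy)
  -- For y in S the product x y is orthogonal to S, hence lies in Z ∩ C = 0. So x annihilates S and
  -- lies in Z ∩ C itself.
  have hzero : ∀ x ∈ C, (∀ y ∈ I, B x y = 0) → x = 0 := by
    intro x hx h
    have h1 : ∀ y ∈ S, x * y = 0 := by
      intro y hy
      have hxy : x * y ∈ C := C.smul_mem (MulOpposite.op y) hx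
      have : x * y ∈ Z ⊓ C := by
        refine ⟨hZmem _ (hCS hxy) fun w hw => ?_, hxy⟩
        rw [hB.assoc]
        exact h _ (Submodule.mul_mem_mul hy hw)
      rwa [hZC] at this
    have : x ∈ Z ⊓ C := ⟨⟨hCS hx, h1⟩, hx⟩
    rwa [hZC] at this
  have hIr : ∀ x ∈ I, ∀ a, x * a ∈ I := by
    intro x hx a
    induction hx using Submodule.mul_induction_on' with
    | mem_mul_mem x hx y hy => rw [mul_assoc]; exact Submodule.mul_mem_mul hx (hSr a hy)
    | add x _ y _ hx hy => rw [add_mul]; exact I.add_mem hx hy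
  have hIl : ∀ x ∈ I, ∀ a, a * x ∈ I := by
    intro x hx a
    induction hx using Submodule.mul_induction_on' with
    | mem_mul_mem x hx y hy => rw [← mul_assoc]; exact Submodule.mul_mem_mul (hSl a hx) hy
    | add x _ y _ hx hy => rw [mul_add]; exact I.add_mem hx hy
  have hcompl : IsCompl I (B.orthogonal I) := by
    rw [LinearMap.BilinForm.isCompl_orthogonal_iff_disjoint hB.isRefl, Submodule.disjoint_def]
    intro x hx hx'
    refine hzero x (hIC x hx) fun y hy => ?_
    rw [hB.symm]
    exact LinearMap.BilinForm.mem_orthogonal_iff.mp hx' y hy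
  have hO : ∀ x ∈ B.orthogonal I, ∀ a, x * a ∈ B.orthogonal I ∧ a * x ∈ B.orthogonal I := by
    intro x hx a
    rw [LinearMap.BilinForm.mem_orthogonal_iff] at hx
    refine ⟨LinearMap.BilinForm.mem_orthogonal_iff.mpr fun y hy => ?_,
      LinearMap.BilinForm.mem_orthogonal_iff.mpr fun y hy => ?_⟩
    · rw [← hB.assoc, hB.rotate]
      exact hx _ (hIl y hy a)
    · rw [← hB.assoc]
      exact hx _ (hIr y hy a)
  have hdisj : ∀ x ∈ I, x ∈ B.orthogonal I → x = 0 := fun x hx hx' =>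
    Submodule.disjoint_def.mp hcompl.disjoint x hx hx'
  obtain ⟨p, hp, q, hq, hpq⟩ := Submodule.mem_sup.mp
    (show (1 : A) ∈ I ⊔ B.orthogonal I by rw [hcompl.sup_eq_top]; trivial)
  have hpx : ∀ x ∈ I, x * p = x := by
    intro x hx
    have h1 : x * q = 0 := hdisj _ (hIr x hx q) (hO q hq x).2
    conv_rhs => rw [← mul_one x, ← hpq, mul_add, h1, add_zero]
  have hcent : ∀ a, p * a = a * p := by
    intro a
    have h1 : p * a - a * p = a * q - q * a := by
      have h2 : (p + q) * a = a * (p + q) := by rw [hpq, one_mul, mul_one]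
      rw [add_mul, mul_add] at h2
      rw [sub_eq_sub_iff_add_eq_add, h2, add_comm]
    refine sub_eq_zero.mp (hdisj _ (I.sub_mem (hIr p hp a) (hIl p hp a)) ?_)
    rw [h1]
    exact Submodule.sub_mem _ (hO q hq a).2 (hO q hq a).1
  rcases hind.2 p (hpx p hp) hcent with h0 | h1
  · have := hpx (s * t) (Submodule.mul_mem_mul hs ht)
    rw [← this, h0, mul_zero]
  · refine absurd ?_ hS
    rw [← h1]
    exact hCS (hIC p hp)

end IsSymmetrizingForm

end Symmetric

/-! ### The socle and the symmetrizing form at a single vertex. -/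

section AugmentedSymmetric

variable {K : Type v} {A : Type u} [Field K] [Ring A] [Algebra K A]
  {B : LinearMap.BilinForm K A} (hB : IsSymmetrizingForm B)
  {V : Type*} [Fintype V] [DecidableEq V] {e : V → A} {ε : A →ₐ[K] (V → K)}
  (he : CompleteOrthogonalIdempotents e) (hε : ∀ i, ε (e i) = Pi.single i 1)
  {k : ℕ} (hN : LinearMap.ker ε.toLinearMap ^ k = ⊥)

namespace IsSymmetrizingForm

include hB hN in
omit [Fintype V] [DecidableEq V] in
theorem mul_socle_eq_zero {n s : A} (hn : n ∈ LinearMap.ker ε.toLinearMap) (hs : s ∈ socle A) :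
    n * s = 0 :=
  hB.eq_zero fun a => by
    rw [hB.assoc, hB.symm]
    exact hB.apply_eq_zero (mul_eq_zero_of_mem_socle hN (Ideal.mul_mem_right a _ hs) hn)

include hB he hε hN

/-- For a two-sided ideal, orthogonality and annihilation agree, and the socle is the annihilator of
the kernel of ε. This determines its dimension exactly. -/
theorem orthogonal_ker :
    B.orthogonal (LinearMap.ker ε.toLinearMap) = (socle A).restrictScalars K := by
  ext s
  rw [LinearMap.BilinForm.mem_orthogonal_iff, Submodule.restrictScalars_mem]
  constructor
  · intro h
    refine mem_socle_of_mul_eq_zero he hε fun n hn => hB.eq_zero fun a => ?_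
    rw [hB.assoc, hB.symm]
    exact h _ (mul_mem_ker ε hn a)
  · intro h n hn
    exact hB.apply_eq_zero (hB.mul_socle_eq_zero hN hn h)

theorem finrank_socle [Module.Finite K A] :
    Module.finrank K ((socle A).restrictScalars K) = Fintype.card V := by
  rw [← hB.orthogonal_ker he hε hN,
    LinearMap.BilinForm.finrank_orthogonal hB.nondegenerate]
  have hs : LinearMap.range ε.toLinearMap = ⊤ := by
    rw [LinearMap.range_eq_top]
    intro v
    refine ⟨∑ i, v i • e i, ?_⟩
    ext j
    simp [hε, Finset.sum_apply, Pi.single_apply]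
  have := LinearMap.finrank_range_add_finrank_ker ε.toLinearMap
  rw [hs, finrank_top, Module.finrank_fintype_fun_eq_card] at this
  omega

omit [Fintype V] he in
-- Pairing e_i s e_j with a is the same as pairing s with e_j a e_i, which lies in the kernel of ε
-- when i ≠ j and is therefore annihilated by s. Consequently a defect in the socle can survive only
-- along closed paths.
theorem e_mul_mul_e_eq_zero {s : A} (hs : s ∈ socle A) {i j : V} (hij : i ≠ j) :
    e i * s * e j = 0 := by
  refine hB.eq_zero fun a => ?_
  have hn : e j * a * e i ∈ LinearMap.ker ε.toLinearMap := by
    rw [LinearMap.mem_ker, AlgHom.toLinearMap_apply, map_mul, map_mul, hε, hε]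
    ext l
    by_cases hl : l = i
    · subst hl; simp [hij]
    · simp [hl]
  rw [hB.assoc, hB.rotate, hB.symm]
  exact hB.apply_eq_zero (mul_eq_zero_of_mem_socle hN hs hn)

/-- Here s = s e_i, so s a = ε(a)_i s, and the value B(s, 1) determines all the others. A closed
path in the socle can thus be tested after cyclic rotation. -/
theorem eq_zero_of_mem_socle {s : A} (hs : s ∈ socle A) {i : V} (hse : e i * s = s)
    (h0 : B s 1 = 0) : s = 0 := by
  have hsi : s * e i = s := by
    conv_rhs => rw [← mul_one s, ← he.complete, Finset.mul_sum]
    rw [Finset.sum_eq_single i]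
    · intro j _ hj
      rw [← hse]
      exact hB.e_mul_mul_e_eq_zero hε hN hs (Ne.symm hj)
    · intro h; exact absurd (Finset.mem_univ i) h
  refine hB.eq_zero fun a => ?_
  obtain ⟨n, hn, ha⟩ := exists_mul_e_eq he hε i a
  have h1 : s * a = ε a i • s := by
    rw [← hsi, mul_assoc, ha, mul_add, mul_eq_zero_of_mem_socle hN hs hn, add_zero,
      mul_smul_comm]
  rw [← hB.apply_mul_one, h1, map_smul, LinearMap.smul_apply, h0, smul_zero]

theorem eq_smul_of_mem_socle {s t : A} (hs : s ∈ socle A) (ht : t ∈ socle A) {i : V}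
    (hse : e i * s = s) (hte : e i * t = t) (ht0 : t ≠ 0) : ∃ z : K, s = z • t := by
  have ht1 : B t 1 ≠ 0 := fun h => ht0 (hB.eq_zero_of_mem_socle he hε hN ht hte h)
  refine ⟨B s 1 / B t 1, sub_eq_zero.mp (hB.eq_zero_of_mem_socle he hε hN (i := i) ?_ ?_ ?_)⟩
  · exact Ideal.sub_mem _ hs (Submodule.smul_of_tower_mem (socle A) _ ht)
  · rw [mul_sub, hse, mul_smul_comm, hte]
  · rw [map_sub, map_smul, LinearMap.sub_apply, LinearMap.smul_apply, smul_eq_mul,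
      div_mul_cancel₀ _ ht1, sub_self]

/-- The socle of an indecomposable symmetric algebra with at least two simple modules is contained
in the square of the radical. -/
theorem socle_le_sq [Module.Finite K A] [Nontrivial V] (hind : IsIndecomposable A) :
    (socle A).restrictScalars K ≤ LinearMap.ker ε.toLinearMap ^ 2 := by
  set N := LinearMap.ker ε.toLinearMap with hNdef
  have hSN : B.orthogonal ((socle A).restrictScalars K) = N := by
    rw [← hB.orthogonal_ker he hε hN,
      LinearMap.BilinForm.orthogonal_orthogonal hB.nondegenerate hB.isRefl]
  -- Taking orthogonals reverses the inclusion, and N is the orthogonal of the socle.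
  suffices h : B.orthogonal (N ^ 2) ≤ N by
    rw [← LinearMap.BilinForm.orthogonal_orthogonal hB.nondegenerate hB.isRefl (N ^ 2),
      ← hB.orthogonal_ker he hε hN]
    exact LinearMap.BilinForm.orthogonal_le h
  intro v hv
  have hvS : ∀ n ∈ N, v * n ∈ socle A := by
    intro n hn
    rw [← Submodule.restrictScalars_mem K, ← hB.orthogonal_ker he hε hN,
      LinearMap.BilinForm.mem_orthogonal_iff]
    intro n' hn'
    rw [hB.symm, hB.assoc, hB.symm]
    refine LinearMap.BilinForm.mem_orthogonal_iff.mp hv _ ?_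
    rw [sq]
    exact Submodule.mul_mem_mul hn hn'
  by_contra hvN
  obtain ⟨i, hi⟩ : ∃ i, ε v i ≠ 0 := by
    by_contra! h
    exact hvN (funext h)
  obtain ⟨n, hn, hr⟩ := exists_mul_e_eq he hε i v
  -- Since v N lies in the socle, e_i v = ε(v)_i e_i + n kills e_i N modulo the socle. Its scalar
  -- part is nonzero and n is nilpotent, so e_i N itself lies in the socle.
  have hiN : ∀ y ∈ N, e i * y = y → y ∈ socle A := by
    intro y hy hey
    have h1 : ε v i • y + n * y ∈ socle A := by
      have := Ideal.mul_mem_left (socle A) (e i) (hvS y hy)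
      rwa [← mul_assoc, hr, add_mul, smul_mul_assoc, hey] at this
    have h2 : ∀ l : ℕ, n ^ l * y - (-ε v i) ^ l • y ∈ socle A := by
      intro l
      induction l with
      | zero => simp
      | succ l ih =>
        have h3 := Ideal.mul_mem_left (socle A) (n ^ l) h1
        have h4 := Submodule.smul_of_tower_mem (socle A) (-ε v i) ih
        have h5 := Ideal.add_mem _ h3 h4
        convert h5 using 1
        rw [mul_add, mul_smul_comm, smul_sub, smul_smul, ← pow_succ', neg_smul, pow_succ,
          mul_assoc]
        abel
    have h3 := h2 k
    rw [pow_eq_zero_of_mem hN hn, zero_mul, zero_sub, neg_mem_iff] at h3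
    have h4 := Submodule.smul_of_tower_mem (socle A) ((-ε v i) ^ k)⁻¹ h3
    rwa [smul_smul, inv_mul_cancel₀ (pow_ne_zero _ (neg_ne_zero.mpr hi)), one_smul] at h4
  -- A socle element from i to another vertex vanishes, and the form carries this over to the
  -- opposite direction. So e_i is central, against indecomposability and the presence of a second
  -- vertex.
  have hout : ∀ j, i ≠ j → ∀ a, e i * a * e j = 0 := by
    intro j hij a
    have hy : e i * a * e j ∈ N := by
      rw [LinearMap.mem_ker, AlgHom.toLinearMap_apply, map_mul, map_mul, hε, hε]
      ext l
      by_cases hl : l = i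
      · subst hl; simp [hij]
      · simp [hl]
    have hey : e i * (e i * a * e j) = e i * a * e j := by
      rw [← mul_assoc, ← mul_assoc, he.idem i]
    have := hB.e_mul_mul_e_eq_zero hε hN (hiN _ hy hey) hij
    rwa [hey, mul_assoc, he.idem j] at this
  have hin : ∀ j, i ≠ j → ∀ a, e j * a * e i = 0 := by
    intro j hij a
    refine hB.eq_zero fun r => ?_
    rw [hB.assoc, hB.rotate, hout j hij r, map_zero, LinearMap.zero_apply]
  have hcent : ∀ a, e i * a = a * e i := by
    intro a
    have h1 : e i * a = e i * a * e i := by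
      conv_lhs => rw [← mul_one (e i * a), ← he.complete, Finset.mul_sum]
      rw [Finset.sum_eq_single i (fun j _ hj => hout j (Ne.symm hj) a)
        (fun h => absurd (Finset.mem_univ i) h)]
    have h2 : a * e i = e i * a * e i := by
      conv_lhs => rw [← one_mul (a * e i), ← he.complete, Finset.sum_mul]
      simp only [← mul_assoc]
      rw [Finset.sum_eq_single i (fun j _ hj => hin j (Ne.symm hj) a)
        (fun h => absurd (Finset.mem_univ i) h)]
    rw [h1, h2]
  obtain ⟨j, hj⟩ := exists_ne i
  rcases hind.2 (e i) (he.idem i) hcent with h0 | h1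
  · have := congrFun (congrArg ε h0) i
    simp [hε] at this
  · have := congrFun (congrArg ε h1) j
    simp [hε, hj] at this

end IsSymmetrizingForm

end AugmentedSymmetric

end FDAlgebra

namespace TriangulationQuiver

universe u

variable {Q : TriangulationQuiver} {K : Type u} [Field K]

/-! ### Nonvanishing of the arrows that are not virtual. -/

section TwoDimensional

/-- Arrows that are not virtual do not vanish in `Λ`. -/
theorem arrow_ne_zero (m : Q.WeightFunction) (c : Q.ParameterFunction K) {a : Q.Arrow}
    (ha : m.len a ≠ 2) : SocleDeformedAlgebra.arrow m c 0 a ≠ 0 := by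
  classical
  let e : Q.Vertex → Matrix (Fin 2) (Fin 2) K := fun i =>
    Matrix.diagonal ![if i = Q.src a then 1 else 0, if i = Q.tgt a then 1 else 0]
  -- Only `a` acts, by a matrix unit of square zero. An A_y of length one belongs to a virtual y,
  -- which differs from `a`, so both sides of every relation are zero.
  let x : Q.Arrow → Matrix (Fin 2) (Fin 2) K := fun y =>
    if y = a then !![0, 1; 0, 0] else 0
  have hxx : ∀ y z, x y * x z = 0 := by
    intro y z
    simp only [x]
    split_ifs
    · ext i j
      fin_cases i <;> fin_cases j <;> simp
    all_goals simp
  have hg : ∀ y {l}, 2 ≤ l → gProd x y l = 0 := by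
    intro y l hl
    obtain ⟨l, rfl⟩ := Nat.exists_eq_add_of_le' hl
    rw [gProd_succ', gProd_succ', ← mul_assoc, hxx, zero_mul]
  have hA : ∀ y, gProd x y (m.len y - 1) = 0 := by
    intro y
    by_cases hy : m.len y = 2
    · rw [hy, gProd_one]
      have : y ≠ a := fun h => ha (h ▸ hy)
      simp [x, this]
    · exact hg y (by have := m.three_le_len hy; omega)
  have h : IsSolution m c 0 e x :=
    { complete :=
        { idem := fun i => by
            rw [IsIdempotentElem, Matrix.diagonal_mul_diagonal]
            congr 1
            ext k
            fin_cases k <;> simp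
          ortho := fun i j hij => by
            change Matrix.diagonal _ * Matrix.diagonal _ = 0
            rw [Matrix.diagonal_mul_diagonal, ← Matrix.diagonal_zero]
            congr 1
            ext k
            fin_cases k <;> simp <;> rintro rfl rfl <;> exact hij rfl
          complete := by
            ext k l
            rw [Matrix.sum_apply]
            fin_cases k <;> fin_cases l <;> simp [e] }
      src_mul := fun y => by
        by_cases hy : y = a
        · subst hy
          ext k l
          fin_cases k <;> fin_cases l <;> simp [e, x, Matrix.diagonal_mul]
        · simp [x, hy]
      mul_tgt := fun y => by
        by_cases hy : y = a
        · subst hy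
          ext k l
          fin_cases k <;> fin_cases l <;> simp [e, x, Matrix.mul_diagonal]
        · simp [x, hy]
      mul_f := fun y _ => by rw [hxx, hA, smul_zero]
      border_sq := fun y _ => by rw [hxx, hA, smul_zero, hg _ (m.two_le_len _), smul_zero, add_zero]
      mul_f_g := fun y _ _ => by rw [hxx, zero_mul]
      mul_g_f := fun y _ _ => by rw [hxx, zero_mul] }
  obtain ⟨F, -, hF⟩ := SocleDeformedAlgebra.exists_lift h
  intro h0
  have h1 := hF a
  rw [h0, map_zero] at h1
  have := congrFun (congrFun h1 0) 1
  simp [x] at this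

end TwoDimensional

/-! ### The module of paths starting at a vertex. -/

section TwoStrings

variable (m : Q.WeightFunction) (c : Q.ParameterFunction K) (a : Q.Arrow)

/-- The two arrows starting at the source of `a`. -/
def branch (s : Bool) : Q.Arrow := bif s then Q.bar a else a

theorem bar_branch (s : Bool) : Q.bar (branch a s) = branch a (!s) := by
  cases s <;> simp [branch, bar_bar]

theorem src_branch (s : Bool) : Q.src (branch a s) = Q.src a := by
  cases s <;> simp [branch, Q.src_bar]

theorem eq_branch {y : Q.Arrow} (h : Q.src y = Q.src a) : ∃ s, y = branch a s := by
  rcases Q.eq_or_eq_bar a y h with rfl | rfl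
  · exact ⟨false, rfl⟩
  · exact ⟨true, rfl⟩

/-- The underlying space of the module with basis the paths from the source of `a`: the basis
vectors `(0, false)` and `(0, true)` are the trivial path and the generator of the socle, and
`(k, s)` is the path of length `k` along the `g`-cycle of `branch a s`. -/
abbrev StringSpace (K : Type u) [Field K] : Type u := ℕ × Bool →₀ K

/-- The path of length `k` along the `g`-cycle of `branch a s`. -/
noncomputable def stringPath (s : Bool) (k : ℕ) : StringSpace K :=
  if k = 0 then .single (0, false) 1
  else if k < m.len (branch a s) then .single (k, s) 1
  else if k = m.len (branch a s) then (c.c (branch a s))⁻¹ • .single (0, true) 1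
  else 0

/-- The product of a path of length `k` with the arrow that does not follow it on its
`g`-cycle. -/
noncomputable def stringTurn (s : Bool) (k : ℕ) : StringSpace K :=
  if k = 1 then
    c.c (branch a (!s)) • stringPath m c a (!s) (m.len (branch a (!s)) - 1)
  -- For virtual f(ā) the relations turn x_{g(ā)} x_{f(g(ā))} into a multiple of x_{f(ā)}, and x_ā
  -- x_{f(ā)} into a multiple of A_a. The mirror case is absent, as f(a) will be assumed not to be
  -- virtual.
  else if k = 2 ∧ s = true ∧ m.len (Q.f (Q.bar a)) = 2 then
    (c.c (Q.f (Q.bar a)) * c.c a) • stringPath m c a false (m.len a - 1)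
  else 0

open Classical in
/-- The product of a basis vector with an arrow. -/
noncomputable def stringMul (y : Q.Arrow) (p : ℕ × Bool) : StringSpace K :=
  if p.1 = 0 then
    if p.2 = true then 0
    else if y = a then stringPath m c a false 1
    else if y = Q.bar a then stringPath m c a true 1
    else 0
  -- Basis vectors beyond the end of the string are padding, killed by every arrow; they keep the
  -- index set independent of the lengths.
  else if m.len (branch a p.2) ≤ p.1 then 0
  else if y = Q.g^[p.1] (branch a p.2) then stringPath m c a p.2 (p.1 + 1)
  else if y = Q.f (Q.g^[p.1 - 1] (branch a p.2)) then stringTurn m c a p.2 p.1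
  else 0

/-- The action of an arrow. -/
noncomputable def stringArrow (y : Q.Arrow) : Module.End K (StringSpace K) :=
  Finsupp.linearCombination K (stringMul m c a y)

/-- The vertex at which a path ends. -/
def stringEnd (p : ℕ × Bool) : Q.Vertex :=
  if p.1 = 0 then Q.src a else Q.src (Q.g^[p.1] (branch a p.2))

open Classical in
/-- The action of the idempotent of a vertex. -/
noncomputable def stringVertex (i : Q.Vertex) : Module.End K (StringSpace K) :=
  Finsupp.linearCombination K fun p =>
    if i = stringEnd a p then (Finsupp.single p 1 : StringSpace K) else 0

theorem stringVertex_single (i : Q.Vertex) (p : ℕ × Bool) :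
    stringVertex a i (.single p 1 : StringSpace K) =
      (open Classical in if i = stringEnd a p then .single p 1 else 0) := by
  simp [stringVertex]

theorem stringArrow_single (y : Q.Arrow) (p : ℕ × Bool) :
    stringArrow m c a y (.single p 1) = stringMul m c a y p := by
  simp [stringArrow]

theorem stringVertex_stringPath (s : Bool) (k : ℕ) :
    stringVertex a (Q.src (Q.g^[k] (branch a s))) (stringPath m c a s k) =
      stringPath m c a s k := by
  have h2 := m.two_le_len (branch a s)
  unfold stringPath
  split_ifs with h0 h1 h3
  · subst h0
    rw [stringVertex_single, if_pos]
    simp [stringEnd, src_branch]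
  · rw [stringVertex_single, if_pos]
    simp [stringEnd, h0]
  · subst h3
    rw [map_smul, stringVertex_single, if_pos]
    simp [stringEnd, m.iterate_g_len, src_branch]
  · rw [map_zero]

theorem stringPath_of_lt (s : Bool) {k : ℕ} (h0 : k ≠ 0) (h : k < m.len (branch a s)) :
    stringPath m c a s k = .single (k, s) 1 := by
  rw [stringPath, if_neg h0, if_pos h]

theorem stringArrow_socle (y : Q.Arrow) : stringArrow m c a y (.single (0, true) 1) = 0 := by
  rw [stringArrow_single]
  simp [stringMul]

theorem stringArrow_stringPath_of_le (s : Bool) {k : ℕ} (h : m.len (branch a s) ≤ k)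
    (y : Q.Arrow) : stringArrow m c a y (stringPath m c a s k) = 0 := by
  have h2 := m.two_le_len (branch a s)
  rw [stringPath, if_neg (by omega), if_neg (by omega)]
  split_ifs
  · rw [map_smul, stringArrow_socle, smul_zero]
  · rw [map_zero]

theorem stringPath_of_gt (s : Bool) {k : ℕ} (h : m.len (branch a s) < k) :
    stringPath m c a s k = 0 := by
  rw [stringPath, if_neg (by omega), if_neg (by omega), if_neg (by omega)]

theorem stringArrow_stringPath (s : Bool) (k : ℕ) :
    stringArrow m c a (Q.g^[k] (branch a s)) (stringPath m c a s k) =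
      stringPath m c a s (k + 1) := by
  have h2 := m.two_le_len (branch a s)
  by_cases hk : m.len (branch a s) ≤ k
  · rw [stringArrow_stringPath_of_le m c a s hk, stringPath_of_gt m c a s (by omega)]
  by_cases h0 : k = 0
  · subst h0
    rw [stringPath, if_pos rfl, stringArrow_single]
    have := Q.bar_ne a
    cases s <;> simp [stringMul, branch, this]
  · rw [stringPath_of_lt m c a s h0 (by omega), stringArrow_single, stringMul, if_neg h0,
      if_neg hk, if_pos rfl]

theorem stringArrow_stringPath_turn (s : Bool) {k : ℕ} (h0 : k ≠ 0)
    (hk : k < m.len (branch a s)) :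
    stringArrow m c a (Q.f (Q.g^[k - 1] (branch a s))) (stringPath m c a s k) =
      stringTurn m c a s k := by
  have h2 := m.two_le_len (branch a s)
  rw [stringPath_of_lt m c a s h0 (by omega), stringArrow_single, stringMul, if_neg h0,
      if_neg hk.not_ge, if_neg, if_pos rfl]
  obtain ⟨k, rfl⟩ := Nat.exists_eq_succ_of_ne_zero h0
  rw [Function.iterate_succ_apply', Nat.succ_sub_one]
  exact (g_ne_f _).symm

theorem stringArrow_eq_zero (p : ℕ × Bool) {y : Q.Arrow} (h : Q.src y ≠ stringEnd a p) :
    stringArrow m c a y (.single p 1) = 0 := by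
  rw [stringArrow_single, stringMul]
  split_ifs with h0 h1 h1 h1 h1 h1 h1
  · rfl
  · subst h1; simp [stringEnd, h0] at h
  · subst h1; simp [stringEnd, h0, Q.src_bar] at h
  · rfl
  · rfl
  · subst h1; simp [stringEnd, h0] at h
  · subst h1
    obtain ⟨k, hk⟩ := Nat.exists_eq_succ_of_ne_zero h0
    simp [stringEnd, hk, Function.iterate_succ_apply', src_g, Q.src_f] at h
  · rfl

/-- A basis vector is the trivial path, a path along a `g`-cycle, or killed by all arrows. -/
theorem string_cases (p : ℕ × Bool) :
    (.single p 1 : StringSpace K) = stringPath m c a false 0 ∨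
    (∃ s k, k ≠ 0 ∧ k < m.len (branch a s) ∧
      (.single p 1 : StringSpace K) = stringPath m c a s k ∧ p = (k, s)) ∨
    ∀ y, stringArrow m c a y (.single p 1) = 0 := by
  obtain ⟨k, s⟩ := p
  by_cases h0 : k = 0
  · subst h0
    cases s
    · exact Or.inl (by simp [stringPath])
    · exact Or.inr (Or.inr (stringArrow_socle m c a))
  by_cases hk : k < m.len (branch a s)
  · exact Or.inr (Or.inl ⟨s, k, h0, hk, (stringPath_of_lt m c a s h0 hk).symm, rfl⟩)
  · refine Or.inr (Or.inr fun y => ?_)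
    rw [stringArrow_single, stringMul, if_neg h0, if_pos (by simpa using hk)]

/-- The arrows that do not kill a basis vector. -/
theorem stringArrow_cases (s : Bool) {k : ℕ} (h0 : k ≠ 0) (hk : k < m.len (branch a s))
    (y : Q.Arrow) : y = Q.g^[k] (branch a s) ∨ y = Q.f (Q.g^[k - 1] (branch a s)) ∨
      Q.src y ≠ Q.src (Q.g^[k] (branch a s)) := by
  obtain ⟨k, rfl⟩ := Nat.exists_eq_succ_of_ne_zero h0
  rw [Function.iterate_succ_apply', Nat.succ_sub_one]
  by_cases h : Q.src y = Q.src (Q.g (Q.g^[k] (branch a s)))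
  · rw [src_g] at h
    rcases (tgt_eq_iff _ _).mp h.symm with h | h
    · exact Or.inr (Or.inl h)
    · exact Or.inl h
  · exact Or.inr (Or.inr h)

end TwoStrings

end TriangulationQuiver

namespace TriangulationQuiver

universe u

variable {Q : TriangulationQuiver} {K : Type u} [Field K]

/-! ### The relations α f(α) = c_ᾱ A_ᾱ on the string module. -/

section TwoStrings

variable (m : Q.WeightFunction) (c : Q.ParameterFunction K) (a : Q.Arrow)

/-- The arrows as elements of the opposite endomorphism algebra. -/
noncomputable def stringOp (y : Q.Arrow) : (Module.End K (StringSpace K))ᵐᵒᵖ :=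
  MulOpposite.op (stringArrow m c a y)

theorem unop_gProd_succ (y : Q.Arrow) (l : ℕ) (v : StringSpace K) :
    (gProd (stringOp m c a) y (l + 1)).unop v =
      stringArrow m c a (Q.g^[l] y) ((gProd (stringOp m c a) y l).unop v) := by
  rw [gProd_succ, MulOpposite.unop_mul, Module.End.mul_apply]
  rfl

theorem unop_gProd_succ' (y : Q.Arrow) (l : ℕ) (v : StringSpace K) :
    (gProd (stringOp m c a) y (l + 1)).unop v =
      (gProd (stringOp m c a) (Q.g y) l).unop (stringArrow m c a y v) := by
  rw [gProd_succ', MulOpposite.unop_mul, Module.End.mul_apply]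
  rfl

theorem unop_gProd_stringPath (s : Bool) (k l : ℕ) :
    (gProd (stringOp m c a) (Q.g^[k] (branch a s)) l).unop (stringPath m c a s k) =
      stringPath m c a s (k + l) := by
  induction l with
  | zero => simp
  | succ l ih =>
    rw [unop_gProd_succ, ih, ← Function.iterate_add_apply, add_comm l k,
      stringArrow_stringPath, add_assoc]

theorem unop_gProd_eq_zero {y : Q.Arrow} {l : ℕ} (hl : l ≠ 0) {v : StringSpace K}
    (h : stringArrow m c a y v = 0) : (gProd (stringOp m c a) y l).unop v = 0 := by
  obtain ⟨l, rfl⟩ := Nat.exists_eq_succ_of_ne_zero hl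
  rw [unop_gProd_succ', h, map_zero]

theorem stringArrow_last (s : Bool) :
    stringArrow m c a (Q.f (Q.f (branch a (!s)))) (stringPath m c a s (m.len (branch a s) - 1)) =
      stringPath m c a s (m.len (branch a s)) := by
  have h2 := m.two_le_len (branch a s)
  have := stringArrow_stringPath m c a s (m.len (branch a s) - 1)
  rwa [m.iterate_g_len_sub_one, bar_branch, Nat.sub_add_cancel (by omega)] at this

variable (h₁ : m.len a ≠ 2) (h₂ : m.len (Q.bar a) ≠ 2) (h₃ : m.len (Q.f a) ≠ 2)
  (h₄ : m.len (Q.f (Q.bar a)) = 2 → 4 ≤ m.len a ∧ 4 ≤ m.len (Q.bar a))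

include h₁ h₂ in
theorem three_le_len_branch (s : Bool) : 3 ≤ m.len (branch a s) := by
  cases s
  · exact m.three_le_len h₁
  · exact m.three_le_len h₂

include h₁ h₂ h₄ in
-- A string stopped one step before its end has length at least two, and could turn only by the
-- special value of `stringTurn` at length two on the side of ā. There h₄ makes the string longer.
theorem stringArrow_last_turn (s : Bool) :
    stringArrow m c a (Q.g (Q.f (branch a (!s))))
      (stringPath m c a s (m.len (branch a s) - 1)) = 0 := by
  have h3 := three_le_len_branch m a h₁ h₂ s
  have := stringArrow_stringPath_turn m c a s (k := m.len (branch a s) - 1) (by omega) (by omega)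
  rw [Nat.sub_sub, show 1 + 1 = 2 from rfl, m.f_iterate_g_len_sub_two, bar_branch] at this
  rw [this, stringTurn, if_neg (by omega), if_neg]
  rintro ⟨h5, rfl, h6⟩
  have := (h₄ h6).2
  change m.len (Q.bar a) - 1 = 2 at h5
  omega

theorem stringTurn_eq_zero {s : Bool} {k : ℕ} (hk : 2 < k) : stringTurn m c a s k = 0 := by
  rw [stringTurn, if_neg (by omega), if_neg (by omega)]

theorem stringTurn_one (s : Bool) : stringTurn m c a s 1 =
    c.c (branch a (!s)) • stringPath m c a (!s) (m.len (branch a (!s)) - 1) := by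
  rw [stringTurn, if_pos rfl]

theorem c_iterate (k : ℕ) (y : Q.Arrow) : c.c (Q.g^[k] y) = c.c y := by
  induction k with
  | zero => rfl
  | succ k ih => rw [Function.iterate_succ_apply', c.c_g, ih]

theorem c_smul_stringPath_len (s : Bool) :
    c.c (branch a s) • stringPath m c a s (m.len (branch a s)) = .single (0, true) 1 := by
  have := m.two_le_len (branch a s)
  rw [stringPath, if_neg (by omega), if_neg (by omega), if_pos rfl, smul_smul,
    mul_inv_cancel₀ (c.c_ne_zero _), one_smul]

theorem f_f_g_bar_of_len_eq_two (h : m.len (Q.f (Q.bar a)) = 2) :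
    Q.f (Q.f (Q.g (Q.bar a))) = Q.g (Q.f (Q.bar a)) := by
  apply g_injective
  rw [g_f_f, bar_g, m.g_g_of_len_eq_two h]

theorem g_f_g_bar_of_len_eq_two (h : m.len (Q.f (Q.bar a)) = 2) :
    Q.g (Q.f (Q.g (Q.bar a))) = Q.f (Q.f (Q.bar a)) := by
  rw [← bar_f, f_f_g_bar_of_len_eq_two m a h, bar_g]

include h₁ h₂ h₃ h₄

/-- The relations `α f(α) = c A_ᾱ` on the module. -/
theorem stringOp_mul_f (y : Q.Arrow) : stringOp m c a y * stringOp m c a (Q.f y) =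
    c.c (Q.bar y) • gProd (stringOp m c a) (Q.bar y) (m.len (Q.bar y) - 1) := by
  apply MulOpposite.unop_injective
  refine Finsupp.lhom_ext' fun p => LinearMap.ext_ring ?_
  rw [MulOpposite.unop_mul, MulOpposite.unop_smul]
  simp only [LinearMap.comp_apply, Finsupp.lsingle_apply, Module.End.mul_apply,
    LinearMap.smul_apply]
  change stringArrow m c a (Q.f y) (stringArrow m c a y (.single p 1)) = _
  have hlen := m.two_le_len (Q.bar y)
  have hlast := stringArrow_last_turn m c a h₁ h₂ h₄
  have hsrc0 : ∀ p, Q.src y ≠ stringEnd a p →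
      stringArrow m c a (Q.f y) (stringArrow m c a y (.single p 1)) = c.c (Q.bar y) •
        (gProd (stringOp m c a) (Q.bar y) (m.len (Q.bar y) - 1)).unop (.single p 1) := by
    intro p hp
    rw [stringArrow_eq_zero m c a p hp, map_zero, unop_gProd_eq_zero m c a (by omega)
      (stringArrow_eq_zero m c a p (by rwa [Q.src_bar])), smul_zero]
  rcases string_cases m c a p with h0 | ⟨s, k, hk0, hk, h0, rfl⟩ | h0
  · by_cases hy : Q.src y = Q.src a
    · obtain ⟨s, rfl⟩ := eq_branch a hy
      have htop : ∀ s, stringPath m c a s 0 = stringPath m c a false 0 := fun s => by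
        simp [stringPath]
      have h5 : stringArrow m c a (branch a s) (stringPath m c a false 0) =
          stringPath m c a s 1 := by
        rw [← htop s]; exact stringArrow_stringPath m c a s 0
      have h6 := stringArrow_stringPath_turn m c a s one_ne_zero
        (by have := three_le_len_branch m a h₁ h₂ s; omega)
      have h7 := unop_gProd_stringPath m c a (!s) 0 (m.len (branch a (!s)) - 1)
      rw [htop, zero_add, Function.iterate_zero_apply] at h7
      rw [h0, h5, bar_branch, h7, ← stringTurn_one]
      exact h6
    · refine hsrc0 p ?_
      obtain ⟨k, s⟩ := p
      by_cases hk : k = 0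
      · simpa [stringEnd, hk] using hy
      · exfalso
        rw [stringPath, if_pos rfl] at h0
        have := Finsupp.single_left_injective one_ne_zero h0
        exact hk (congrArg Prod.fst this)
  · rcases stringArrow_cases m a s hk0 hk y with rfl | rfl | hy
    · -- the arrow that follows the path on its cycle
      obtain ⟨k, rfl⟩ := Nat.exists_eq_succ_of_ne_zero hk0
      rw [Nat.succ_eq_add_one] at *
      have hbar : Q.bar (Q.g^[k + 1] (branch a s)) = Q.f (Q.g^[k] (branch a s)) := by
        rw [Function.iterate_succ_apply', bar_g]
      have h5 := stringArrow_stringPath_turn m c a s hk0 hk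
      rw [Nat.add_sub_cancel] at h5
      have h6 : stringArrow m c a (Q.f (Q.g^[k + 1] (branch a s)))
          (stringPath m c a s (k + 1 + 1)) = stringTurn m c a s (k + 2) := by
        by_cases hk' : k + 1 + 1 < m.len (branch a s)
        · exact stringArrow_stringPath_turn m c a s (k := k + 1 + 1) (by omega) hk'
        · have := three_le_len_branch m a h₁ h₂ s
          rw [stringArrow_stringPath_of_le m c a s (by omega), stringTurn_eq_zero m c a (by omega)]
      rw [h0, stringArrow_stringPath, h6, hbar]
      rw [hbar] at hlen
      obtain ⟨l, hl⟩ : ∃ l, m.len (Q.f (Q.g^[k] (branch a s))) - 1 = l + 1 :=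
        ⟨m.len (Q.f (Q.g^[k] (branch a s))) - 2, by omega⟩
      rw [hl, unop_gProd_succ', h5]
      rcases k with _ | _ | k
      · rw [stringTurn_one, map_smul, Function.iterate_zero_apply]
        rw [Function.iterate_zero_apply] at hl
        have h7 := hlast (!s)
        rw [Bool.not_not] at h7
        -- If this arrow is virtual, its A is the arrow itself and the action is the special value
        -- of `stringTurn`. Otherwise a further arrow follows the turn, and it kills the end of the
        -- other string.
        by_cases hv : m.len (Q.f (branch a s)) = 2
        · obtain rfl : l = 0 := by omega
          cases s
          · exact absurd hv h₃
          · rw [gProd_zero, MulOpposite.unop_one, Module.End.one_apply, stringTurn,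
              if_neg (by omega), if_pos ⟨rfl, rfl, hv⟩, smul_smul]
            rfl
        · rw [unop_gProd_eq_zero m c a (by omega) h7, smul_zero, smul_zero, stringTurn,
            if_neg (by omega), if_neg]
          rintro ⟨-, rfl, h8⟩
          exact hv h8
      · rw [stringTurn_eq_zero m c a (by omega)]
        by_cases hv : s = true ∧ m.len (Q.f (Q.bar a)) = 2
        · obtain ⟨rfl, hv⟩ := hv
          rw [stringTurn, if_neg (by omega), if_pos ⟨rfl, rfl, hv⟩, map_smul]
          have h7 := stringArrow_last m c a false
          have hg := g_f_g_bar_of_len_eq_two m a hv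
          -- By h₄ the path A_{f(g(ā))} has at least three arrows: one turns to A_a, one continues
          -- to the socle generator, and one kills it.
          have hl' : 2 ≤ l := by
            have h9 := (h₄ hv).1
            have h10 : m.len (Q.f (Q.g (Q.bar a))) = m.len a := by
              rw [← m.len_g, hg, m.len_f_f, bar_bar]
            change m.len (Q.f (Q.g (Q.bar a))) - 1 = _ at hl
            omega
          obtain ⟨l, rfl⟩ := Nat.exists_eq_add_of_le' hl'
          have hg' : Q.g (Q.f (Q.g^[0 + 1] (branch a true))) = Q.f (Q.f (branch a (!false))) := hg
          rw [hg', unop_gProd_succ']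
          change _ = _ • _ • (gProd (stringOp m c a) _ (l + 1)).unop (stringArrow m c a _
            (stringPath m c a false (m.len (branch a false) - 1)))
          rw [h7, unop_gProd_eq_zero m c a (by omega)
            (stringArrow_stringPath_of_le m c a false le_rfl _), smul_zero, smul_zero]
        · rw [stringTurn, if_neg (by omega), if_neg (by tauto), map_zero, smul_zero]
      · rw [stringTurn_eq_zero m c a (by omega), stringTurn_eq_zero m c a (by omega), map_zero,
          smul_zero]
    · -- the arrow that does not follow the path on its cycle
      obtain ⟨k, rfl⟩ := Nat.exists_eq_succ_of_ne_zero hk0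
      have h5 := stringArrow_stringPath_turn m c a s hk0 hk
      have hbar : Q.bar (Q.f (Q.g^[k] (branch a s))) = Q.g^[k + 1] (branch a s) := by
        rw [bar_f, Function.iterate_succ_apply']
      have h6 := m.two_le_len (branch a s)
      rw [h0, h5, Nat.succ_sub_one, hbar, Nat.succ_eq_add_one, unop_gProd_stringPath,
        c_iterate, m.len_iterate]
      rcases k with _ | _ | k
      · rw [zero_add, stringTurn_one, map_smul, Function.iterate_zero_apply,
          show 1 + (m.len (branch a s) - 1) = m.len (branch a s) by omega,
          c_smul_stringPath_len]
        have h7 := stringArrow_last m c a (!s)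
        rw [Bool.not_not] at h7
        rw [h7, c_smul_stringPath_len]
      · rw [stringPath_of_gt m c a s (by omega), smul_zero]
        by_cases hv : s = true ∧ m.len (Q.f (Q.bar a)) = 2
        · obtain ⟨rfl, hv⟩ := hv
          rw [stringTurn, if_neg (by omega), if_pos ⟨rfl, rfl, hv⟩, map_smul]
          have h7 := f_f_g_bar_of_len_eq_two m a hv
          have h8 := hlast false
          change _ • stringArrow m c a (Q.f (Q.f (Q.g (Q.bar a)))) _ = 0
          rw [h7]
          exact (congrArg _ h8).trans (smul_zero _)
        · rw [stringTurn, if_neg (by omega), if_neg (by tauto), map_zero]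
      · rw [stringTurn_eq_zero m c a (by omega), map_zero,
          stringPath_of_gt m c a s (by omega), smul_zero]
    · exact hsrc0 (k, s) (by rwa [stringEnd, if_neg hk0])
  · rw [h0, map_zero, unop_gProd_eq_zero m c a (by omega) (h0 _), smul_zero]

end TwoStrings

end TriangulationQuiver

namespace TriangulationQuiver

universe u

variable {Q : TriangulationQuiver} {K : Type u} [Field K]

/-! ### Idempotents and zero relations on the string module; nonvanishing of B_α. -/

section TwoStrings

variable (m : Q.WeightFunction) (c : Q.ParameterFunction K) (a : Q.Arrow)

open Classical in
theorem stringVertex_mul (i j : Q.Vertex) : (stringVertex a i * stringVertex a j :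
    Module.End K (StringSpace K)) = if i = j then stringVertex a i else 0 := by
  refine Finsupp.lhom_ext' fun p => LinearMap.ext_ring ?_
  simp only [LinearMap.comp_apply, Finsupp.lsingle_apply, Module.End.mul_apply]
  rw [stringVertex_single]
  by_cases hj : j = stringEnd a p
  · rw [if_pos hj, stringVertex_single]
    by_cases hij : i = j
    · subst hij
      rw [if_pos rfl, if_pos hj, stringVertex_single, if_pos hj]
    · rw [if_neg hij, if_neg fun h => hij (h.trans hj.symm)]
      rfl
  · rw [if_neg hj, map_zero]
    by_cases hij : i = j
    · subst hij
      rw [if_pos rfl, stringVertex_single, if_neg hj]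
    · rw [if_neg hij]
      rfl

theorem sum_stringVertex : ∑ i, (stringVertex a i : Module.End K (StringSpace K)) = 1 := by
  refine Finsupp.lhom_ext' fun p => LinearMap.ext_ring ?_
  simp only [LinearMap.comp_apply, Finsupp.lsingle_apply, LinearMap.sum_apply,
    stringVertex_single, Module.End.one_apply]
  exact (Finset.sum_eq_single (stringEnd a p) (fun i _ h => if_neg h) (by simp)).trans (if_pos rfl)

theorem stringVertex_tgt_stringTurn (s : Bool) {k : ℕ} (h0 : k ≠ 0) :
    stringVertex a (Q.tgt (Q.f (Q.g^[k - 1] (branch a s)))) (stringTurn m c a s k) =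
      stringTurn m c a s k := by
  rw [stringTurn]
  split_ifs with h1 h2
  · subst h1
    have := stringVertex_stringPath m c a (!s) (m.len (branch a (!s)) - 1)
    rw [m.iterate_g_len_sub_one, bar_branch, Bool.not_not] at this
    rw [← Q.src_f, map_smul]
    exact congrArg _ this
  · obtain ⟨rfl, rfl, hv⟩ := h2
    have := stringVertex_stringPath m c a false (m.len (branch a false) - 1)
    rw [m.iterate_g_len_sub_one] at this
    have hsrc : Q.tgt (Q.f (Q.g^[2 - 1] (branch a true))) =
        Q.src (Q.f (Q.f (Q.bar (branch a false)))) := by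
      rw [← Q.src_f, ← Q.src_bar]
      change Q.src (Q.bar (Q.f (Q.f (Q.g (Q.bar a))))) = Q.src (Q.f (Q.f (Q.bar a)))
      rw [f_f_g_bar_of_len_eq_two m a hv, bar_g]
    rw [hsrc, map_smul]
    exact congrArg _ this
  · rw [map_zero]

/-- The idempotents of the vertices as elements of the opposite endomorphism algebra. -/
noncomputable def stringIdem (K : Type u) [Field K] (a : Q.Arrow) (i : Q.Vertex) :
    (Module.End K (StringSpace K))ᵐᵒᵖ :=
  MulOpposite.op (stringVertex a i)

theorem isPathSystem_string : IsPathSystem (stringIdem K a) (stringOp m c a) := by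
  classical
  refine ⟨⟨⟨fun i => ?_, fun i j hij => ?_⟩, ?_⟩, fun y => ?_, fun y => ?_⟩
  · rw [IsIdempotentElem, stringIdem, ← MulOpposite.op_mul, stringVertex_mul, if_pos rfl]
  · change MulOpposite.op _ * MulOpposite.op _ = 0
    rw [← MulOpposite.op_mul, stringVertex_mul, if_neg hij.symm, MulOpposite.op_zero]
  · simp only [stringIdem]
    refine (map_sum MulOpposite.opAddEquiv _ _).symm.trans ?_
    rw [sum_stringVertex]
    rfl
  · rw [stringIdem, stringOp, ← MulOpposite.op_mul]
    congr 1
    refine Finsupp.lhom_ext' fun p => LinearMap.ext_ring ?_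
    simp only [LinearMap.comp_apply, Finsupp.lsingle_apply, Module.End.mul_apply]
    rw [stringVertex_single]
    split_ifs with h
    · rfl
    · rw [stringArrow_eq_zero m c a p h, map_zero]
  · rw [stringIdem, stringOp, ← MulOpposite.op_mul]
    congr 1
    refine Finsupp.lhom_ext' fun p => LinearMap.ext_ring ?_
    simp only [LinearMap.comp_apply, Finsupp.lsingle_apply, Module.End.mul_apply]
    have hpath : ∀ s k, Q.g^[k] (branch a s) = y →
        stringVertex a (Q.tgt y) (stringPath m c a s (k + 1)) = stringPath m c a s (k + 1) := by
      rintro s k rfl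
      have := stringVertex_stringPath m c a s (k + 1)
      rwa [Function.iterate_succ_apply', src_g] at this
    rw [stringArrow_single, stringMul]
    split_ifs with h0 h1 h1 h1 h1 h1 h1
    · exact map_zero _
    · exact hpath false 0 h1.symm
    · exact hpath true 0 h1.symm
    · exact map_zero _
    · exact map_zero _
    · exact hpath p.2 p.1 h1.symm
    · subst h1
      exact stringVertex_tgt_stringTurn m c a p.2 h0
    · exact map_zero _

variable (h₁ : m.len a ≠ 2) (h₂ : m.len (Q.bar a) ≠ 2) (h₃ : m.len (Q.f a) ≠ 2)
  (h₄ : m.len (Q.f (Q.bar a)) = 2 → 4 ≤ m.len a ∧ 4 ≤ m.len (Q.bar a))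

include h₁ h₂ h₃ h₄

omit h₁ h₂ h₃ h₄ in
theorem stringArrow_branch (s : Bool) :
    stringArrow m c a (branch a s) (.single (0, false) 1) = stringPath m c a s 1 := by
  have := stringArrow_stringPath m c a s 0
  rwa [stringPath, if_pos rfl] at this

omit h₃ h₄ in
theorem stringArrow_turn (s : Bool) (k : ℕ) : stringArrow m c a (Q.f (Q.g^[k] (branch a s)))
    (stringPath m c a s (k + 1)) = stringTurn m c a s (k + 1) := by
  have h3 := three_le_len_branch m a h₁ h₂ s
  by_cases hk' : k + 1 < m.len (branch a s)
  · exact stringArrow_stringPath_turn m c a s (k := k + 1) (by omega) hk'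
  · rw [stringArrow_stringPath_of_le m c a s (by omega), stringTurn_eq_zero m c a (by omega)]

omit h₃ in
theorem stringArrow_turn_one (s : Bool) :
    stringArrow m c a (Q.g (Q.f (branch a s))) (stringTurn m c a s 1) = 0 := by
  have := stringArrow_last_turn m c a h₁ h₂ h₄ (!s)
  rw [Bool.not_not] at this
  rw [stringTurn_one, map_smul, this, smul_zero]

omit h₃ in
theorem stringOp_mul_f_g (y : Q.Arrow) (hy : m.len (Q.bar y) ≠ 2) :
    stringOp m c a y * stringOp m c a (Q.f y) * stringOp m c a (Q.g (Q.f y)) = 0 := by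
  have hlast := stringArrow_last_turn m c a h₁ h₂ h₄
  have htop : ∀ s, stringPath m c a s 0 = .single (0, false) 1 := fun s => by simp [stringPath]
  have hturn := fun s {k} (_ : k ≠ 0) => stringArrow_turn m c a h₁ h₂ s k
  have hlast' := stringArrow_turn_one m c a h₁ h₂ h₄
  have h6 := fun s => stringArrow_turn m c a h₁ h₂ s 0
  simp only [Function.iterate_zero_apply, zero_add] at h6
  apply MulOpposite.unop_injective
  refine Finsupp.lhom_ext' fun p => LinearMap.ext_ring ?_
  rw [MulOpposite.unop_mul, MulOpposite.unop_mul]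
  simp only [LinearMap.comp_apply, Finsupp.lsingle_apply, Module.End.mul_apply]
  change stringArrow m c a (Q.g (Q.f y)) (stringArrow m c a (Q.f y)
    (stringArrow m c a y (.single p 1))) = 0
  rcases string_cases m c a p with h0 | ⟨s, k, hk0, hk, h0, rfl⟩ | h0
  · rw [htop] at h0
    rw [h0]
    by_cases hys : Q.src y = Q.src a
    · obtain ⟨s, rfl⟩ := eq_branch a hys
      rw [stringArrow_branch, h6, hlast']
    · rw [stringArrow_eq_zero m c a (0, false) hys, map_zero, map_zero]
  · rcases stringArrow_cases m a s hk0 hk y with rfl | rfl | hys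
    · rw [h0, stringArrow_stringPath, hturn s hk0, stringTurn, if_neg (by omega), if_neg,
        map_zero]
      rintro ⟨hk1, rfl, hv⟩
      obtain rfl : k = 1 := by omega
      refine hy ?_
      rw [Function.iterate_one, bar_g]
      exact hv
    · obtain ⟨k, rfl⟩ := Nat.exists_eq_succ_of_ne_zero hk0
      have h7 := stringArrow_stringPath_turn m c a s hk0 hk
      rw [h0, h7]
      rw [Nat.succ_sub_one] at *
      rcases k with _ | k
      · rw [stringTurn_one, map_smul, map_smul]
        have h8 := stringArrow_last m c a (!s)
        rw [Bool.not_not] at h8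
        rw [Function.iterate_zero_apply, h8, stringArrow_stringPath_of_le m c a _ le_rfl,
          smul_zero]
      · rw [stringTurn, if_neg (by omega)]
        split_ifs with hv
        · obtain ⟨hk1, rfl, hv⟩ := hv
          obtain rfl : k = 0 := by omega
          rw [map_smul, map_smul]
          have h7 := f_f_g_bar_of_len_eq_two m a hv
          have h8 := hlast false
          change _ • stringArrow m c a _ (stringArrow m c a (Q.f (Q.f (Q.g (Q.bar a)))) _) = 0
          rw [h7]
          refine (congrArg (fun v => _ • stringArrow m c a _ v) h8).trans ?_
          rw [map_zero, smul_zero]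
        · rw [map_zero, map_zero]
    · rw [stringArrow_eq_zero m c a (k, s) (by rwa [stringEnd, if_neg hk0]), map_zero, map_zero]
  · rw [h0, map_zero, map_zero]

omit h₃ in
theorem stringOp_mul_g_f (y : Q.Arrow) (hy : m.len (Q.f y) ≠ 2) :
    stringOp m c a y * stringOp m c a (Q.g y) * stringOp m c a (Q.f (Q.g y)) = 0 := by
  have htop : ∀ s, stringPath m c a s 0 = .single (0, false) 1 := fun s => by simp [stringPath]
  have hturn := fun s {k} (_ : k ≠ 0) => stringArrow_turn m c a h₁ h₂ s k
  have hlast' := stringArrow_turn_one m c a h₁ h₂ h₄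
  apply MulOpposite.unop_injective
  refine Finsupp.lhom_ext' fun p => LinearMap.ext_ring ?_
  rw [MulOpposite.unop_mul, MulOpposite.unop_mul]
  simp only [LinearMap.comp_apply, Finsupp.lsingle_apply, Module.End.mul_apply]
  change stringArrow m c a (Q.f (Q.g y)) (stringArrow m c a (Q.g y)
    (stringArrow m c a y (.single p 1))) = 0
  rcases string_cases m c a p with h0 | ⟨s, k, hk0, hk, h0, rfl⟩ | h0
  · rw [htop] at h0
    rw [h0]
    by_cases hys : Q.src y = Q.src a
    · obtain ⟨s, rfl⟩ := eq_branch a hys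
      have h7 := stringArrow_stringPath m c a s 1
      rw [Function.iterate_one] at h7
      have h8 := hturn s one_ne_zero
      rw [Function.iterate_one] at h8
      rw [stringArrow_branch, h7, h8, stringTurn, if_neg (by omega), if_neg]
      rintro ⟨-, rfl, hv⟩
      exact hy hv
    · rw [stringArrow_eq_zero m c a (0, false) hys, map_zero, map_zero]
  · rcases stringArrow_cases m a s hk0 hk y with rfl | rfl | hys
    · have h7 := stringArrow_stringPath m c a s (k + 1)
      have h8 := hturn s (k := k + 1) (by omega)
      rw [Function.iterate_succ_apply'] at h7 h8
      rw [h0, stringArrow_stringPath, h7, h8, stringTurn_eq_zero m c a (by omega)]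
    · obtain ⟨k, rfl⟩ := Nat.exists_eq_succ_of_ne_zero hk0
      have h7 := stringArrow_stringPath_turn m c a s hk0 hk
      rw [h0, h7]
      rw [Nat.succ_sub_one] at *
      rcases k with _ | k
      · rw [Function.iterate_zero_apply, hlast', map_zero]
      · rw [stringTurn, if_neg (by omega)]
        split_ifs with hv
        · obtain ⟨hk1, rfl, hv⟩ := hv
          obtain rfl : k = 0 := by omega
          rw [map_smul, map_smul]
          have h8 := stringArrow_last m c a false
          have hg := g_f_g_bar_of_len_eq_two m a hv
          change _ • stringArrow m c a _ (stringArrow m c a (Q.g (Q.f (Q.g (Q.bar a)))) _) = 0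
          rw [hg]
          refine (congrArg (fun v => _ • stringArrow m c a _ v) h8).trans ?_
          rw [stringArrow_stringPath_of_le m c a _ le_rfl, smul_zero]
        · rw [map_zero, map_zero]
    · rw [stringArrow_eq_zero m c a (k, s) (by rwa [stringEnd, if_neg hk0]), map_zero, map_zero]
  · rw [h0, map_zero, map_zero]

theorem isSolution_string : IsSolution m c 0 (stringIdem K a) (stringOp m c a) := by
  refine { isPathSystem_string m c a with
    mul_f := fun y _ => stringOp_mul_f m c a h₁ h₂ h₃ h₄ y
    border_sq := fun y hy => ?_
    mul_f_g := fun y hy _ => stringOp_mul_f_g m c a h₁ h₂ h₄ y hy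
    mul_g_f := fun y hy _ => stringOp_mul_g_f m c a h₁ h₂ h₄ y hy }
  rw [Pi.zero_apply, zero_smul, add_zero, ← stringOp_mul_f m c a h₁ h₂ h₃ h₄ y,
      show Q.f y = y from hy]

/-- The path `B_α` does not vanish in `Λ`. -/
theorem gProd_len_ne_zero :
    gProd (SocleDeformedAlgebra.arrow m c 0) a (m.len a) ≠ 0 := by
  obtain ⟨F, -, hF⟩ := SocleDeformedAlgebra.exists_lift (isSolution_string m c a h₁ h₂ h₃ h₄)
  intro h0
  have h5 := map_gProd (R' := (Module.End K (StringSpace K))ᵐᵒᵖ)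
    (F : SocleDeformedAlgebra m c 0 →+* (Module.End K (StringSpace K))ᵐᵒᵖ)
    (SocleDeformedAlgebra.arrow m c 0) a (m.len a)
  have h5' : (fun y => (F : SocleDeformedAlgebra m c 0 →+* (Module.End K (StringSpace K))ᵐᵒᵖ)
      (SocleDeformedAlgebra.arrow m c 0 y)) = stringOp m c a := funext hF
  rw [h5'] at h5
  rw [h0, map_zero] at h5
  have h6 := unop_gProd_stringPath m c a false 0 (m.len a)
  rw [zero_add] at h6
  change (gProd (stringOp m c a) a (m.len a)).unop _ = _ at h6
  rw [← h5, MulOpposite.unop_zero, LinearMap.zero_apply] at h6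
  have h7 := c_smul_stringPath_len m c a false
  change _ • stringPath m c a false (m.len a) = _ at h7
  rw [← h6, smul_zero] at h7
  simpa using h7.symm

end TwoStrings

/-! ### The paths B_α at loops of Λ. -/

section

variable (m : Q.WeightFunction) (c : Q.ParameterFunction K)

theorem four_le_len_of_border {a : Q.Arrow} (ha : Q.IsBorderLoop a)
    (hv : m.len (Q.f (Q.bar a)) = 2) : 4 ≤ m.len a := by
  by_contra h
  have h3 : m.len a = 3 := by
    have := m.three_le_len (m.len_border_ne_two ha)
    omega
  exact m.not_len_eq_three hv (by rw [m.len_border ha, h3]) (by rw [bar_bar, h3])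

/-- A border loop and its partner lie on one g-cycle without virtual arrows, and f fixes the loop.
If f(ā) is virtual, the exclusion of two cycles of length three gives length at least four, so the
string module applies. -/
theorem gProd_len_ne_zero_of_border {a : Q.Arrow} (ha : Q.IsBorderLoop a) :
    gProd (SocleDeformedAlgebra.arrow m c 0) a (m.len a) ≠ 0 := by
  have h1 := m.len_border_ne_two ha
  refine gProd_len_ne_zero m c a h1 (by rwa [m.len_border ha]) ?_ fun hv => ?_
  · rwa [show Q.f a = a from ha]
  · rw [m.len_border ha, and_self]
    exact four_le_len_of_border m ha hv

/-- The arrow following a loop that is not a border loop and is not fixed by `g` is not virtual. -/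
theorem len_bar_ne_two_of_loop {a : Q.Arrow} (ha : Q.tgt a = Q.src a)
    (hb : ¬ Q.IsBorderLoop a) : m.len (Q.bar a) ≠ 2 := by
  intro hv
  have h1 := f_eq_bar_of_loop ha hb
  have h2 : Q.f (Q.f a) = Q.g (Q.bar a) := by
    apply g_injective
    rw [g_f_f, m.g_g_of_len_eq_two hv]
  rw [h1] at h2
  exact g_ne_f _ h2.symm

theorem gProd_len_ne_zero_of_loop {a : Q.Arrow} (ha : Q.tgt a = Q.src a)
    (hb : ¬ Q.IsBorderLoop a) (h1 : m.len a ≠ 2) :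
    gProd (SocleDeformedAlgebra.arrow m c 0) a (m.len a) ≠ 0 := by
  have h2 := len_bar_ne_two_of_loop m ha hb
  have h3 := f_eq_bar_of_loop ha hb
  refine gProd_len_ne_zero m c a h1 h2 (by rwa [h3]) fun hv => absurd hv ?_
  rw [← h3, m.len_f_f]
  exact h2

end

end TriangulationQuiver

namespace TriangulationQuiver

universe u v

open FDAlgebra SocleDeformedAlgebra

/-! ### The socle of Λ. -/

section SocleOfWeightedAlgebra

variable {Q : TriangulationQuiver} {K : Type v} [Field K]
  {m : Q.WeightFunction} {c : Q.ParameterFunction K} [DecidableEq Q.Vertex]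
  {ε : WeightedAlgebra m c →ₐ[K] (Q.Vertex → K)}
  (hεe : ∀ i, ε (vertex m c 0 i) = Pi.single i 1) (hεx : ∀ a, ε (arrow m c 0 a) = 0)
include hεe hεx

/-- Some arrow x_a ≠ 0 starts at each vertex i. If ε(s)_i ≠ 0, then e_i s acts on x_a as a nonzero
scalar plus a nilpotent, contradicting s x_a = 0. -/
theorem socle_le_ker {s : WeightedAlgebra m c} (hs : s ∈ socle (WeightedAlgebra m c)) :
    ε s = 0 := by
  obtain ⟨k, hN⟩ := WeightedAlgebra.exists_ker_pow_eq_bot hεe hεx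
  have h := isPathSystem m c (0 : Q.BorderFunction K)
  ext i
  by_contra hi
  obtain ⟨a, rfl, ha⟩ : ∃ a, Q.src a = i ∧ m.len a ≠ 2 := by
    obtain ⟨a, ha⟩ := Q.src_surjective i
    by_cases h2 : m.len a = 2
    · exact ⟨Q.bar a, by rw [Q.src_bar, ha], m.len_bar_ne_two_of_len h2⟩
    · exact ⟨a, ha, h2⟩
  obtain ⟨n, hn, hr⟩ := exists_mul_e_eq h.complete hεe (Q.src a) s
  refine arrow_ne_zero m c ha (eq_zero_of_smul_add_mul_eq_zero hN hi hn ?_)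
  have h1 : s * arrow m c 0 a = 0 := mul_eq_zero_of_mem_socle hN hs (hεx a)
  have h2 := congrArg (· * arrow m c 0 a) hr
  simp only [mul_assoc, h1, mul_zero, add_mul, smul_mul_assoc, h.src_mul] at h2
  exact h2.symm

theorem mem_socle_of_mul_arrow_eq_zero {s : WeightedAlgebra m c}
    (hs : ∀ a, s * arrow m c 0 a = 0) : s ∈ socle (WeightedAlgebra m c) := by
  refine mem_socle_of_mul_eq_zero (isPathSystem m c 0).complete hεe fun n hn => ?_
  rw [WeightedAlgebra.ker_eq_mul_top hεe hεx] at hn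
  induction hn using Submodule.mul_induction_on' with
  | mem_mul_mem y hy z _ =>
    rw [← mul_assoc]
    convert zero_mul z
    induction hy using Submodule.span_induction with
    | mem y hy => obtain ⟨a, rfl⟩ := hy; exact hs a
    | zero => exact mul_zero s
    | add y y' _ _ h h' => rw [mul_add, h, h', add_zero]
    | smul t y _ h => rw [mul_smul_comm, h, smul_zero]
  | add y _ y' _ h h' => rw [mul_add, h, h', add_zero]

theorem gProd_len_mem_socle (a : Q.Arrow) :
    gProd (arrow m c 0) a (m.len a) ∈ socle (WeightedAlgebra m c) :=
  mem_socle_of_mul_arrow_eq_zero hεe hεx ((WeightedAlgebra.isSolution m c).gProd_len_mul a)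

end SocleOfWeightedAlgebra

/-- Elements of a symmetric algebra that lift the arrows of `Λ / soc(Λ)`, up to terms that
vanish in all products with arrows, along a homomorphism `Λ → A / soc(A)`. -/
structure IsSocleLift {Q : TriangulationQuiver} {K : Type v} [Field K] {A : Type u} [Ring A]
    [Algebra K A] [DecidableEq Q.Vertex] (m : Q.WeightFunction) (c : Q.ParameterFunction K)
    (B : LinearMap.BilinForm K A) (ε : A →ₐ[K] (Q.Vertex → K))
    (ψ : WeightedAlgebra m c →ₐ[K] A ⧸ socle A) (e : Q.Vertex → A) (x : Q.Arrow → A) : Prop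
    extends IsPathSystem e x where
  form : IsSymmetrizingForm B
  aug : ∀ i, ε (e i) = Pi.single i 1
  aug_arrow : ∀ a, ε (x a) = 0
  nilpotent : ∃ k, LinearMap.ker ε.toLinearMap ^ k = ⊥
  socle_le : (socle A).restrictScalars K ≤ LinearMap.ker ε.toLinearMap ^ 2
  ker_le : LinearMap.ker ε.toLinearMap ≤
    Submodule.span K (Set.range x) ⊔ LinearMap.ker ε.toLinearMap ^ 2
  map_eq_zero_iff : ∀ r, ψ r = 0 ↔ r ∈ socle (WeightedAlgebra m c)
  mk_mul : ∀ a b, Ideal.Quotient.mkₐ K (socle A) (x a * x b) = ψ (arrow m c 0 a * arrow m c 0 b)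
  map_mul_mk : ∀ a b, ψ (arrow m c 0 a) * Ideal.Quotient.mkₐ K (socle A) (x b) =
    ψ (arrow m c 0 a * arrow m c 0 b)

/-! ### Lifting idempotents and arrows to the symmetric algebra. -/

section Existence

variable {Q : TriangulationQuiver} {K : Type v} [Field K] {A : Type u} [Ring A]
  [Algebra K A] [DecidableEq Q.Vertex] [Module.Finite K A] {B : LinearMap.BilinForm K A}

/-- Idempotents lift along A → A/soc(A) because the socle has square zero, and lifts of the arrows
are cut down by these idempotents. They generate N modulo N² since the ambiguity, the socle, lies in
N². -/
theorem exists_isSocleLift (m : Q.WeightFunction) (c : Q.ParameterFunction K)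
    (hB : IsSymmetrizingForm B) (hind : IsIndecomposable A)
    (hsoc : SocleEquivalent K A (WeightedAlgebra m c)) :
    ∃ (ε : A →ₐ[K] (Q.Vertex → K)) (ψ : WeightedAlgebra m c →ₐ[K] A ⧸ socle A)
      (e : Q.Vertex → A) (x : Q.Arrow → A), IsSocleLift m c B ε ψ e x ∧
        ∀ a, Ideal.Quotient.mkₐ K (socle A) (x a) = ψ (arrow m c 0 a) := by
  have : Nontrivial Q.Vertex := Fintype.one_lt_card_iff_nontrivial.mp Q.two_le_card
  obtain ⟨-, -, ⟨φ⟩⟩ := hsoc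
  obtain ⟨ε₀, hεe, hεx⟩ := exists_augmentation m c (0 : Q.BorderFunction K)
  obtain ⟨k, hN⟩ := WeightedAlgebra.exists_ker_pow_eq_bot hεe hεx
  have hL := isPathSystem m c (0 : Q.BorderFunction K)
  let π := Ideal.Quotient.mkₐ K (socle A)
  let π₀ := Ideal.Quotient.mkₐ K (socle (WeightedAlgebra m c))
  let ψ : WeightedAlgebra m c →ₐ[K] A ⧸ socle A := (φ.symm : _ →ₐ[K] _).comp π₀
  have hπ : Function.Surjective π := Ideal.Quotient.mkₐ_surjective K _
  have hψ : Function.Surjective ψ :=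
    φ.symm.surjective.comp (Ideal.Quotient.mkₐ_surjective K _)
  have hπ0 : ∀ r, π r = 0 ↔ r ∈ socle A := fun r => Ideal.Quotient.eq_zero_iff_mem
  have hψ0 : ∀ r, ψ r = 0 ↔ r ∈ socle (WeightedAlgebra m c) := fun r => by
    change φ.symm (π₀ r) = 0 ↔ _
    rw [EmbeddingLike.map_eq_zero_iff]
    exact Ideal.Quotient.eq_zero_iff_mem
  let ε₁ := Ideal.Quotient.liftₐ (socle (WeightedAlgebra m c)) ε₀
    fun s hs => socle_le_ker hεe hεx hs
  let ε : A →ₐ[K] (Q.Vertex → K) := (ε₁.comp (φ : _ →ₐ[K] _)).comp π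
  have hε₁ : ∀ r, ε₁ (φ (ψ r)) = ε₀ r := fun r => by
    change ε₁ (φ (φ.symm (π₀ r))) = _
    rw [φ.apply_symm_apply]
    rfl
  have hεψ : ∀ y r, π y = ψ r → ε y = ε₀ r := fun y r h => by
    rw [← hε₁, ← h]
    rfl
  have hS1 : (1 : A) ∉ socle A := fun h => by
    have h1 := (hψ0 1).mp (by rw [map_one, ← map_one π]; exact (hπ0 1).mpr h)
    have h2 := socle_le_ker hεe hεx h1
    rw [map_one] at h2
    exact one_ne_zero h2
  have hSS : ∀ s ∈ socle A, ∀ t ∈ socle A, s * t = 0 := fun s hs t ht =>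
    hB.socle_mul_socle hind hS1 hs ht
  have hSε : ∀ s ∈ socle A, ε s = 0 := fun s hs => by
    rw [hεψ s 0 (by rw [map_zero, (hπ0 s).mpr hs]), map_zero]
  have hker : Submodule.map π.toLinearMap (LinearMap.ker ε.toLinearMap) ≤
      Submodule.map ψ.toLinearMap (LinearMap.ker ε₀.toLinearMap) := by
    rintro _ ⟨n, hn, rfl⟩
    obtain ⟨r, hr⟩ := hψ (π n)
    refine ⟨r, ?_, hr⟩
    have := hεψ n r hr.symm
    rw [SetLike.mem_coe, LinearMap.mem_ker, AlgHom.toLinearMap_apply] at hn ⊢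
    rw [← this, hn]
  have hker' : Submodule.map ψ.toLinearMap (LinearMap.ker ε₀.toLinearMap) ≤
      Submodule.map π.toLinearMap (LinearMap.ker ε.toLinearMap) := by
    rintro _ ⟨r, hr, rfl⟩
    obtain ⟨n, hn⟩ := hπ (ψ r)
    refine ⟨n, ?_, hn⟩
    have := hεψ n r hn
    rw [SetLike.mem_coe, LinearMap.mem_ker, AlgHom.toLinearMap_apply] at hr ⊢
    rw [this, hr]
  -- The k-th power vanishes in A/soc(A), hence lies in the socle, whose square is zero.
  have hnil : LinearMap.ker ε.toLinearMap ^ (k + k) = ⊥ := by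
    have h1 : LinearMap.ker ε.toLinearMap ^ k ≤ (socle A).restrictScalars K := by
      intro n hn
      have h2 : π n ∈ Submodule.map π.toLinearMap (LinearMap.ker ε.toLinearMap ^ k) :=
        ⟨n, hn, rfl⟩
      rw [Submodule.map_pow] at h2
      have h3 := pow_le_pow_left' hker k h2
      rw [← Submodule.map_pow, hN, Submodule.map_bot, Submodule.mem_bot, hπ0] at h3
      exact h3
    rw [pow_add, eq_bot_iff]
    refine Submodule.mul_le.mpr fun s hs t ht => ?_
    rw [Submodule.mem_bot]
    exact hSS s (h1 hs) t (h1 ht)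
  obtain ⟨e, he, heψ⟩ := CompleteOrthogonalIdempotents.lift_of_isNilpotent_ker
    (π : A →+* A ⧸ socle A)
    (fun s hs => ⟨2, by
      rw [sq]
      exact hSS s ((hπ0 s).mp hs) s ((hπ0 s).mp hs)⟩)
    (hL.complete.map (ψ : WeightedAlgebra m c →+* A ⧸ socle A))
    (fun i => hπ _)
  have heψ : ∀ i, π (e i) = ψ (vertex m c 0 i) := fun i => congrFun heψ i
  have hεe' : ∀ i, ε (e i) = Pi.single i 1 := fun i => by rw [hεψ _ _ (heψ i), hεe]
  choose w hw using fun a => hπ (ψ (arrow m c 0 a))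
  let x : Q.Arrow → A := fun a => e (Q.src a) * w a * e (Q.tgt a)
  have hx : ∀ a, π (x a) = ψ (arrow m c 0 a) := fun a => by
    rw [map_mul, map_mul, heψ, heψ, hw, ← map_mul, ← map_mul, hL.src_mul, hL.mul_tgt]
  have hle := hB.socle_le_sq he hεe' hnil hind
  refine ⟨ε, ψ, e, x,
    { complete := he
      src_mul := fun a => by simp only [x, ← mul_assoc, he.idem _ |>.eq]
      mul_tgt := fun a => by simp only [x, mul_assoc, he.idem _ |>.eq]
      form := hB
      aug := hεe'
      aug_arrow := fun a => by rw [hεψ _ _ (hx a), hεx]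
      nilpotent := ⟨_, hnil⟩
      socle_le := hle
      ker_le := ?_
      map_eq_zero_iff := hψ0
      mk_mul := fun a b => by
        rw [map_mul ψ, ← hx, ← hx]
        exact map_mul π _ _
      map_mul_mk := fun a b => by
        rw [map_mul ψ, ← hx, ← hx] }, hx⟩
  intro n hn
  obtain ⟨r, hr, hrn⟩ := hker ⟨n, hn, rfl⟩
  obtain ⟨y, hy, z, hz, rfl⟩ := Submodule.mem_sup.mp (WeightedAlgebra.ker_le_span_sup_sq hεe hεx hr)
  have hy' : ψ y ∈ Submodule.map π.toLinearMap (Submodule.span K (Set.range x)) := by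
    have h1 : ψ y ∈ Submodule.map ψ.toLinearMap (Submodule.span K (Set.range (arrow m c 0))) :=
      ⟨y, hy, rfl⟩
    rw [Submodule.map_span, ← Set.range_comp] at h1 ⊢
    convert h1 using 3
    exact funext hx
  have hz' : ψ z ∈ Submodule.map π.toLinearMap (LinearMap.ker ε.toLinearMap ^ 2) := by
    rw [Submodule.map_pow]
    refine pow_le_pow_left' hker' 2 ?_
    rw [← Submodule.map_pow]
    exact ⟨z, hz, rfl⟩
  obtain ⟨y', hy', hyy⟩ := hy'
  obtain ⟨z', hz', hzz⟩ := hz'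
  have hs : n - (y' + z') ∈ socle A := by
    rw [← hπ0, map_sub, map_add]
    have h1 : ψ (y + z) = π n := hrn
    have h2 : π y' = ψ y := hyy
    have h3 : π z' = ψ z := hzz
    rw [h2, h3, ← map_add, h1, sub_self]
  have hn' : n = y' + (z' + (n - (y' + z'))) := by abel
  rw [hn']
  exact Submodule.add_mem_sup hy' (Submodule.add_mem _ hz' (hle hs))

end Existence

end TriangulationQuiver

namespace TriangulationQuiver

universe u v

open FDAlgebra SocleDeformedAlgebra

theorem WeightFunction.gProd_len {Q : TriangulationQuiver} {R : Type u} [Ring R]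
    (m : Q.WeightFunction) (z : Q.Arrow → R) (a : Q.Arrow) :
    gProd z a (m.len a) = gProd z a (m.len a - 1) * z (Q.f (Q.f (Q.bar a))) := by
  have := m.two_le_len a
  rw [← m.iterate_g_len_sub_one, ← gProd_succ, Nat.sub_add_cancel (by omega)]

/-! ### Zero relations and nonvanishing of B_α in the symmetric algebra. -/

namespace IsSocleLift

variable {Q : TriangulationQuiver} {K : Type v} [Field K] {A : Type u} [Ring A]
  [Algebra K A] [DecidableEq Q.Vertex] {m : Q.WeightFunction} {c : Q.ParameterFunction K}
  {B : LinearMap.BilinForm K A} {ε : A →ₐ[K] (Q.Vertex → K)}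
  {ψ : WeightedAlgebra m c →ₐ[K] A ⧸ socle A} {e : Q.Vertex → A} {x : Q.Arrow → A}
  (h : IsSocleLift m c B ε ψ e x)
include h

theorem mem_socle_of_mk_eq {p : A} {r : WeightedAlgebra m c}
    (hp : Ideal.Quotient.mkₐ K (socle A) p = ψ r) (hr : r ∈ socle (WeightedAlgebra m c)) :
    p ∈ socle A := by
  rw [← Ideal.Quotient.eq_zero_iff_mem]
  exact hp.trans ((h.map_eq_zero_iff r).mpr hr)

theorem mem_socle_of_mk_eq' {p : A} {r : WeightedAlgebra m c}
    (hp : Ideal.Quotient.mkₐ K (socle A) p = ψ r) (hr : p ∈ socle A) :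
    r ∈ socle (WeightedAlgebra m c) := by
  rw [← h.map_eq_zero_iff, ← hp]
  exact Ideal.Quotient.eq_zero_iff_mem.mpr hr

theorem sub_mem_socle {p q : A} {r : WeightedAlgebra m c}
    (hp : Ideal.Quotient.mkₐ K (socle A) p = ψ r) (hq : Ideal.Quotient.mkₐ K (socle A) q = ψ r) :
    p - q ∈ socle A :=
  h.mem_socle_of_mk_eq (r := 0) (by rw [map_sub, hp, hq, sub_self, map_zero]) (Ideal.zero_mem _)

theorem socle_mul {s n : A} (hs : s ∈ socle A) (hn : ε n = 0) : s * n = 0 := by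
  obtain ⟨k, hN⟩ := h.nilpotent
  exact mul_eq_zero_of_mem_socle hN hs hn

theorem mul_socle {s n : A} (hn : ε n = 0) (hs : s ∈ socle A) : n * s = 0 := by
  obtain ⟨k, hN⟩ := h.nilpotent
  exact h.form.mul_socle_eq_zero hN hn hs

theorem eq_zero_of_ne {s : A} (hs : s ∈ socle A) {i j : Q.Vertex} (hi : e i * s = s)
    (hj : s * e j = s) (hij : i ≠ j) : s = 0 := by
  obtain ⟨k, hN⟩ := h.nilpotent
  rw [← hj, ← hi]
  exact h.form.e_mul_mul_e_eq_zero h.aug hN hs hij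

theorem mk_mul_mul (a b d : Q.Arrow) :
    Ideal.Quotient.mkₐ K (socle A) (x a * x b * x d) =
      ψ (arrow m c 0 a * arrow m c 0 b * arrow m c 0 d) := by
  rw [map_mul, h.mk_mul, map_mul ψ, mul_assoc, h.map_mul_mk, ← map_mul ψ, ← mul_assoc]

/-- Length one is excluded because a later correction of the lifts may change single arrows by
elements outside the socle; only products of arrows stay controlled. -/
theorem mk_gProd (a : Q.Arrow) {l : ℕ} (hl : 2 ≤ l) :
    Ideal.Quotient.mkₐ K (socle A) (gProd x a l) = ψ (gProd (arrow m c 0) a l) := by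
  induction l, hl using Nat.le_induction with
  | base => rw [gProd_two, gProd_two, h.mk_mul]
  | succ l hl ih =>
    obtain ⟨l, rfl⟩ := Nat.exists_eq_add_of_le' hl
    rw [gProd_succ, map_mul, ih, gProd_succ (arrow m c 0) a (l + 1 + 1),
      gProd_succ (arrow m c 0) a (l + 1), map_mul ψ, mul_assoc, h.map_mul_mk, ← map_mul ψ,
      ← mul_assoc]

theorem aug_gProd (a : Q.Arrow) {l : ℕ} (hl : l ≠ 0) : ε (gProd x a l) = 0 := by
  obtain ⟨l, rfl⟩ := Nat.exists_eq_succ_of_ne_zero hl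
  rw [gProd_succ, map_mul, h.aug_arrow, mul_zero]

theorem gProd_len_mem_socle (a : Q.Arrow) : gProd x a (m.len a) ∈ socle A := by
  obtain ⟨ε₀, hεe, hεx⟩ := exists_augmentation m c (0 : Q.BorderFunction K)
  exact h.mem_socle_of_mk_eq (h.mk_gProd a (m.two_le_len a))
    (TriangulationQuiver.gProd_len_mem_socle hεe hεx a)

theorem ker_le_mul_top (k : ℕ) : LinearMap.ker ε.toLinearMap ≤
    Submodule.span K (Set.range x) * ⊤ ⊔ LinearMap.ker ε.toLinearMap ^ (k + 1) := by
  induction k with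
  | zero => rw [zero_add, pow_one]; exact le_sup_right
  | succ k ih =>
    refine ih.trans (sup_le le_sup_left ?_)
    rw [pow_succ']
    refine (mul_le_mul' h.ker_le le_rfl).trans ?_
    rw [Submodule.sup_mul, ← pow_add]
    refine sup_le ?_ ?_
    · exact (mul_le_mul' le_rfl le_top).trans le_sup_left
    · rw [show k + 1 + 1 = 2 + k by ring]
      exact le_sup_right

theorem mem_socle_of_mul_arrow_eq_zero {p : A} (hp : ∀ a, p * x a = 0) : p ∈ socle A := by
  obtain ⟨k, hN⟩ := h.nilpotent
  refine mem_socle_of_mul_eq_zero h.complete h.aug fun n hn => ?_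
  have hn' := h.ker_le_mul_top k hn
  rw [pow_succ, hN, Submodule.bot_mul, sup_bot_eq] at hn'
  clear hn
  induction hn' using Submodule.mul_induction_on' with
  | mem_mul_mem y hy z _ =>
    rw [← mul_assoc]
    convert zero_mul z
    induction hy using Submodule.span_induction with
    | mem y hy => obtain ⟨a, rfl⟩ := hy; exact hp a
    | zero => exact mul_zero p
    | add y y' _ _ h h' => rw [mul_add, h, h', add_zero]
    | smul t y _ h => rw [mul_smul_comm, h, smul_zero]
  | add y _ y' _ h h' => rw [mul_add, h, h', add_zero]

/-- The path `B_α` does not vanish, if `A_α` can be continued only along its `g`-cycle. -/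
theorem gProd_len_ne_zero {a : Q.Arrow} (ha : m.len a ≠ 2) (hE : ¬ m.IsExceptional a)
    (ht : Q.tgt (Q.g (Q.f (Q.bar a))) ≠ Q.src a)
    (hB : gProd (arrow m c 0) a (m.len a) ≠ 0) : gProd x a (m.len a) ≠ 0 := by
  intro h0
  have h3 := m.three_le_len ha
  have hl : m.len a - 1 ≠ 0 := by omega
  have hsrc : gProd x a (m.len a - 1) * e (Q.src (Q.f (Q.f (Q.bar a)))) =
      gProd x a (m.len a - 1) := by
    rw [← m.iterate_g_len_sub_one]
    exact h.gProd_mul_src a hl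
  -- If B_α = 0, every arrow kills A_α: the turning arrow gives a socle element between different
  -- vertices. Then A_α is in the socle of Λ as well, which forces B_α = 0 there.
  have hA : gProd x a (m.len a - 1) ∈ socle A := by
    refine h.mem_socle_of_mul_arrow_eq_zero fun y => ?_
    by_cases hy : Q.src y = Q.src (Q.f (Q.f (Q.bar a)))
    · rcases Q.eq_or_eq_bar _ y hy with rfl | rfl
      · rw [← m.gProd_len, h0]
      · obtain ⟨k, hk, hk'⟩ := (WeightedAlgebra.isSolution m c).gProd_len_sub_one_mul a
        have hk0 : k = 0 := by
          by_contra hk0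
          exact hE (hk' hk0)
        rw [hk0, zero_smul] at hk
        have hm : gProd x a (m.len a - 1) * x (Q.g (Q.f (Q.bar a))) ∈ socle A := by
          refine h.mem_socle_of_mk_eq (r := 0) ?_ (Ideal.zero_mem _)
          obtain ⟨l, hl'⟩ : ∃ l, m.len a - 1 = l + 1 := ⟨m.len a - 2, by omega⟩
          rw [← hk, map_mul, h.mk_gProd a (by omega), hl', gProd_succ, map_mul ψ, mul_assoc,
            h.map_mul_mk, ← map_mul ψ, ← mul_assoc]
        refine h.eq_zero_of_ne hm (i := Q.src a) ?_ ?_ ht.symm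
        · rw [← mul_assoc, h.src_mul_gProd a hl]
        · rw [mul_assoc]
          exact congrArg _ (h.mul_tgt _)
    · exact h.mul_eq_zero hsrc (h.src_mul y) (Ne.symm hy)
  have hΛ := h.mem_socle_of_mk_eq' (h.mk_gProd a (by omega)) hA
  obtain ⟨ε₀, hεe, hεx⟩ := exists_augmentation m c (0 : Q.BorderFunction K)
  obtain ⟨k, hN⟩ := WeightedAlgebra.exists_ker_pow_eq_bot hεe hεx
  refine hB ?_
  rw [m.gProd_len]
  exact mul_eq_zero_of_mem_socle hN hΛ (hεx _)

theorem gProd_len_ne_zero_of_loop {a : Q.Arrow} (ha : Q.tgt a = Q.src a)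
    (hb : ¬ Q.IsBorderLoop a) (h1 : m.len a ≠ 2) : gProd x a (m.len a) ≠ 0 := by
  have h2 := len_bar_ne_two_of_loop m ha hb
  have h3 := f_eq_bar_of_loop ha hb
  have h4 : Q.g (Q.f (Q.bar a)) = Q.bar a := by rw [← h3, g_f_f, h3]
  refine h.gProd_len_ne_zero h1 ?_ ?_ (TriangulationQuiver.gProd_len_ne_zero_of_loop m c ha hb h1)
  · rintro (h5 | ⟨h5, -⟩)
    · exact h1 h5
    · exact h2 (by rwa [← h3])
  · rw [h4]
    exact not_loop_bar ha

theorem gProd_len_ne_zero_of_border {a : Q.Arrow} (ha : Q.IsBorderLoop a) :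
    gProd x (Q.bar a) (m.len (Q.bar a)) ≠ 0 := by
  have h2 : m.len (Q.bar a) ≠ 2 := by
    rw [m.len_border ha]; exact m.len_border_ne_two ha
  have h4 : Q.g (Q.f (Q.bar (Q.bar a))) = Q.bar a := by
    rw [bar_bar, show Q.f a = a from ha, ha.g_eq]
  refine h.gProd_len_ne_zero h2 ?_ ?_ ?_
  · rintro (h5 | ⟨h5, h6⟩)
    · exact h2 h5
    · have := four_le_len_of_border m ha h5
      rw [m.len_border ha] at h6
      omega
  · rw [h4, Q.src_bar]
    exact not_loop_bar ha.tgt_eq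
  · have h5 := (WeightedAlgebra.isSolution m c).smul_gProd_len_bar a
    intro h0
    rw [h0, smul_zero] at h5
    exact TriangulationQuiver.gProd_len_ne_zero_of_border m c ha
      ((smul_eq_zero.mp h5.symm).resolve_left (c.c_ne_zero a))

/-- The zero relations `α f(α) g(f(α)) = 0` hold in the symmetric algebra. -/
theorem mul_f_g (a : Q.Arrow) (h1 : m.len (Q.bar a) ≠ 2)
    (h2 : ¬ (m.len (Q.f (Q.bar a)) = 2 ∧ m.len (Q.bar a) = 3)) :
    x a * x (Q.f a) * x (Q.g (Q.f a)) = 0 := by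
  have hmem : ∀ {b}, m.len (Q.bar b) ≠ 2 →
      ¬ (m.len (Q.f (Q.bar b)) = 2 ∧ m.len (Q.bar b) = 3) →
      x b * x (Q.f b) * x (Q.g (Q.f b)) ∈ socle A := fun {b} hb hb' =>
    h.mem_socle_of_mk_eq (r := 0)
      (by rw [h.mk_mul_mul, (WeightedAlgebra.isSolution m c).mul_f_g b hb hb'])
      (Ideal.zero_mem _)
  have hs : e (Q.src a) * (x a * x (Q.f a) * x (Q.g (Q.f a))) =
      x a * x (Q.f a) * x (Q.g (Q.f a)) := by
    rw [mul_assoc (x a), ← mul_assoc, h.src_mul]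
  by_cases ht : Q.tgt (Q.g (Q.f a)) = Q.src a
  swap
  · exact h.eq_zero_of_ne (hmem h1 h2) hs (by rw [mul_assoc, h.mul_tgt]) (Ne.symm ht)
  have hg : Q.g (Q.f a) = Q.f (Q.f (Q.bar a)) :=
    ((tgt_eq_src_iff a _).mp ht).resolve_left (g_ne_f _)
  -- Length three would give g(g(ᾱ)) = f²(α) = g(f(ᾱ)), hence g(ᾱ) = f(ᾱ).
  have hlen : 4 ≤ m.len (Q.bar a) := by
    have h3 := m.three_le_len h1
    rcases h3.eq_or_lt with h3 | h3
    · exfalso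
      have h4 := m.g_g_g_of_len_eq_three h3.symm
      have h5 : Q.g (Q.g (Q.bar a)) = Q.f (Q.f a) := g_injective (by rw [h4, g_f_f])
      have h6 : Q.g (Q.f (Q.bar a)) = Q.f (Q.f a) := by
        rw [g, ← hg, bar_g]
      exact g_ne_f _ (g_injective (h5.trans h6.symm))
    · exact h3
  obtain ⟨k, hN⟩ := h.nilpotent
  refine h.form.eq_zero_of_mem_socle h.complete h.aug hN (hmem h1 h2) hs ?_
  have hD : x a * x (Q.f a) - c.c (Q.bar a) • gProd x (Q.bar a) (m.len (Q.bar a) - 1) ∈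
      socle A := by
    refine h.sub_mem_socle (h.mk_mul _ _) ?_
    rw [map_smul, h.mk_gProd _ (by omega), (WeightedAlgebra.isSolution m c).mul_f', map_smul]
  have h3 := h.socle_mul hD (h.aug_arrow (Q.g (Q.f a)))
  rw [sub_mul, sub_eq_zero] at h3
  obtain ⟨l, hl⟩ : ∃ l, m.len (Q.bar a) - 1 = 1 + (1 + l) := ⟨m.len (Q.bar a) - 3, by omega⟩
  -- This is a cyclic rotation of the product, after replacing x_α x_{f(α)} by c_ᾱ A_ᾱ. Its first
  -- three factors form the zero relation at g(f(α)), hence lie in the socle, and A_ᾱ has at least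
  -- one more arrow, which kills them.
  have h4 : x (Q.g (Q.f a)) * gProd x (Q.bar a) (m.len (Q.bar a) - 1) = 0 := by
    have hf : Q.bar a = Q.f (Q.g (Q.f a)) := by rw [hg, Q.f_f_f]
    have hbar : Q.bar (Q.g (Q.f a)) = Q.f (Q.f a) := bar_g _
    rw [hl, gProd_add, gProd_add, gProd_one, gProd_one, Function.iterate_one, ← mul_assoc,
      ← mul_assoc]
    refine h.socle_mul ?_ (h.aug_gProd _ (by omega))
    have h5 := @hmem (Q.g (Q.f a)) ?_ ?_
    · rwa [← hf] at h5
    · rw [bar_g, m.len_f_f]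
      exact h1
    · rintro ⟨-, h6⟩
      rw [bar_g, m.len_f_f] at h6
      omega
  rw [h3, smul_mul_assoc, map_smul, LinearMap.smul_apply, h.form.apply_mul_one, h.form.symm,
    ← h.form.apply_mul_one, h4, map_zero, LinearMap.zero_apply, smul_zero]

/-- The zero relations `α g(α) f(g(α)) = 0` hold in the symmetric algebra. -/
theorem mul_g_f (a : Q.Arrow) (h1 : m.len (Q.f a) ≠ 2)
    (h2 : ¬ (m.len (Q.bar a) = 2 ∧ m.len (Q.f a) = 3)) :
    x a * x (Q.g a) * x (Q.f (Q.g a)) = 0 := by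
  have hmem : x a * x (Q.g a) * x (Q.f (Q.g a)) ∈ socle A :=
    h.mem_socle_of_mk_eq (r := 0)
      (by rw [h.mk_mul_mul, (WeightedAlgebra.isSolution m c).mul_g_f a h1 h2])
      (Ideal.zero_mem _)
  have hs : e (Q.src a) * (x a * x (Q.g a) * x (Q.f (Q.g a))) =
      x a * x (Q.g a) * x (Q.f (Q.g a)) := by
    rw [mul_assoc (x a), ← mul_assoc, h.src_mul]
  by_cases ht : Q.tgt (Q.f (Q.g a)) = Q.src a
  swap
  · exact h.eq_zero_of_ne hmem hs (by rw [mul_assoc, h.mul_tgt]) (Ne.symm ht)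
  have hg : Q.g a = Q.f (Q.bar a) := by
    have h3 := (tgt_eq_src_iff a _).mp ht
    exact Q.f.injective (h3.resolve_left fun h' => g_ne_f _ (Q.f.injective h'))
  have hbar : Q.bar (Q.f (Q.bar a)) = Q.f a := by rw [← hg, bar_g]
  -- The rotated path has the form β f(β) g(f(β)) with β = f(ᾱ) = g(α), so it is a zero relation of
  -- the other kind.
  have h3 : x (Q.g a) * x (Q.f (Q.g a)) * x a = 0 := by
    have h4 := h.mul_f_g (Q.f (Q.bar a)) (by rwa [hbar]) ?_
    · rwa [g_f_f_bar, ← hg] at h4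
    · rw [hbar, m.len_f_f]
      exact h2
  obtain ⟨k, hN⟩ := h.nilpotent
  refine h.form.eq_zero_of_mem_socle h.complete h.aug hN hmem hs ?_
  rw [mul_assoc, h.form.apply_mul_one, h.form.symm, ← h.form.apply_mul_one, h3, map_zero,
    LinearMap.zero_apply]

end IsSocleLift

end TriangulationQuiver

namespace TriangulationQuiver

universe u v

open FDAlgebra SocleDeformedAlgebra

/-! ### Arrows following a loop fixed by g. -/

section FoldedLoops

variable {Q : TriangulationQuiver}

/-- The arrow `α` is `f(ρ)` for a loop `ρ`, which is not virtual and not a border loop. -/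
def WeightFunction.FollowsLoop (m : Q.WeightFunction) (a : Q.Arrow) : Prop :=
  Q.tgt (Q.bar a) = Q.src (Q.bar a) ∧ ¬ Q.IsBorderLoop (Q.bar a) ∧ m.len (Q.bar a) ≠ 2

theorem gProd_of_fixed {R : Type u} [Ring R] (x : Q.Arrow → R) {a : Q.Arrow} (ha : Q.g a = a)
    (l : ℕ) : gProd x a l = x a ^ l := by
  induction l with
  | zero => rw [gProd_zero, pow_zero]
  | succ l ih => rw [gProd_succ, Function.iterate_fixed ha, ih, pow_succ]

namespace WeightFunction.FollowsLoop

variable {m : Q.WeightFunction} {a : Q.Arrow} (h : m.FollowsLoop a)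
include h

theorem g_bar : Q.g (Q.bar a) = Q.bar a := g_eq_of_loop h.1 h.2.1

theorem f_bar : Q.f (Q.bar a) = a := by rw [f_eq_bar_of_loop h.1 h.2.1, bar_bar]

theorem f_f : Q.f (Q.f a) = Q.bar a := by
  apply Q.f.injective
  rw [Q.f_f_f, h.f_bar]

theorem len_ne_two : m.len a ≠ 2 := by
  have := len_bar_ne_two_of_loop m h.1 h.2.1
  rwa [bar_bar] at this

theorem len_f_ne_two : m.len (Q.f a) ≠ 2 := by
  have := m.len_f_f (Q.bar a)
  rw [h.f_bar, bar_bar] at this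
  rw [this]
  exact h.len_ne_two

theorem not_loop : Q.tgt a ≠ Q.src a := by
  have := not_loop_bar h.1
  rwa [bar_bar, Q.src_bar] at this

theorem not_bar : ¬ m.FollowsLoop (Q.bar a) := fun h' => by
  have := h'.1
  rw [bar_bar] at this
  exact h.not_loop this

theorem not_f : ¬ m.FollowsLoop (Q.f a) := fun h' => by
  have h1 := Q.f.injective h'.f_bar
  have h2 := h'.1
  rw [h1] at h2
  exact h.not_loop h2

variable {K : Type v} [Field K] (c : Q.ParameterFunction K)

/-- With ρ = ᾱ, the path ρ α continues along f(α) to a multiple of B_ρ and along g(α) to a zero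
relation. Together with its left version, this allows adding multiples of x_ρ x_α to x_α without
changing products of arrows modulo the socle. -/
theorem mul_mul_arrow_mem_socle (y : Q.Arrow) :
    arrow m c 0 (Q.bar a) * arrow m c 0 a * arrow m c 0 y ∈ socle (WeightedAlgebra m c) := by
  classical
  obtain ⟨ε₀, hεe, hεx⟩ := exists_augmentation m c (0 : Q.BorderFunction K)
  have hs := WeightedAlgebra.isSolution m c
  by_cases hy : Q.tgt a = Q.src y
  · rcases (tgt_eq_iff a y).mp hy with rfl | rfl
    · have h1 := hs.smul_gProd_len' (Q.bar a)
      rw [h.f_bar] at h1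
      rw [← h1]
      exact Submodule.smul_of_tower_mem (socle _) _ (gProd_len_mem_socle hεe hεx _)
    · have h1 := hs.mul_f_g (Q.bar a) (by rw [bar_bar]; exact h.len_ne_two)
        (by rw [bar_bar]; exact fun h' => h.len_f_ne_two h'.1)
      rw [h.f_bar] at h1
      rw [h1]
      exact Ideal.zero_mem _
  · rw [mul_assoc, hs.mul_arrow_eq_zero hy, mul_zero]
    exact Ideal.zero_mem _

theorem arrow_mul_mul_mem_socle (y : Q.Arrow) :
    arrow m c 0 y * arrow m c 0 (Q.bar a) * arrow m c 0 a ∈ socle (WeightedAlgebra m c) := by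
  classical
  obtain ⟨ε₀, hεe, hεx⟩ := exists_augmentation m c (0 : Q.BorderFunction K)
  have hs := WeightedAlgebra.isSolution m c
  by_cases hy : Q.tgt y = Q.src (Q.bar a)
  · rcases (tgt_eq_src_iff (Q.bar a) y).mp hy with rfl | rfl
    · have h1 := hs.smul_gProd_len' (Q.f a)
      rw [h.f_f, h.f_bar] at h1
      rw [h.f_bar, ← h1]
      exact Submodule.smul_of_tower_mem (socle _) _ (gProd_len_mem_socle hεe hεx _)
    · have h1 := hs.mul_g_f (Q.bar a) (by rw [h.f_bar]; exact h.len_ne_two)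
        (by rw [bar_bar]; exact fun h' => h.len_ne_two h'.1)
      rw [h.g_bar, h.f_bar] at h1
      rw [bar_bar, h.f_f, h1]
      exact Ideal.zero_mem _
  · rw [hs.mul_arrow_eq_zero hy, zero_mul]
    exact Ideal.zero_mem _

end WeightFunction.FollowsLoop

end FoldedLoops

/-! ### Correcting the lifts of the arrows. -/

namespace IsSocleLift

variable {Q : TriangulationQuiver} {K : Type v} [Field K] {A : Type u} [Ring A]
  [Algebra K A] [DecidableEq Q.Vertex] {m : Q.WeightFunction} {c : Q.ParameterFunction K}
  {B : LinearMap.BilinForm K A} {ε : A →ₐ[K] (Q.Vertex → K)}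
  {ψ : WeightedAlgebra m c →ₐ[K] A ⧸ socle A} {e : Q.Vertex → A} {x : Q.Arrow → A}
  (h : IsSocleLift m c B ε ψ e x)
include h

theorem congr {x' : Q.Arrow → A} (hp : IsPathSystem e x')
    (hsq : ∀ a, x a - x' a ∈ LinearMap.ker ε.toLinearMap ^ 2)
    (hmul : ∀ a b, Ideal.Quotient.mkₐ K (socle A) (x' a * x' b) =
      Ideal.Quotient.mkₐ K (socle A) (x a * x b))
    (hmk : ∀ a b, ψ (arrow m c 0 a) * Ideal.Quotient.mkₐ K (socle A) (x' b) =
      ψ (arrow m c 0 a) * Ideal.Quotient.mkₐ K (socle A) (x b)) :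
    IsSocleLift m c B ε ψ e x' where
  toIsPathSystem := hp
  form := h.form
  aug := h.aug
  aug_arrow a := by
    have h1 : LinearMap.ker ε.toLinearMap ^ 2 ≤ LinearMap.ker ε.toLinearMap := by
      rw [sq]
      exact Submodule.mul_le.mpr fun y hy z _ => mul_mem_ker ε hy z
    have h2 : ε (x a - x' a) = 0 := h1 (hsq a)
    rw [map_sub, h.aug_arrow, zero_sub, neg_eq_zero] at h2
    exact h2
  nilpotent := h.nilpotent
  socle_le := h.socle_le
  ker_le := by
    refine h.ker_le.trans (sup_le ?_ le_sup_right)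
    rw [Submodule.span_le]
    rintro _ ⟨a, rfl⟩
    rw [← add_sub_cancel (x' a) (x a)]
    exact Submodule.add_mem_sup (Submodule.subset_span ⟨a, rfl⟩) (hsq a)
  map_eq_zero_iff := h.map_eq_zero_iff
  mk_mul a b := by rw [hmul, h.mk_mul]
  map_mul_mk a b := by rw [hmk, h.map_mul_mk]

theorem mem_ker_sq_of_mul (a b : Q.Arrow) : x a * x b ∈ LinearMap.ker ε.toLinearMap ^ 2 := by
  rw [sq]
  exact Submodule.mul_mem_mul (h.aug_arrow a) (h.aug_arrow b)

/-- The defect lies in the one-dimensional space e_i soc(A), which is spanned by the nonzero B_ρ for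
the loop ρ = ᾱ. As g fixes ρ, the paths are powers of x_ρ. -/
theorem exists_coeff_of_followsLoop {a : Q.Arrow} (ha : m.FollowsLoop a) :
    ∃ t : K, x a * x (Q.f a) = c.c (Q.bar a) • x (Q.bar a) ^ (m.len (Q.bar a) - 1) +
      (c.c (Q.bar a) * t) • x (Q.bar a) ^ m.len (Q.bar a) := by
  obtain ⟨k, hN⟩ := h.nilpotent
  have hl := m.three_le_len ha.2.2
  have hD : x a * x (Q.f a) - c.c (Q.bar a) • gProd x (Q.bar a) (m.len (Q.bar a) - 1) ∈
      socle A := by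
    refine h.sub_mem_socle (h.mk_mul _ _) ?_
    rw [map_smul, h.mk_gProd _ (by omega), (WeightedAlgebra.isSolution m c).mul_f', map_smul]
  obtain ⟨z, hz⟩ := h.form.eq_smul_of_mem_socle h.complete h.aug hN hD
    (h.gProd_len_mem_socle (Q.bar a)) (i := Q.src a)
    (by rw [mul_sub, ← mul_assoc, h.src_mul, mul_smul_comm, ← Q.src_bar a,
      h.src_mul_gProd _ (by omega)])
    (by rw [← Q.src_bar a, h.src_mul_gProd _ (by omega)])
    (h.gProd_len_ne_zero_of_loop ha.1 ha.2.1 ha.2.2)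
  refine ⟨(c.c (Q.bar a))⁻¹ * z, ?_⟩
  rw [mul_inv_cancel_left₀ (c.c_ne_zero _), ← gProd_of_fixed x ha.g_bar,
    ← gProd_of_fixed x ha.g_bar, ← hz]
  abel

/-- The arrows following loops can be chosen such that their relations hold exactly. -/
theorem exists_adjust_followsLoop :
    ∃ x' : Q.Arrow → A, IsSocleLift m c B ε ψ e x' ∧
      (∀ a, ¬ m.FollowsLoop a → x' a = x a) ∧
      ∀ a, m.FollowsLoop a → x' a * x' (Q.f a) =
        c.c (Q.bar a) • gProd x' (Q.bar a) (m.len (Q.bar a) - 1) := by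
  classical
  have ht : ∀ a, ∃ t : K, (¬ m.FollowsLoop a → t = 0) ∧ (m.FollowsLoop a →
      x a * x (Q.f a) = c.c (Q.bar a) • x (Q.bar a) ^ (m.len (Q.bar a) - 1) +
      (c.c (Q.bar a) * t) • x (Q.bar a) ^ m.len (Q.bar a)) := by
    intro a
    by_cases ha : m.FollowsLoop a
    · obtain ⟨t, ht⟩ := h.exists_coeff_of_followsLoop ha
      exact ⟨t, fun h' => absurd ha h', fun _ => ht⟩
    · exact ⟨0, fun _ => rfl, fun h' => absurd h' ha⟩
  choose t ht0 ht using ht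
  have hx : ∀ a, ¬ m.FollowsLoop a → x a - t a • (x (Q.bar a) * x a) = x a := fun a ha => by
    rw [ht0 a ha, zero_smul, sub_zero]
  have h1 : ∀ a b, Ideal.Quotient.mkₐ K (socle A) (t a • (x (Q.bar a) * x a * x b)) = 0 := by
    intro a b
    by_cases ha : m.FollowsLoop a
    · rw [map_smul, h.mk_mul_mul, (h.map_eq_zero_iff _).mpr (ha.mul_mul_arrow_mem_socle c b),
        smul_zero]
    · rw [ht0 a ha, zero_smul, map_zero]
  have h2 : ∀ a b, Ideal.Quotient.mkₐ K (socle A) (t b • (x a * x (Q.bar b) * x b)) = 0 := by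
    intro a b
    by_cases hb : m.FollowsLoop b
    · rw [map_smul, h.mk_mul_mul, (h.map_eq_zero_iff _).mpr (hb.arrow_mul_mul_mem_socle c a),
        smul_zero]
    · rw [ht0 b hb, zero_smul, map_zero]
  -- For ρ = ᾱ of length l this subtracts t c_ρ x_ρ^l from x_α x_{f(α)}, because x_ρ^{l+1} = 0. It
  -- is exactly the defect, while x_ρ and x_{f(α)} do not change.
  refine ⟨fun a => x a - t a • (x (Q.bar a) * x a), h.congr ?_ ?_ ?_ ?_, hx, fun a ha => ?_⟩
  · exact
    { complete := h.complete
      src_mul := fun a => by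
        have := h.src_mul (Q.bar a)
        rw [Q.src_bar] at this
        rw [mul_sub, mul_smul_comm, ← mul_assoc, h.src_mul, this]
      mul_tgt := fun a => by rw [sub_mul, smul_mul_assoc, mul_assoc, h.mul_tgt] }
  · intro a
    rw [sub_sub_cancel]
    exact Submodule.smul_mem _ _ (h.mem_ker_sq_of_mul _ _)
  · intro a b
    have h3 : (x a - t a • (x (Q.bar a) * x a)) * (x b - t b • (x (Q.bar b) * x b)) =
        x a * x b - t a • (x (Q.bar a) * x a * x b) - t b • (x a * x (Q.bar b) * x b) +
        t a • (x (Q.bar a) * x a * x (Q.bar b)) * (t b • x b) := by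
      simp only [sub_mul, mul_sub, smul_mul_assoc, mul_smul_comm, smul_sub, mul_assoc]
      abel
    rw [h3, map_add, map_sub, map_sub, h1, h2, map_mul _ (t a • _), h1, zero_mul, sub_zero,
      sub_zero, add_zero]
  · intro a b
    have h3 := h2 a b
    have h4 : ψ (arrow m c 0 a) * Ideal.Quotient.mkₐ K (socle A) (x (Q.bar b) * x b) =
        Ideal.Quotient.mkₐ K (socle A) (x a * x (Q.bar b) * x b) := by
      rw [h.mk_mul_mul, h.mk_mul, ← map_mul, mul_assoc]
    rw [map_sub, mul_sub, map_smul, mul_smul_comm, h4, ← map_smul, h3, sub_zero]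
  · have h3 : gProd (fun a => x a - t a • (x (Q.bar a) * x a)) (Q.bar a) (m.len (Q.bar a) - 1) =
        x (Q.bar a) ^ (m.len (Q.bar a) - 1) := by
      rw [gProd_of_fixed _ ha.g_bar, hx _ ha.not_bar]
    have hl : m.len (Q.bar a) = m.len (Q.bar a) - 1 + 1 := by
      have := m.two_le_len (Q.bar a)
      omega
    have h4 : x (Q.bar a) * x (Q.bar a) ^ m.len (Q.bar a) = 0 := by
      refine h.mul_socle (h.aug_arrow _) ?_
      rw [← gProd_of_fixed x ha.g_bar]
      exact h.gProd_len_mem_socle _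
    have h5 : x (Q.bar a) * x (Q.bar a) ^ (m.len (Q.bar a) - 1) =
        x (Q.bar a) ^ m.len (Q.bar a) := by
      rw [← pow_succ', ← hl]
    rw [h3]
    beta_reduce
    rw [hx _ ha.not_f, sub_mul, smul_mul_assoc, mul_assoc, ht a ha, mul_add, mul_smul_comm,
      mul_smul_comm, h4, h5, smul_zero, add_zero, smul_smul, mul_comm (t a)]
    abel

/-- Virtual arrows can be replaced by products of two arrows. -/
theorem exists_adjust_virtual
    (hv : ∀ a, m.len a = 2 → Ideal.Quotient.mkₐ K (socle A) (x a) = ψ (arrow m c 0 a)) :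
    ∃ x' : Q.Arrow → A, IsSocleLift m c B ε ψ e x' ∧ (∀ a, m.len a ≠ 2 → x' a = x a) ∧
      ∀ a, m.len (Q.bar a) = 2 → x' a * x' (Q.f a) = c.c (Q.bar a) • x' (Q.bar a) := by
  classical
  -- For virtual α the path A_α is α itself, so the relation at ᾱ dictates x_α. It holds modulo the
  -- socle already, so the lift changes only by a socle element.
  let x' : Q.Arrow → A := fun a =>
    if m.len a = 2 then (c.c a)⁻¹ • (x (Q.bar a) * x (Q.f (Q.bar a))) else x a
  have hx : ∀ a, m.len a ≠ 2 → x' a = x a := fun a ha => if_neg ha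
  have hx' : ∀ a, m.len a = 2 → x' a = (c.c a)⁻¹ • (x (Q.bar a) * x (Q.f (Q.bar a))) :=
    fun a ha => if_pos ha
  have hmk : ∀ a, Ideal.Quotient.mkₐ K (socle A) (x' a) = Ideal.Quotient.mkₐ K (socle A) (x a) := by
    intro a
    by_cases ha : m.len a = 2
    · have h1 := (WeightedAlgebra.isSolution m c).mul_f_of_len_eq_two (a := Q.bar a)
        (by rwa [bar_bar])
      rw [hv a ha, hx' a ha, map_smul, h.mk_mul, h1, bar_bar, map_smul, smul_smul,
        inv_mul_cancel₀ (c.c_ne_zero a), one_smul]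
    · rw [hx a ha]
  refine ⟨x', h.congr ?_ ?_ ?_ ?_, hx, fun a ha => ?_⟩
  · refine ⟨h.complete, fun a => ?_, fun a => ?_⟩
    · by_cases ha : m.len a = 2
      · have := h.src_mul (Q.bar a)
        rw [Q.src_bar] at this
        rw [hx' a ha, mul_smul_comm, ← mul_assoc, this]
      · rw [hx a ha, h.src_mul]
    · by_cases ha : m.len a = 2
      · have := h.mul_tgt (Q.f (Q.bar a))
        rw [← Q.src_f, m.f_f_bar_of_len_eq_two ha, src_g] at this
        rw [hx' a ha, smul_mul_assoc, mul_assoc, this]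
      · rw [hx a ha, h.mul_tgt]
  · intro a
    refine h.socle_le (Ideal.Quotient.eq_zero_iff_mem.mp ?_)
    exact (map_sub (Ideal.Quotient.mkₐ K (socle A)) _ _).trans (by rw [hmk, sub_self])
  · intro a b
    rw [map_mul, map_mul, hmk, hmk]
  · intro a b
    rw [hmk]
  · have h1 : m.len a ≠ 2 := by
      have := m.len_bar_ne_two_of_len ha
      rwa [bar_bar] at this
    have h2 : m.len (Q.f a) ≠ 2 := fun h2 => m.len_f_ne_two_of_len h2 (by rw [m.len_f_f, ha])
    rw [hx a h1, hx _ h2, hx' _ ha, smul_smul, mul_inv_cancel₀ (c.c_ne_zero _), one_smul, bar_bar]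

/-- Lifts of the arrows that satisfy the relations of a socle deformation exactly. -/
theorem exists_isSolution
    (hx : ∀ a, Ideal.Quotient.mkₐ K (socle A) (x a) = ψ (arrow m c 0 a)) :
    ∃ (x' : Q.Arrow → A) (b : Q.BorderFunction K), IsSocleLift m c B ε ψ e x' ∧
      IsSolution m c b e x' := by
  obtain ⟨x₁, h₁, hx₁, hF₁⟩ := h.exists_adjust_followsLoop
  obtain ⟨x₂, h₂, hx₂, hV⟩ := h₁.exists_adjust_virtual
    (fun a ha => by rw [hx₁ a fun h' => h'.len_ne_two ha, hx])
  have hF : ∀ a, m.FollowsLoop a → x₂ a * x₂ (Q.f a) =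
      c.c (Q.bar a) • gProd x₂ (Q.bar a) (m.len (Q.bar a) - 1) := fun a ha => by
    rw [hx₂ a ha.len_ne_two, hx₂ _ ha.len_f_ne_two, hF₁ a ha, gProd_of_fixed _ ha.g_bar,
      gProd_of_fixed _ ha.g_bar, hx₂ _ ha.2.2]
  have hD : ∀ a, m.len (Q.bar a) ≠ 2 →
      x₂ a * x₂ (Q.f a) - c.c (Q.bar a) • gProd x₂ (Q.bar a) (m.len (Q.bar a) - 1) ∈
        socle A := fun a ha => by
    have := m.three_le_len ha
    refine h₂.sub_mem_socle (h₂.mk_mul _ _) ?_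
    rw [map_smul, h₂.mk_gProd _ (by omega), (WeightedAlgebra.isSolution m c).mul_f', map_smul]
  have hDs : ∀ a, e (Q.src a) *
      (x₂ a * x₂ (Q.f a) - c.c (Q.bar a) • gProd x₂ (Q.bar a) (m.len (Q.bar a) - 1)) =
      x₂ a * x₂ (Q.f a) - c.c (Q.bar a) • gProd x₂ (Q.bar a) (m.len (Q.bar a) - 1) :=
    fun a => by
      have := m.two_le_len (Q.bar a)
      rw [mul_sub, ← mul_assoc, h₂.src_mul, mul_smul_comm, ← Q.src_bar a,
        h₂.src_mul_gProd _ (by omega)]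
  -- At a border vertex the defect is a multiple of the nonzero B_ᾱ; the coefficient becomes the
  -- value of the border function.
  have hb : ∀ i : Q.border, ∃ b : K, ∀ a, Q.IsBorderLoop a → Q.src a = i →
      x₂ a * x₂ a = c.c (Q.bar a) • gProd x₂ (Q.bar a) (m.len (Q.bar a) - 1) +
        b • gProd x₂ (Q.bar a) (m.len (Q.bar a)) := by
    rintro ⟨_, a, ha, rfl⟩
    have hl := m.two_le_len (Q.bar a)
    obtain ⟨k, hN⟩ := h.nilpotent
    obtain ⟨z, hz⟩ := h.form.eq_smul_of_mem_socle h.complete h.aug hN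
      (hD a (by rw [m.len_border ha]; exact m.len_border_ne_two ha))
      (h₂.gProd_len_mem_socle (Q.bar a)) (i := Q.src a) (hDs a)
      (by rw [← Q.src_bar a, h₂.src_mul_gProd _ (by omega)])
      (h₂.gProd_len_ne_zero_of_border ha)
    refine ⟨z, fun a' ha' hs => ?_⟩
    have haa : a' = a := by
      refine (Q.eq_or_eq_bar a a' hs).resolve_right fun h' => ?_
      subst h'
      have := ha'.tgt_eq
      rw [Q.src_bar] at this
      exact not_loop_bar ha.tgt_eq this
    subst haa
    rw [show Q.f a' = a' from ha', sub_eq_iff_eq_add] at hz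
    rw [hz, add_comm]
  choose b hb using hb
  refine ⟨x₂, b, h₂,
    { h₂.toIsPathSystem with
      mul_f := fun a ha => ?_
      border_sq := fun a ha => hb ⟨Q.src a, a, ha, rfl⟩ a ha rfl
      mul_f_g := h₂.mul_f_g
      mul_g_f := h₂.mul_g_f }⟩
  by_cases h2 : m.len (Q.bar a) = 2
  · rw [hV a h2, h2, gProd_one]
  -- The defect is a socle element from s(α) to t(f(α)). If these agree and α is not a border loop,
  -- then f²(α) = ᾱ is a loop, and the relation was made exact by the correction for loops.
  by_cases ht : Q.tgt (Q.f a) = Q.src a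
  · by_cases hl : m.FollowsLoop a
    · exact hF a hl
    · exfalso
      have h3 : Q.src (Q.f (Q.f a)) = Q.src a := by rw [Q.src_f, ht]
      have h4 : Q.f (Q.f a) = Q.bar a := by
        refine (Q.eq_or_eq_bar a _ h3).resolve_left fun h' => ha ?_
        have := Q.f_f_f a
        rw [h'] at this
        exact this
      refine hl ⟨?_, fun hbar => ?_, h2⟩
      · rw [← h4, tgt_f_f, h3]
      · have h5 : Q.f (Q.bar a) = Q.bar a := hbar
        rw [← h4, Q.f_f_f, h4] at h5
        exact Q.bar_ne a h5.symm
  · have hl := m.three_le_len h2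
    refine sub_eq_zero.mp (h₂.eq_zero_of_ne (hD a h2) (hDs a) (j := Q.tgt (Q.f a)) ?_
      (Ne.symm ht))
    have h3 := h₂.gProd_mul_src (Q.bar a) (l := m.len (Q.bar a) - 1) (by omega)
    rw [m.iterate_g_len_sub_one, bar_bar, Q.src_f] at h3
    rw [sub_mul, mul_assoc, h₂.mul_tgt, smul_mul_assoc, h3]

end IsSocleLift

end TriangulationQuiver

namespace TriangulationQuiver

universe u v

open FDAlgebra SocleDeformedAlgebra

/-! ### Border paths in a socle deformation. -/

section Border

variable {Q : TriangulationQuiver} {K : Type u} [Field K] {R : Type v} [Ring R] [Algebra K R]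
  {m : Q.WeightFunction} {c : Q.ParameterFunction K} {b : Q.BorderFunction K}
  {e : Q.Vertex → R} {x : Q.Arrow → R} (h : IsSolution m c b e x)
include h

namespace IsSolution

/-- At a border vertex, the path `B_ᾱ` is annihilated by all arrows. -/
theorem border_gProd_len_mul {a : Q.Arrow} (ha : Q.IsBorderLoop a) :
    (∀ y, gProd x (Q.bar a) (m.len (Q.bar a)) * x y = 0) ∧
      ∀ y, x y * gProd x (Q.bar a) (m.len (Q.bar a)) = 0 := by
  have hg : Q.g a = Q.bar a := ha.g_eq
  have hf : Q.f a = a := ha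
  have h2 := m.len_border_ne_two ha
  have hlen := m.len_border ha
  have hexc : ¬ (m.len (Q.f (Q.bar a)) = 2 ∧ m.len (Q.bar a) = 3) := by
    rintro ⟨h3, h4⟩
    have := four_le_len_of_border m ha h3
    omega
  have hαβ : x a * x a * x (Q.bar a) = 0 := by
    have := h.mul_f_g a (by rwa [hlen]) hexc
    rwa [hf, hg] at this
  have hγα : x (Q.f (Q.f (Q.bar a))) * x a * x a = 0 := by
    have h3 := h.mul_g_f (Q.f (Q.f (Q.bar a))) (by rwa [Q.f_f_f, hlen]) (by
      rw [Q.f_f_f, bar_f, m.len_g]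
      exact hexc)
    rwa [g_f_f_bar, hf] at h3
  have h3 := m.three_le_len h2
  obtain ⟨l, hl⟩ : ∃ l, m.len (Q.bar a) = l + 1 + 1 := ⟨m.len a - 2, by omega⟩
  have hγ : Q.g^[l] (Q.bar a) = Q.f (Q.f (Q.bar a)) := by
    apply g_injective
    rw [← Function.iterate_succ_apply' Q.g, g_f_f_bar]
    have := m.iterate_g_len_sub_one (Q.bar a)
    rwa [hl, Nat.add_sub_cancel, bar_bar, hf, hf] at this
  have hA : gProd x (Q.bar a) (l + 1 + 1) = gProd x (Q.bar a) (l + 1) * x a := by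
    rw [gProd_succ, Function.iterate_succ_apply', hγ, g_f_f_bar]
  have hsq := h.border_sq a ha
  rw [hl, Nat.add_sub_cancel] at hsq
  have hc := c.c_ne_zero (Q.bar a)
  have hBα : gProd x (Q.bar a) (l + 1 + 1) * x a = 0 := by
    rw [hA, gProd_succ, hγ, mul_assoc, mul_assoc, ← mul_assoc (x (Q.f _)), hγα, mul_zero]
  have hααA : ∀ k, x a * (x a * gProd x (Q.bar a) (k + 1)) = 0 := fun k => by
    rw [gProd_succ', ← mul_assoc, ← mul_assoc, hαβ, zero_mul]
  -- The border term drops out since B_ᾱ x_α = 0. As B_ᾱ is thus a multiple of x_α³, the remaining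
  -- products vanish by x_α² x_ᾱ = 0 and x_{f²(ᾱ)} x_α² = 0.
  have hcube : x a * x a * x a = c.c (Q.bar a) • gProd x (Q.bar a) (l + 1 + 1) := by
    rw [hsq, add_mul, smul_mul_assoc, smul_mul_assoc, hBα, smul_zero, add_zero, ← hA]
  have hαB : x a * gProd x (Q.bar a) (l + 1 + 1) = 0 := by
    have h4 : x a * (x a * x a * x a) = 0 := by
      rw [mul_assoc (x a) (x a) (x a), hsq]
      simp only [mul_add, mul_smul_comm, hααA, smul_zero, add_zero]
    rw [hcube, mul_smul_comm] at h4
    exact (smul_eq_zero.mp h4).resolve_left hc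
  have hBβ : gProd x (Q.bar a) (l + 1 + 1) * x (Q.bar a) = 0 := by
    have h4 : x a * x a * x a * x (Q.bar a) = 0 := by
      rw [mul_assoc (x a) (x a) (x a), mul_assoc, hαβ, mul_zero]
    rw [hcube, smul_mul_assoc] at h4
    exact (smul_eq_zero.mp h4).resolve_left hc
  have hγB : x (Q.f (Q.f (Q.bar a))) * gProd x (Q.bar a) (l + 1 + 1) = 0 := by
    have h4 : x (Q.f (Q.f (Q.bar a))) * (x a * x a * x a) = 0 := by
      rw [← mul_assoc, ← mul_assoc, hγα, zero_mul]
    rw [hcube, mul_smul_comm] at h4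
    exact (smul_eq_zero.mp h4).resolve_left hc
  have hend := h.gProd_mul_src (Q.bar a) (l := l + 1 + 1) (by omega)
  have hbeg := h.src_mul_gProd (Q.bar a) (l := l + 1 + 1) (by omega)
  rw [← hl, m.iterate_g_len, hl, Q.src_bar] at hend
  rw [Q.src_bar] at hbeg
  rw [hl]
  refine ⟨fun y => ?_, fun y => ?_⟩
  · by_cases hy : Q.src y = Q.src a
    · rcases Q.eq_or_eq_bar a y hy with rfl | rfl
      · exact hBα
      · exact hBβ
    · exact h.mul_eq_zero hend (h.src_mul y) (Ne.symm hy)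
  · by_cases hy : Q.tgt y = Q.src a
    · rcases (tgt_eq_src_iff a y).mp hy with rfl | rfl
      · rw [hf, hf]
        exact hαB
      · exact hγB
    · exact h.mul_eq_zero (h.mul_tgt y) hbeg hy

end IsSolution

end Border

theorem algHom_gProd {Q : TriangulationQuiver} {K R R' : Type*} [Field K] [Ring R] [Algebra K R]
    [Ring R'] [Algebra K R'] (F : R →ₐ[K] R') (x : Q.Arrow → R) (a : Q.Arrow) (l : ℕ) :
    F (gProd x a l) = gProd (fun a => F (x a)) a l :=
  map_gProd (F : R →+* R') x a l

/-! ### Dimensions of socle deformations. -/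

namespace SocleDeformedAlgebra

variable {Q : TriangulationQuiver} {K : Type u} [Field K]
  (m : Q.WeightFunction) (c : Q.ParameterFunction K) (b : Q.BorderFunction K)

/-- A border loop at a border vertex. -/
noncomputable def borderLoop (i : Q.border) : Q.Arrow := i.2.choose

theorem borderLoop_isBorderLoop (i : Q.border) : Q.IsBorderLoop (borderLoop i) :=
  i.2.choose_spec.1

theorem src_borderLoop (i : Q.border) : Q.src (borderLoop i) = i := i.2.choose_spec.2

/-- The path `B_ᾱ` for the border loop `α` at a border vertex. -/
noncomputable def borderElem (i : Q.border) : SocleDeformedAlgebra m c b :=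
  gProd (arrow m c b) (Q.bar (borderLoop i)) (m.len (Q.bar (borderLoop i)))

theorem vertex_mul_borderElem (i : Q.border) :
    vertex m c b i * borderElem m c b i = borderElem m c b i := by
  have h1 := m.two_le_len (Q.bar (borderLoop i))
  have h2 := (isPathSystem m c b).src_mul_gProd (Q.bar (borderLoop i))
    (l := m.len (Q.bar (borderLoop i))) (by omega)
  rwa [Q.src_bar, src_borderLoop] at h2

theorem borderElem_mul_vertex (i : Q.border) :
    borderElem m c b i * vertex m c b i = borderElem m c b i := by
  have h1 := m.two_le_len (Q.bar (borderLoop i))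
  have h2 := (isPathSystem m c b).gProd_mul_src (Q.bar (borderLoop i))
    (l := m.len (Q.bar (borderLoop i))) (by omega)
  rwa [m.iterate_g_len, Q.src_bar, src_borderLoop] at h2

theorem exists_mul_borderElem (i : Q.border) (r : SocleDeformedAlgebra m c b) :
    (∃ k : K, r * borderElem m c b i = k • borderElem m c b i) ∧
      ∃ k : K, borderElem m c b i * r = k • borderElem m c b i := by
  have hs := isSolution m c b
  have hr : r ∈ Algebra.adjoin K (Set.range (vertex m c b) ∪ Set.range (arrow m c b)) := by
    rw [adjoin_eq_top]; trivial
  induction hr using Algebra.adjoin_induction with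
  | mem y hy =>
    rcases hy with ⟨j, rfl⟩ | ⟨a, rfl⟩
    · by_cases hj : j = i
      · subst hj
        exact ⟨⟨1, by rw [one_smul, vertex_mul_borderElem]⟩,
          ⟨1, by rw [one_smul, borderElem_mul_vertex]⟩⟩
      · exact ⟨⟨0, by rw [zero_smul, hs.e_mul_eq_zero (vertex_mul_borderElem m c b i) hj]⟩,
          ⟨0, by rw [zero_smul, hs.mul_e_eq_zero (borderElem_mul_vertex m c b i) (Ne.symm hj)]⟩⟩
    · have h1 := hs.border_gProd_len_mul (borderLoop_isBorderLoop i)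
      exact ⟨⟨0, by rw [zero_smul]; exact h1.2 a⟩, ⟨0, by rw [zero_smul]; exact h1.1 a⟩⟩
  | algebraMap k =>
    exact ⟨⟨k, (Algebra.smul_def _ _).symm⟩,
      ⟨k, by rw [← Algebra.commutes, ← Algebra.smul_def]⟩⟩
  | add y z _ _ hy hz =>
    obtain ⟨⟨k, hk⟩, ⟨l, hl⟩⟩ := hy
    obtain ⟨⟨k', hk'⟩, ⟨l', hl'⟩⟩ := hz
    exact ⟨⟨k + k', by rw [add_mul, hk, hk', add_smul]⟩,
      ⟨l + l', by rw [mul_add, hl, hl', add_smul]⟩⟩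
  | mul y z _ _ hy hz =>
    obtain ⟨⟨k, hk⟩, ⟨l, hl⟩⟩ := hy
    obtain ⟨⟨k', hk'⟩, ⟨l', hl'⟩⟩ := hz
    exact ⟨⟨k' * k, by rw [mul_assoc, hk', mul_smul_comm, hk, smul_smul]⟩,
      ⟨l * l', by rw [← mul_assoc, hl, smul_mul_assoc, hl', smul_smul]⟩⟩

/-- The ideal spanned by the paths `B` at the border vertices. -/
noncomputable def borderIdeal : Ideal (SocleDeformedAlgebra m c b) where
  __ := (Submodule.span K (Set.range (borderElem m c b))).toAddSubmonoid
  smul_mem' r s hs := by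
    change r * s ∈ Submodule.span K (Set.range (borderElem m c b))
    change s ∈ Submodule.span K (Set.range (borderElem m c b)) at hs
    induction hs using Submodule.span_induction with
    | mem s hs =>
      obtain ⟨i, rfl⟩ := hs
      obtain ⟨k, hk⟩ := (exists_mul_borderElem m c b i r).1
      rw [hk]
      exact Submodule.smul_mem _ _ (Submodule.subset_span ⟨i, rfl⟩)
    | zero => rw [mul_zero]; exact Submodule.zero_mem _
    | add s t _ _ hs ht => rw [mul_add]; exact Submodule.add_mem _ hs ht
    | smul k s _ hs => rw [mul_smul_comm]; exact Submodule.smul_mem _ _ hs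

theorem mem_borderIdeal {s : SocleDeformedAlgebra m c b} :
    s ∈ borderIdeal m c b ↔ s ∈ Submodule.span K (Set.range (borderElem m c b)) := Iff.rfl

instance borderIdeal_isTwoSided : (borderIdeal m c b).IsTwoSided := by
  refine ⟨fun {s} r hs => ?_⟩
  rw [mem_borderIdeal] at hs ⊢
  induction hs using Submodule.span_induction with
  | mem s hs =>
    obtain ⟨i, rfl⟩ := hs
    obtain ⟨k, hk⟩ := (exists_mul_borderElem m c b i r).2
    rw [hk]
    exact Submodule.smul_mem _ _ (Submodule.subset_span ⟨i, rfl⟩)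
  | zero => rw [zero_mul]; exact Submodule.zero_mem _
  | add s t _ _ hs ht => rw [add_mul]; exact Submodule.add_mem _ hs ht
  | smul k s _ hs => rw [smul_mul_assoc]; exact Submodule.smul_mem _ _ hs

theorem borderElem_mem (i : Q.border) : borderElem m c b i ∈ borderIdeal m c b :=
  Submodule.subset_span ⟨i, rfl⟩

/-- Modulo the border paths the deformation term disappears, so the quotient of the deformed algebra
satisfies the relations of Λ. -/
theorem exists_hom_quotient : ∃ F : WeightedAlgebra m c →ₐ[K]
    SocleDeformedAlgebra m c b ⧸ borderIdeal m c b, Function.Surjective F ∧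
      ∀ i, F (borderElem m c 0 i) = 0 := by
  let π := Ideal.Quotient.mkₐ K (borderIdeal m c b)
  have hs := (isSolution m c b).map π
  have hB : ∀ i, π (borderElem m c b i) = 0 := fun i =>
    Ideal.Quotient.eq_zero_iff_mem.mpr (borderElem_mem m c b i)
  have hs0 : IsSolution m c 0 (fun i => π (vertex m c b i)) fun a => π (arrow m c b a) :=
    { hs with
      border_sq := fun a ha => by
        have h1 : gProd (fun a => π (arrow m c b a)) (Q.bar a) (m.len (Q.bar a)) = 0 := by
          have h2 := hB ⟨Q.src a, a, ha, rfl⟩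
          have h3 : borderLoop ⟨Q.src a, a, ha, rfl⟩ = a := by
            refine (Q.eq_or_eq_bar a _ (src_borderLoop _)).resolve_right fun h' => ?_
            have h4 := (borderLoop_isBorderLoop ⟨Q.src a, a, ha, rfl⟩).tgt_eq
            rw [h', Q.src_bar] at h4
            exact not_loop_bar ha.tgt_eq h4
          rw [borderElem, h3] at h2
          exact (algHom_gProd π (arrow m c b) _ _).symm.trans h2
        rw [hs.border_sq a ha, h1, smul_zero, smul_zero] }
  obtain ⟨F, hFe, hFx⟩ := exists_lift hs0
  refine ⟨F, ?_, fun i => ?_⟩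
  · have h1 : F.range = ⊤ := by
      rw [eq_top_iff]
      have h2 : (⊤ : Subalgebra K (SocleDeformedAlgebra m c b ⧸ borderIdeal m c b)) =
          (⊤ : Subalgebra K (SocleDeformedAlgebra m c b)).map π := by
        rw [Algebra.map_top]
        exact ((AlgHom.range_eq_top _).mpr (Ideal.Quotient.mkₐ_surjective K _)).symm
      rw [h2, ← adjoin_eq_top, AlgHom.map_adjoin, Algebra.adjoin_le_iff]
      rintro _ ⟨_, ⟨i, rfl⟩ | ⟨a, rfl⟩, rfl⟩
      · exact ⟨_, hFe i⟩
      · exact ⟨_, hFx a⟩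
    exact (AlgHom.range_eq_top _).mp h1
  · have h1 : F (borderElem m c 0 i) = gProd (fun a => F (arrow m c 0 a)) _ _ :=
      algHom_gProd F (arrow m c 0) _ _
    rw [h1, funext hFx, ← hB i]
    exact (algHom_gProd π (arrow m c b) _ _).symm

theorem linearIndependent_borderElem : LinearIndependent K (borderElem m c 0) := by
  classical
  have hs := isPathSystem m c (0 : Q.BorderFunction K)
  rw [Fintype.linearIndependent_iff]
  intro k hk i
  have h1 := congrArg (vertex m c 0 i * ·) hk
  simp only [Finset.mul_sum, mul_zero, mul_smul_comm] at h1
  rw [Finset.sum_eq_single i, vertex_mul_borderElem] at h1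
  · refine (smul_eq_zero.mp h1).resolve_right fun h2 => ?_
    have ha := borderLoop_isBorderLoop i
    have h5 := (WeightedAlgebra.isSolution m c).smul_gProd_len_bar (borderLoop i)
    rw [borderElem] at h2
    rw [h2, smul_zero] at h5
    exact gProd_len_ne_zero_of_border m c ha
      ((smul_eq_zero.mp h5.symm).resolve_left (c.c_ne_zero _))
  · intro j _ hj
    rw [hs.e_mul_eq_zero (vertex_mul_borderElem m c 0 j) fun h' => hj (Subtype.ext h'.symm),
      smul_zero]
  · exact fun h' => absurd (Finset.mem_univ i) h'

/-- The dimension of a socle deformation of `Λ` is at most that of `Λ`. -/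
theorem finrank_le : Module.Finite K (SocleDeformedAlgebra m c b) ∧
    Module.finrank K (SocleDeformedAlgebra m c b) ≤ Module.finrank K (WeightedAlgebra m c) := by
  classical
  have := WeightedAlgebra.module_finite m c
  obtain ⟨F, hF, hFB⟩ := exists_hom_quotient m c b
  let π := (Ideal.Quotient.mkₐ K (borderIdeal m c b)).toLinearMap
  have hπ : LinearMap.range π = ⊤ :=
    LinearMap.range_eq_top.mpr (Ideal.Quotient.mkₐ_surjective K _)
  have hker : LinearMap.ker π = Submodule.span K (Set.range (borderElem m c b)) := by
    ext s
    exact Ideal.Quotient.eq_zero_iff_mem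
  have hfin : Module.Finite K (SocleDeformedAlgebra m c b ⧸ borderIdeal m c b) :=
    Module.Finite.of_surjective F.toLinearMap hF
  have hfin' : Module.Finite K (SocleDeformedAlgebra m c b) := by
    refine ⟨Submodule.fg_of_fg_map_of_fg_inf_ker π ?_ ?_⟩
    · rw [Submodule.map_top, hπ]
      exact hfin.fg_top
    · rw [top_inf_eq, hker]
      exact Submodule.fg_span (Set.finite_range _)
  refine ⟨hfin', ?_⟩
  -- The deformed algebra exceeds the common quotient by at most one dimension per border vertex,
  -- whereas Λ exceeds it by at least as much, its border paths being independent and killed by F.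
  have h1 := LinearMap.finrank_range_add_finrank_ker π
  have h2 := LinearMap.finrank_range_add_finrank_ker F.toLinearMap
  rw [hπ, finrank_top, hker] at h1
  rw [LinearMap.range_eq_top.mpr hF, finrank_top] at h2
  have h3 : Module.finrank K (Submodule.span K (Set.range (borderElem m c b))) ≤
      Fintype.card Q.border := finrank_range_le_card _
  have h4 : Fintype.card Q.border ≤ Module.finrank K (LinearMap.ker F.toLinearMap) := by
    rw [← finrank_span_eq_card (linearIndependent_borderElem m c)]
    refine Submodule.finrank_mono (Submodule.span_le.mpr ?_)
    rintro _ ⟨i, rfl⟩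
    exact hFB i
  omega

end SocleDeformedAlgebra

/-! ### Comparison of the symmetric algebra with a socle deformation. -/

section Main

variable {Q : TriangulationQuiver} {K : Type v} [Field K] {A : Type u} [Ring A] [Algebra K A]

/-- From N ⊆ X + N² one gets N^j ⊆ X^j + N^{j+1}. Descending from a vanishing power, every positive
power of N lies in the image, which contains the powers of X; the vertices supply the rest. -/
theorem IsSocleLift.range_eq_top [DecidableEq Q.Vertex] {m : Q.WeightFunction}
    {c : Q.ParameterFunction K} {B : LinearMap.BilinForm K A} {ε : A →ₐ[K] (Q.Vertex → K)}
    {ψ : WeightedAlgebra m c →ₐ[K] A ⧸ socle A} {e : Q.Vertex → A} {x : Q.Arrow → A}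
    (h : IsSocleLift m c B ε ψ e x) {R : Type*} [Ring R] [Algebra K R] (θ : R →ₐ[K] A)
    (hx : ∀ a, x a ∈ θ.range) (he : ∀ i, e i ∈ θ.range) : LinearMap.range θ.toLinearMap = ⊤ := by
  obtain ⟨k, hN⟩ := h.nilpotent
  set N := LinearMap.ker ε.toLinearMap with hNdef
  set X := Submodule.span K (Set.range x) with hX
  have hXN : X ≤ N := by
    rw [Submodule.span_le]
    rintro _ ⟨a, rfl⟩
    exact h.aug_arrow a
  have hXW : X ≤ LinearMap.range θ.toLinearMap := by
    rw [Submodule.span_le]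
    rintro _ ⟨a, rfl⟩
    exact hx a
  have hpow : ∀ j, N ^ j ≤ X ^ j ⊔ N ^ (j + 1) := by
    intro j
    induction j with
    | zero => rw [pow_zero, pow_zero]; exact le_sup_left
    | succ j ih =>
      rw [pow_succ]
      refine (mul_le_mul' ih le_rfl).trans ?_
      rw [Submodule.sup_mul, ← pow_succ]
      refine sup_le ((mul_le_mul' le_rfl h.ker_le).trans ?_) le_sup_right
      rw [Submodule.mul_sup, ← pow_succ]
      refine sup_le le_sup_left ((mul_le_mul' (pow_le_pow_left' hXN j) le_rfl).trans ?_)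
      rw [← pow_add]
      exact le_sup_right
  have hXj : ∀ j, X ^ j ≤ LinearMap.range θ.toLinearMap := fun j => by
    refine (pow_le_pow_left' hXW j).trans ?_
    rw [LinearMap.range_eq_map, ← Submodule.map_pow]
    exact Submodule.map_mono le_top
  have hNj : ∀ i j, i + j = k + 1 → N ^ j ≤ LinearMap.range θ.toLinearMap := by
    intro i
    induction i with
    | zero =>
      intro j hj
      rw [zero_add] at hj
      rw [hj, pow_succ, hN, Submodule.bot_mul]
      exact bot_le
    | succ i ih =>
      intro j hj
      exact (hpow j).trans (sup_le (hXj j) (ih (j + 1) (by omega)))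
  rw [eq_top_iff]
  intro r _
  obtain ⟨n, hn, hr⟩ := exists_eq_sum_add h.aug r
  rw [hr]
  refine Submodule.add_mem _ (Submodule.sum_mem _ fun i _ => Submodule.smul_mem _ _ (he i)) ?_
  have := hNj k 1 rfl
  rw [pow_one] at this
  exact this hn

theorem _root_.FDAlgebra.finrank_quotient_socle {K R : Type*} [Field K] [Ring R] [Algebra K R]
    [Module.Finite K R] :
    Module.finrank K (R ⧸ socle R) + Module.finrank K ((socle R).restrictScalars K) =
      Module.finrank K R := by
  have h1 := LinearMap.finrank_range_add_finrank_ker (Ideal.Quotient.mkₐ K (socle R)).toLinearMap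
  rw [LinearMap.range_eq_top.mpr (Ideal.Quotient.mkₐ_surjective K _), finrank_top] at h1
  have h2 : LinearMap.ker (Ideal.Quotient.mkₐ K (socle R)).toLinearMap =
      (socle R).restrictScalars K := by
    ext s
    exact Ideal.Quotient.eq_zero_iff_mem
  rwa [h2] at h1

/-- A symmetric algebra that is socle equivalent to a weighted triangulation algebra is a socle
deformation of it. -/
theorem exists_algEquiv_socleDeformedAlgebra [Module.Finite K A] (m : Q.WeightFunction)
    (c : Q.ParameterFunction K) (hind : IsIndecomposable A) (hsymm : IsSymmetricAlgebra K A)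
    (hsoc : SocleEquivalent K A (WeightedAlgebra m c)) :
    ∃ b : Q.BorderFunction K, Nonempty (A ≃ₐ[K] SocleDeformedAlgebra m c b) := by
  classical
  obtain ⟨B, hB₁, hB₂, hB₃⟩ := hsymm
  have hB : IsSymmetrizingForm B := ⟨hB₁, hB₂, hB₃⟩
  obtain ⟨ε, ψ, e, x₀, h₀, hx₀⟩ := exists_isSocleLift m c hB hind hsoc
  obtain ⟨x, b, h, hb⟩ := h₀.exists_isSolution hx₀
  obtain ⟨θ, hθe, hθx⟩ := exists_lift hb
  have hsurj := h.range_eq_top θ (fun a => ⟨_, hθx a⟩) fun i => ⟨_, hθe i⟩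
  have hΛ := WeightedAlgebra.module_finite m c
  obtain ⟨hfin, hle⟩ := finrank_le m c b
  -- The quotients by the socles have equal dimension. The number of vertices bounds dim soc(Λ) from
  -- above by self-injectivity and equals dim soc(A) by symmetry.
  have hdim : Module.finrank K (WeightedAlgebra m c) ≤ Module.finrank K A := by
    obtain ⟨-, hinj, ⟨φ⟩⟩ := hsoc
    obtain ⟨ε₀, hεe, hεx⟩ := exists_augmentation m c (0 : Q.BorderFunction K)
    obtain ⟨k, hN⟩ := h.nilpotent
    obtain ⟨k₀, hN₀⟩ := WeightedAlgebra.exists_ker_pow_eq_bot hεe hεx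
    have h1 := finrank_socle_le (R := WeightedAlgebra m c) (isPathSystem m c 0).complete hεe hN₀
      hinj
    have h2 := hB.finrank_socle h.complete h.aug hN
    have h3 := φ.toLinearEquiv.finrank_eq
    have h4 := finrank_quotient_socle (K := K) (R := A)
    have h5 := finrank_quotient_socle (K := K) (R := WeightedAlgebra m c)
    omega
  refine ⟨b, ⟨(AlgEquiv.ofBijective θ ⟨?_, ?_⟩).symm⟩⟩
  · have h1 := LinearMap.finrank_range_add_finrank_ker θ.toLinearMap
    rw [hsurj, finrank_top] at h1
    have h2 : LinearMap.ker θ.toLinearMap = ⊥ := by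
      rw [← Submodule.finrank_eq_zero (R := K)]
      omega
    exact LinearMap.ker_eq_bot.mp h2
  · exact LinearMap.range_eq_top.mp hsurj

end Main

end TriangulationQuiver

/-- A surface without boundary has no border loops. -/
theorem DirectedTriangulation.isEmpty_border {S : Type*} [TopologicalSpace S] [T2Space S]
    [CompactSpace S] [ConnectedSpace S] [ChartedSpace (EuclideanHalfSpace 2) S]
    (T : DirectedTriangulation S) (h : (𝓡∂ 2).boundary S = ∅) : IsEmpty T.quiver.border := by
  refine ⟨?_⟩
  rintro ⟨_, a, ha, -⟩
  change T.arrowPerm a = a at ha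
  rcases a with s | s
  · have h1 : T.next s = s := Sum.inl.inj ha
    have h2 := congrArg Prod.snd h1
    simp only [next] at h2
    split_ifs at h2 <;> omega
  -- The vertex i + 1 of a triangle lies on its side i, so a free side would give a point of the
  -- empty boundary.
  · have h1 := (T.free_iff_boundary s.1).mp s.2
      (s.1.1, ⟨Pi.single (s.1.2 + 1) 1, single_mem_stdSimplex ℝ _⟩) rfl
      (by simp)
    rw [h] at h1
    exact h1

theorem theorem1p2 {K : Type*} [Field K] [IsAlgClosed K]
    -- a directed triangulated surface with weight and parameter functions
    {S : Type*} [TopologicalSpace S] [T2Space S] [CompactSpace S] [ConnectedSpace S]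
    [ChartedSpace (EuclideanHalfSpace 2) S] (T : DirectedTriangulation S)
    (m : T.quiver.WeightFunction) (c : T.quiver.ParameterFunction K)
    -- the weighted surface algebra is not the singular disc algebra
    (hD : IsEmpty (TriangulationQuiver.WeightedAlgebra m c ≃ₐ[K]
      TriangulationQuiver.SingularDiscAlgebra K))
    {A : Type*} [Ring A] [Algebra K A] [Module.Finite K A]
    (hbasic : FDAlgebra.IsBasic A) (hind : FDAlgebra.IsIndecomposable A)
    (hsymm : FDAlgebra.IsSymmetricAlgebra K A)
    (hrank : 2 ≤ Module.rank ℤ (FDAlgebra.GrothendieckGroup A))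
    (hsoc : FDAlgebra.SocleEquivalent K A (TriangulationQuiver.WeightedAlgebra m c)) :
    ((𝓡∂ 2).boundary S = ∅ →
      Nonempty (A ≃ₐ[K] TriangulationQuiver.WeightedAlgebra m c)) ∧
    ((𝓡∂ 2).boundary S ≠ ∅ →
      ∃ b : T.quiver.BorderFunction K,
        Nonempty (A ≃ₐ[K] TriangulationQuiver.SocleDeformedAlgebra m c b)) := by
  have main := TriangulationQuiver.exists_algEquiv_socleDeformedAlgebra m c hind hsymm hsoc
  refine ⟨fun h => ?_, fun _ => main⟩
  obtain ⟨b, hb⟩ := main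
  have := T.isEmpty_border h
  rwa [Subsingleton.elim b 0] at hb
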